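/- Fix $1\le p<\infty$. For a Dirichlet polynomial $P(s)=\sum_{n\le N}a_n n^{-s}$ put $\|P\|_p=\sup_{\sigma>0}\Big(\lim_{T\to\infty}\frac1{2T}\int_{-T}^{T}|P(\sigma+it)|^p\,dt\Big)^{1/p}$, and let $\mathscr H^p$ be the closure of the Dirichlet polynomials in this norm, regarded as a space of Dirichlet series $f(s)=\sum_{n\ge1}a_n n^{-s}$. Let $m_\infty$ be the normalized Haar measure of the infinite torus $\mathbb T^\infty$, whose points $\chi=(\chi_j)_{j\geq 1}$ are viewed as characters on the positive rationals by $\chi(p_j)=\chi_j$, where $p_j$ is the $j$-th prime, and write $\mathfrak p^{-i\tau}=(2^{-i\tau},3^{-i\tau},5^{-i\tau},\dots)$ and $\mathbb C_\kappa=\{s=\sigma+it:\sigma>\kappa\}$. For $f\in\mathscr H^p$ let $f^*:\mathbb T^\infty\to\mathbb C$ be a representative of the corresponding element of $H^p(\mathbb T^\infty)$, i.e. of the element of $L^p(\mathbb T^\infty)$ whose Fourier coefficient at $q\in\mathbb Q_+$ is $a_q$ if $q\in\mathbb N$ and $0$ otherwise. Let $E_f=E_f(f^*)$ be the set of those $\chi\in\mathbb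 T^\infty$ for which $\tau\mapsto f^*(\chi\mathfrak p^{-i\tau})$ is locally in $L^p(\mathbb R)$ and $$\|f\|_p^p=\lim_{T\to\infty}\frac1{2T}\int_{-T}^{T}|f^*(\chi\mathfrak p^{-i\tau})|^p\,d\tau .$$ For $\chi\in E_f$ let $C_f(\chi)$ be the smallest $C\ge0$ such that $\int_{-T}^{0}|f^*(\chi\mathfrak p^{-i\tau})|^p\,d\tau\le C(1+T)$ and $\int_{0}^{T}|f^*(\chi\mathfrak p^{-i\tau})|^p\,d\tau\le C(1+T)$ for all $T>0$, let $$F_\chi(s)=\int_{-\infty}^{\infty}f^*(\chi\mathfrak p^{-i\tau})\,\frac{\sigma}{\sigma^2+(t-\tau)^2}\,\frac{d\tau}{\pi},\qquad s=\sigma+it\in\mathbb C_0,$$ and let $f_\chi(s)=\sum_{n\ge1}a_n\chi(n)n^{-s}$ for $s\in\mathbb C_{1/2}$. **Theorem.** For every $f\in\mathscr H^p$ and every representative $f^*$: 1. $E_f$ has full measure in $\mathbb T^\infty$. For every $\chi\in E_f$, the integral $F_\chi(s)$ converges absolutely for all $s\in\mathbb C_0$, the constant $C_f(\chi)$ exists,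 and $$\sup_{\sigma>0}\ \sup_{T\ge1}\ \frac1{2T}\int_{-T}^{T}|F_\chi(\sigma+it)|^p\,dt\le 6\,C_f(\chi).$$ 2. For almost every $\chi\in E_f$, the function $F_\chi$ is analytic in $\mathbb C_0$, the series defining $f_\chi$ converges absolutely in $\mathbb C_{1/2}$, and $F_\chi=f_\chi$ in $\mathbb C_{1/2}$. Thus $F_\chi$ is the analytic continuation of $f_\chi$ to $\mathbb C_0$, and it satisfies the estimate in 1. 3. The representative $f^*$ can be changed on a set of measure zero in such a way that the assertions in 2 hold for every $\chi$ in the resulting set $E_f$. -/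

import Mathlib

open MeasureTheory Filter Topology Set

noncomputable section

namespace DirichletHardy

/-! ### Dirichlet polynomials and the space of Dirichlet series -/

/-- The Dirichlet polynomial `∑ aₙ n⁻ˢ` with finitely many coefficients `P n = aₙ`. -/
def polyEval (P : ℕ+ →₀ ℂ) (s : ℂ) : ℂ :=
  P.sum fun n c => c * ((n : ℕ) : ℂ) ^ (-s)

/-- The mean `M_p(σ, P)` of a Dirichlet polynomial on the vertical line `Re s = σ`:
`M_p(σ, P) ^ p = lim_{T → ∞} (1 / 2T) ∫_{-T}^{T} |P(σ + it)| ^ p dt`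
(the limit exists since `P` is almost periodic). -/
def polyMean (p : ℝ) (σ : ℝ) (P : ℕ+ →₀ ℂ) : ℝ :=
  (limUnder atTop fun T : ℝ =>
    1 / (2 * T) * ∫ t in (-T)..T, ‖polyEval P (σ + t * Complex.I)‖ ^ p) ^ (1 / p)

/-- The norm `‖P‖_p = sup_{σ > 0} M_p(σ, P)` of a Dirichlet polynomial
(the supremum is finite since `P` is bounded on `Re s > 0`). -/
def polyNorm (p : ℝ) (P : ℕ+ →₀ ℂ) : ℝ :=
  ⨆ σ : Ioi (0 : ℝ), polyMean p σ P

/-- The sequence of Dirichlet polynomials `P k` is Cauchy for `‖·‖_p`, and its limit is the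
Dirichlet series `∑ aₙ n⁻ˢ` (the coefficients converge to those of the limit). -/
def Approximates (p : ℝ) (P : ℕ → ℕ+ →₀ ℂ) (a : ℕ+ → ℂ) : Prop :=
  (∀ ε > 0, ∃ N, ∀ j ≥ N, ∀ k ≥ N, polyNorm p (P j - P k) < ε) ∧
    ∀ n, Tendsto (fun k => P k n) atTop (𝓝 (a n))

/-- The Dirichlet series `f(s) = ∑ aₙ n⁻ˢ` belongs to `𝓗^p`, the closure of the Dirichlet
polynomials in the norm `‖·‖_p`. -/
def MemHp (p : ℝ) (a : ℕ+ → ℂ) : Prop :=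
  ∃ P, Approximates p P a

/-- The norm `‖f‖_p` of `f(s) = ∑ aₙ n⁻ˢ` in `𝓗^p`: the limit of `‖P k‖_p` for Dirichlet polynomials
`P k` approximating `f` (the limit does not depend on the approximating sequence). -/
def hpNorm (p : ℝ) (a : ℕ+ → ℂ) : ℝ :=
  sInf {r | ∃ P, Approximates p P a ∧ Tendsto (fun k => polyNorm p (P k)) atTop (𝓝 r)}

/-! ### The infinite torus -/

/-- The infinite torus `𝕋^∞`, with coordinates indexed by the primes; a point `χ` is identified
with the character determined by the values `χ(p_j) = χ_j`. -/
abbrev Torus : Type := Nat.Primes → Circle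

instance : MeasurableSpace Circle := borel Circle

instance : BorelSpace Circle := ⟨rfl⟩

/-- The normalized Haar measure `m_∞` on `𝕋^∞`. -/
def haarTorus : Measure Torus := Measure.haarMeasure ⊤

/-- The value `χ(q) = ∏_p χ_p ^ {v_p(q)}` at a positive rational number `q`. -/
def charValue (χ : Torus) (q : ℚ) : Circle :=
  ∏ᶠ p : Nat.Primes, χ p ^ padicValRat p q

/-- The Fourier coefficient of `F` at the positive rational number `q`. -/
def fourierCoeffTorus (F : Torus → ℂ) (q : ℚ) : ℂ :=
  ∫ χ, F χ * (starRingEnd ℂ) (charValue χ q : ℂ) ∂haarTorus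

/-- `F` represents an element of `H^p(𝕋^∞)`: it is in `L^p` and its Fourier coefficients vanish at
all positive rational numbers that are not integers. -/
def MemHpTorus (p : ℝ) (F : Torus → ℂ) : Prop :=
  MemLp F (ENNReal.ofReal p) haarTorus ∧
    ∀ q : ℚ, 0 < q → q ∉ range (Nat.cast : ℕ → ℚ) → fourierCoeffTorus F q = 0

/-- `F` is a representative of the function `f^*` in `H^p(𝕋^∞)` that corresponds to the Dirichlet
series `f(s) = ∑ aₙ n⁻ˢ`, so that `f^*` has the Fourier series `∑ aₙ χ(n)`. -/
def IsBohrLift (p : ℝ) (a : ℕ+ → ℂ) (F : Torus → ℂ) : Prop :=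
  MemHpTorus p F ∧ ∀ n : ℕ+, fourierCoeffTorus F ((n : ℕ) : ℚ) = a n

/-- The Kronecker flow `𝔭^{-iτ} = (2^{-iτ}, 3^{-iτ}, 5^{-iτ}, …)`. -/
def kronecker (τ : ℝ) : Torus := fun p => Circle.exp (-τ * Real.log (p : ℕ))

/-- The function `τ ↦ F(χ 𝔭^{-iτ})`. -/
def orbit (F : Torus → ℂ) (χ : Torus) (τ : ℝ) : ℂ := F (χ * kronecker τ)

/-- The set `E_f` for the Dirichlet series `f` with coefficients `a` and the representative `F` of
`f^*`: the points `χ` for which `τ ↦ F(χ 𝔭^{-iτ})` is locally in `L^p` (so that the integrals make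
sense) and `‖f‖_p ^ p = lim_{T → ∞} (1 / 2T) ∫_{-T}^{T} |F(χ 𝔭^{-iτ})| ^ p dτ`. -/
def ergodicSet (p : ℝ) (a : ℕ+ → ℂ) (F : Torus → ℂ) : Set Torus :=
  {χ | (∀ T > 0, MemLp (orbit F χ) (ENNReal.ofReal p) (volume.restrict (Icc (-T) T))) ∧
    Tendsto (fun T : ℝ => 1 / (2 * T) * ∫ τ in (-T)..T, ‖orbit F χ τ‖ ^ p) atTop
      (𝓝 (hpNorm p a ^ p))}

/-- The constants `C ≥ 0` with `∫_{-T}^0 |F(χ 𝔭^{-iτ})| ^ p dτ ≤ C (1 + T)` and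
`∫_0^T |F(χ 𝔭^{-iτ})| ^ p dτ ≤ C (1 + T)` for all `T > 0`. -/
def growthBounds (p : ℝ) (F : Torus → ℂ) (χ : Torus) : Set ℝ :=
  {C | 0 ≤ C ∧ ∀ T > 0, (∫ τ in (-T)..0, ‖orbit F χ τ‖ ^ p) ≤ C * (1 + T) ∧
    (∫ τ in (0 : ℝ)..T, ‖orbit F χ τ‖ ^ p) ≤ C * (1 + T)}

/-- The constant `C_f(χ)`, the smallest element of `growthBounds`. -/
def growthConst (p : ℝ) (F : Torus → ℂ) (χ : Torus) : ℝ :=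
  sInf (growthBounds p F χ)

/-! ### Half-planes, Poisson integrals and vertical limit functions -/

/-- The half-plane `ℂ_κ = {s : Re s > κ}`. -/
def halfPlane (κ : ℝ) : Set ℂ := {s | κ < s.re}

/-- The Poisson kernel `σ / (σ² + (t - τ)²) / π` of the right half-plane, for `s = σ + it`. -/
def poissonKernelHP (s : ℂ) (τ : ℝ) : ℝ :=
  s.re / (s.re ^ 2 + (s.im - τ) ^ 2) / Real.pi

/-- The half-plane Poisson integral of `τ ↦ F(χ 𝔭^{-iτ})` at the point `s`. -/
def poissonIntegral (F : Torus → ℂ) (χ : Torus) (s : ℂ) : ℂ :=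
  ∫ τ : ℝ, orbit F χ τ * (poissonKernelHP s τ : ℂ)

/-- The `n`-th term `aₙ χ(n) n⁻ˢ` of the vertical limit function `f_χ`. -/
def verticalTerm (a : ℕ+ → ℂ) (χ : Torus) (s : ℂ) (n : ℕ+) : ℂ :=
  a n * (charValue χ ((n : ℕ) : ℚ) : ℂ) * ((n : ℕ) : ℂ) ^ (-s)

/-- The function `g` is analytic in `ℂ_0`, and in `ℂ_{1/2}` it coincides with the vertical limit
function `f_χ(s) = ∑ aₙ χ(n) n⁻ˢ`, where this series converges absolutely. -/
def IsContinuationOfVerticalLimit (a : ℕ+ → ℂ) (χ : Torus) (g : ℂ → ℂ) : Prop :=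
  AnalyticOnNhd ℂ g (halfPlane 0) ∧
    ∀ s ∈ halfPlane (1 / 2), Summable (fun n => ‖verticalTerm a χ s n‖) ∧
      g s = ∑' n, verticalTerm a χ s n

end DirichletHardy

end

open DirichletHardy

/-!
The Bohr correspondence identifies `𝓗^p` with `H^p` of the torus: the Kronecker flow is
equidistributed (`tendsto_mean_continuousMap`), and the Poisson integral contracts `L^p`, so the norm
of a Dirichlet polynomial is the `L^p` norm of a trigonometric polynomial (`polyNorm_eq`).
By uniqueness of Fourier coefficients the polynomials approximating `f` converge in `L^p` to every
Bohr lift `F`, and `‖f‖_p = ‖F‖_p` (`tendsto_eLpNorm_torusPoly_sub`, `hpNorm_eq`).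

That `E_f` has full measure is then the pointwise ergodic theorem for `|F|^p`. Convergence holds
everywhere for continuous functions, and the maximal ergodic inequality extends it to `L^1`
(`ae_tendsto_symmetric_mean_flow`).

For `χ` in `E_f` the orbit has linear growth in the mean. By Jensen's inequality the `p`-th power
means of the Poisson integral are bounded by integrals of `|F|^p` along the orbit against even
weights that decrease away from `0`. Decomposing such a weight into its level sets, which are
intervals, bounds these integrals by the growth constant (`mean_poisson_rpow_le`, with the constant
`2` in place of `6`).

For the analytic continuation, a fast subsequence of the approximating polynomials converges on
almost every orbit in the weighted `L^1` space with weight `(1 + τ²)⁻¹`, so that its Poisson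
integrals, which are twisted Dirichlet polynomials, converge locally uniformly in `Re s > 0` to the
Poisson integral of the orbit of `F`. In `Re s > 1/2` they converge to `∑ aₙ χ(n) n⁻ˢ`, because there
`∑ |aₙ| n^{-σ}` is bounded by a multiple of the norm in `L^1` (`exists_sum_norm_mul_rpow_le`). This is
a consequence of a weighted `ℓ²` estimate of the coefficients, proved one prime at a time. Split a
polynomial `G` into its homogeneous components `g k` in the coordinate of one prime. With
`N = ‖G‖₁` a duality argument gives `‖g k‖₁² ≤ 8 N (N - ‖g 0‖₁)` for `k > 0`, hence
`∑ 9⁻ᵏ ‖g k‖₁² ≤ N²`: the constant is `1`, so it survives the passage to infinitely many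
primes. The few primes for which the weight `9⁻ᵏ` is too small for convergence up to `Re s = 1/2` are
treated with the trivial bound `‖g k‖₁ ≤ N`.

The set where the continuation fails is invariant under the flow, so redefining `F` there as a
constant of the wrong modulus removes it from `E_f` (`exists_representative`).
-/

noncomputable section

namespace DirichletHardy

/-! ### Characters of the torus and the Kronecker flow -/

instance : haarTorus.IsHaarMeasure := by unfold haarTorus; infer_instance
instance : IsProbabilityMeasure haarTorus :=
  ⟨by simpa [haarTorus] using (Measure.haarMeasure_self (G := Torus) (K₀ := ⊤))⟩
instance : haarTorus.Regular := by unfold haarTorus; infer_instance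


lemma finite_padicValRat_ne_zero (q : ℚ) : {p : Nat.Primes | padicValRat p q ≠ 0}.Finite := by
  have hfin : ((q.num.natAbs.primeFactors ∪ q.den.primeFactors : Finset ℕ) : Set ℕ).Finite :=
    Finset.finite_toSet _
  refine (hfin.preimage (f := ((↑) : Nat.Primes → ℕ)) Subtype.val_injective.injOn).subset ?_
  intro p hp
  by_contra hmem
  refine hp ?_
  simp only [Finset.coe_union, mem_preimage, mem_union, SetLike.mem_coe, Nat.mem_primeFactors,
    not_or, not_and_or, not_not] at hmem
  by_cases hq : q = 0
  · simp [hq]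
  have h1 : ¬ (p : ℕ) ∣ q.num.natAbs := by
    have := p.2; have := Int.natAbs_ne_zero.2 (Rat.num_ne_zero.2 hq); tauto
  have h2 : ¬ (p : ℕ) ∣ q.den := by
    have := p.2; have := q.den_ne_zero; tauto
  simp [padicValRat, padicValInt, padicValNat.eq_zero_of_not_dvd h1,
    padicValNat.eq_zero_of_not_dvd h2]

lemma finite_mulSupport_charValue (χ : Torus) (q : ℚ) :
    (Function.mulSupport fun p : Nat.Primes => χ p ^ padicValRat p q).Finite :=
  (finite_padicValRat_ne_zero q).subset fun p hp h => hp (by simp [h])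

lemma charValue_mul_rat (χ : Torus) {q r : ℚ} (hq : q ≠ 0) (hr : r ≠ 0) :
    charValue χ (q * r) = charValue χ q * charValue χ r := by
  unfold charValue
  rw [← finprod_mul_distrib (finite_mulSupport_charValue χ q) (finite_mulSupport_charValue χ r)]
  refine finprod_congr fun p => ?_
  have := Fact.mk p.2
  rw [padicValRat.mul hq hr, zpow_add]

@[simp] lemma charValue_one (χ : Torus) : charValue χ 1 = 1 := by
  simp [charValue]

lemma charValue_inv_rat (χ : Torus) {q : ℚ} (hq : q ≠ 0) :
    charValue χ q⁻¹ = (charValue χ q)⁻¹ := by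
  rw [eq_inv_iff_mul_eq_one, ← charValue_mul_rat χ (inv_ne_zero hq) hq, inv_mul_cancel₀ hq,
    charValue_one]

lemma charValue_mul_torus (χ ψ : Torus) (q : ℚ) :
    charValue (χ * ψ) q = charValue χ q * charValue ψ q := by
  unfold charValue
  rw [← finprod_mul_distrib (finite_mulSupport_charValue χ q) (finite_mulSupport_charValue ψ q)]
  exact finprod_congr fun p => by rw [Pi.mul_apply, mul_zpow]

lemma charValue_prime (χ : Torus) (p : Nat.Primes) : charValue χ ((p : ℕ) : ℚ) = χ p := by
  unfold charValue
  rw [finprod_eq_single _ p]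
  · have := Fact.mk p.2
    simp
  · intro r hr
    have := Fact.mk r.2
    have := Fact.mk p.2
    rw [padicValRat.of_nat, padicValNat_primes (fun h => hr (Subtype.ext h))]
    simp

lemma continuous_charValue (q : ℚ) : Continuous fun χ : Torus => charValue χ q := by
  have h : (fun χ : Torus => charValue χ q) = fun χ =>
      ∏ p ∈ (finite_padicValRat_ne_zero q).toFinset, χ p ^ padicValRat p q := by
    ext1 χ
    refine finprod_eq_prod_of_mulSupport_subset _ fun p hp => ?_
    simpa using fun h => hp (by simp [h])
  rw [h]
  exact continuous_finsetProd _ fun p _ => (continuous_apply p).zpow _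

/-- Along the Kronecker flow the character `χ ↦ χ(n)` is `n^{-iτ}`. -/
lemma charValue_kronecker_nat (τ : ℝ) (n : ℕ) (hn : n ≠ 0) :
    charValue (kronecker τ) (n : ℚ) = Circle.exp (-τ * Real.log n) := by
  induction n using Nat.recOnMul with
  | zero => exact absurd rfl hn
  | one => simp
  | prime p hp => exact charValue_prime (kronecker τ) ⟨p, hp⟩
  | mul a b iha ihb =>
    obtain ⟨ha, hb⟩ := mul_ne_zero_iff.1 hn
    rw [Nat.cast_mul, charValue_mul_rat _ (by exact_mod_cast ha) (by exact_mod_cast hb), iha ha,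
      ihb hb, ← Circle.exp_add, Nat.cast_mul, Real.log_mul (by exact_mod_cast ha)
      (by exact_mod_cast hb), mul_add]

lemma charValue_kronecker (τ : ℝ) {q : ℚ} (hq : 0 < q) :
    charValue (kronecker τ) q = Circle.exp (-τ * Real.log q) := by
  have hn : q.num.natAbs ≠ 0 := by simpa using hq.ne'
  have hnum : ((q.num.natAbs : ℕ) : ℚ) = q.num := by
    have := congrArg (Int.cast : ℤ → ℚ) (Int.natAbs_of_nonneg (Rat.num_pos.2 hq).le)
    rwa [Int.cast_natCast] at this
  have hq' : q = (q.num.natAbs : ℚ) * ((q.den : ℚ))⁻¹ := by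
    rw [hnum, ← div_eq_mul_inv, Rat.num_div_den]
  have hd : (q.den : ℚ) ≠ 0 := by exact_mod_cast q.den_ne_zero
  have hd' : (q.den : ℝ) ≠ 0 := by exact_mod_cast q.den_ne_zero
  have hn' : (q.num.natAbs : ℝ) ≠ 0 := Nat.cast_ne_zero.2 hn
  conv_lhs => rw [hq']
  rw [charValue_mul_rat _ (Nat.cast_ne_zero.2 hn) (inv_ne_zero hd), charValue_inv_rat _ hd,
    charValue_kronecker_nat _ _ hn, charValue_kronecker_nat _ _ q.den_ne_zero, ← Circle.exp_neg,
    ← Circle.exp_add]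
  congr 1
  have : (q : ℝ) = (q.num.natAbs : ℝ) * ((q.den : ℝ))⁻¹ := by
    conv_lhs => rw [hq']
    rw [Rat.cast_mul, Rat.cast_inv, Rat.cast_natCast, Rat.cast_natCast]
  rw [this, Real.log_mul hn' (inv_ne_zero hd'), Real.log_inv]
  ring

lemma kronecker_add (s t : ℝ) : kronecker (s + t) = kronecker s * kronecker t := by
  ext1 p
  simp only [kronecker, Pi.mul_apply, ← Circle.exp_add]
  congr 1; ring

@[simp] lemma kronecker_zero : kronecker 0 = 1 := by
  ext1 p; simp [kronecker]

lemma continuous_kronecker : Continuous kronecker :=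
  continuous_pi fun p => Circle.exp.continuous.comp (by fun_prop)

lemma norm_charValue (χ : Torus) (q : ℚ) : ‖(charValue χ q : ℂ)‖ = 1 := Circle.norm_coe _

lemma integral_charValue_eq_zero {q : ℚ} (hq : 0 < q) (hq1 : q ≠ 1) :
    ∫ χ, (charValue χ q : ℂ) ∂haarTorus = 0 := by
  have hlog : Real.log q ≠ 0 := by
    refine Real.log_ne_zero_of_pos_of_ne_one (by exact_mod_cast hq) (by exact_mod_cast hq1)
  -- Translation by this point of the flow multiplies the character by `-1`.
  have h := integral_mul_right_eq_self (μ := haarTorus) (fun χ => (charValue χ q : ℂ))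
    (kronecker (Real.pi / Real.log q))
  have e : -(Real.pi / Real.log q) * Real.log q = -Real.pi := by field_simp
  simp only [charValue_mul_torus, charValue_kronecker _ hq, e, Circle.coe_mul, Circle.coe_exp,
    integral_mul_const] at h
  have h2 : Complex.exp (((-Real.pi : ℝ) : ℂ) * Complex.I) = -1 := by
    simp [Complex.exp_neg, Complex.exp_pi_mul_I]; 
  rw [h2] at h
  linear_combination (-1 / 2 : ℂ) * h

/-! ### The Poisson kernel of the half-plane -/

lemma poissonKernelHP_nonneg {s : ℂ} (hs : 0 < s.re) (τ : ℝ) : 0 ≤ poissonKernelHP s τ := by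
  unfold poissonKernelHP; positivity

lemma continuous_poissonKernelHP {s : ℂ} (hs : 0 < s.re) : Continuous (poissonKernelHP s) := by
  unfold poissonKernelHP
  refine (Continuous.div (by fun_prop) (by fun_prop) fun τ => ?_).div_const _
  positivity

/-- A constant, continuous in `s`, by which the Poisson kernel `P_s(τ)` is bounded in terms of
`(1 + τ²)⁻¹`. -/
def poissonBound (s : ℂ) : ℝ := ((1 + 2 * s.im ^ 2) / s.re + 2 * s.re) / Real.pi

lemma poissonBound_nonneg {s : ℂ} (hs : 0 < s.re) : 0 ≤ poissonBound s := by
  unfold poissonBound; positivity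

lemma poissonKernelHP_le {s : ℂ} (hs : 0 < s.re) (τ : ℝ) :
    poissonKernelHP s τ ≤ poissonBound s * (1 + τ ^ 2)⁻¹ := by
  unfold poissonKernelHP poissonBound
  rw [div_mul_eq_mul_div]
  gcongr
  rw [← div_eq_mul_inv, div_le_div_iff₀ (by positivity) (by positivity)]
  have h : ((1 + 2 * s.im ^ 2) / s.re + 2 * s.re) * (s.re ^ 2 + (s.im - τ) ^ 2) =
      s.re * (1 + τ ^ 2) + (1 + 2 * s.im ^ 2) / s.re * (s.im - τ) ^ 2 +
        s.re * (2 * s.re ^ 2 + (τ - 2 * s.im) ^ 2) := by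
    field_simp; ring
  rw [h]
  have : 0 ≤ (1 + 2 * s.im ^ 2) / s.re * (s.im - τ) ^ 2 := by positivity
  have : 0 ≤ s.re * (2 * s.re ^ 2 + (τ - 2 * s.im) ^ 2) := by positivity
  linarith

lemma integrable_poissonKernelHP {s : ℂ} (hs : 0 < s.re) : Integrable (poissonKernelHP s) := by
  refine (integrable_inv_one_add_sq.const_mul (poissonBound s)).mono'
    (continuous_poissonKernelHP hs).aestronglyMeasurable (.of_forall fun τ => ?_)
  rw [Real.norm_of_nonneg (poissonKernelHP_nonneg hs τ)]
  exact poissonKernelHP_le hs τ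

lemma poissonKernelHP_ofReal (σ τ : ℝ) :
    poissonKernelHP (σ : ℂ) τ = σ / (σ ^ 2 + τ ^ 2) / Real.pi := by
  simp [poissonKernelHP]

/-- On the vertical line of abscissa `σ`, the Poisson kernel is the Fourier transform of
`e^{-2πσ|x|}`. -/
lemma fourier_exp_neg_abs {σ : ℝ} (hσ : 0 < σ) (ξ : ℝ) :
    FourierTransform.fourier (fun x : ℝ => (Real.exp (-(2 * Real.pi * σ) * |x|) : ℂ)) ξ =
      poissonKernelHP σ ξ := by
  have hpi := Real.pi_pos
  set a : ℂ := 2 * Real.pi * (σ - ξ * Complex.I) with ha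
  set b : ℂ := -(2 * Real.pi * (σ + ξ * Complex.I)) with hb
  have hare : 0 < a.re := by simp [ha]; positivity
  have hbre : b.re < 0 := by simp [hb]; positivity
  have hL : EqOn (fun x : ℝ => Complex.exp (a * x))
      (fun x : ℝ => Complex.exp ((-2 * Real.pi * x * ξ : ℝ) * Complex.I) •
        (Real.exp (-(2 * Real.pi * σ) * |x|) : ℂ)) (Iic 0) := by
    intro x hx
    simp only [abs_of_nonpos (mem_Iic.1 hx), Complex.ofReal_exp, smul_eq_mul, ← Complex.exp_add]
    congr 1
    push_cast; rw [ha]; ring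
  have hR : EqOn (fun x : ℝ => Complex.exp (b * x))
      (fun x : ℝ => Complex.exp ((-2 * Real.pi * x * ξ : ℝ) * Complex.I) •
        (Real.exp (-(2 * Real.pi * σ) * |x|) : ℂ)) (Ioi 0) := by
    intro x hx
    simp only [abs_of_pos (mem_Ioi.1 hx), Complex.ofReal_exp, smul_eq_mul, ← Complex.exp_add]
    congr 1
    push_cast; rw [hb]; ring
  have iL := (integrableOn_exp_mul_complex_Iic hare 0).congr_fun hL measurableSet_Iic
  have iR := (integrableOn_exp_mul_complex_Ioi hbre 0).congr_fun hR measurableSet_Ioi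
  rw [Real.fourier_real_eq_integral_exp_smul, ← intervalIntegral.integral_Iic_add_Ioi iL iR,
    ← setIntegral_congr_fun measurableSet_Iic hL, ← setIntegral_congr_fun measurableSet_Ioi hR,
    integral_exp_mul_complex_Iic hare, integral_exp_mul_complex_Ioi hbre, poissonKernelHP_ofReal]
  have h1 : (σ : ℂ) - ξ * Complex.I ≠ 0 := fun h => by
    have := congrArg Complex.re h; simp at this; exact hσ.ne' this
  have h2 : (σ : ℂ) + ξ * Complex.I ≠ 0 := fun h => by
    have := congrArg Complex.re h; simp at this; exact hσ.ne' this
  have h3 : (σ : ℂ) ^ 2 + ξ ^ 2 ≠ 0 := by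
    have : (σ : ℂ) ^ 2 + ξ ^ 2 = (σ - ξ * Complex.I) * (σ + ξ * Complex.I) := by
      ring_nf; simp
    rw [this]; exact mul_ne_zero h1 h2
  have hpi' : (Real.pi : ℂ) ≠ 0 := by exact_mod_cast hpi.ne'
  rw [ha, hb]
  simp only [Complex.ofReal_zero, mul_zero, Complex.exp_zero]
  push_cast
  field_simp
  ring_nf
  simp

lemma integrable_exp_neg_mul_abs {c : ℝ} (hc : 0 < c) :
    Integrable fun x : ℝ => Real.exp (-c * |x|) := by
  rw [← integrableOn_univ, ← Iic_union_Ioi (a := (0 : ℝ))]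
  refine IntegrableOn.union ?_ ?_
  · refine (integrableOn_exp_mul_Iic hc 0).congr_fun (fun x hx => ?_) measurableSet_Iic
    simp [abs_of_nonpos (mem_Iic.1 hx)]
  · refine (integrableOn_exp_mul_Ioi (neg_lt_zero.2 hc) 0).congr_fun (fun x hx => ?_)
      measurableSet_Ioi
    simp [abs_of_pos (mem_Ioi.1 hx)]

/-- The Poisson integral of the boundary function `τ ↦ e^{-ilτ}` is `e^{-ls}`, for `l ≥ 0`. This is
Fourier inversion. -/
lemma integral_exp_mul_poissonKernelHP {s : ℂ} (hs : 0 < s.re) {l : ℝ} (hl : 0 ≤ l) :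
    ∫ τ : ℝ, Complex.exp (-(l * τ) * Complex.I) * (poissonKernelHP s τ : ℂ) =
      Complex.exp (-(l * s)) := by
  have hpi := Real.pi_pos
  set g : ℝ → ℂ := fun x => (Real.exp (-(2 * Real.pi * s.re) * |x|) : ℂ) with hg
  have hgc : Continuous g := by fun_prop
  have hsre : 0 < ((s.re : ℝ) : ℂ).re := by simpa using hs
  have hfg : FourierTransform.fourier g = fun ξ => (poissonKernelHP (s.re : ℂ) ξ : ℂ) :=
    funext fun ξ => fourier_exp_neg_abs hs ξ
  have hgi : Integrable g := (integrable_exp_neg_mul_abs (by positivity)).ofReal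
  have hinv := congrFun (hgc.fourierInv_fourier_eq hgi (by
    rw [hfg]; exact (integrable_poissonKernelHP hsre).ofReal)) (l / (2 * Real.pi))
  rw [hfg, Real.fourierInv_eq' ] at hinv
  have hshift := integral_sub_left_eq_self (fun τ : ℝ =>
    Complex.exp (-(l * τ) * Complex.I) * (poissonKernelHP s τ : ℂ)) volume s.im
  rw [← hshift]
  have : ∀ x : ℝ, Complex.exp (-(l * ((s.im - x : ℝ) : ℂ)) * Complex.I) *
      (poissonKernelHP s (s.im - x) : ℂ) = Complex.exp (-(l * s.im) * Complex.I) *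
      (Complex.exp (((2 * Real.pi * inner ℝ x (l / (2 * Real.pi)) : ℝ) : ℂ) * Complex.I) •
        (poissonKernelHP (s.re : ℂ) x : ℂ)) := by
    intro x
    have e1 : poissonKernelHP s (s.im - x) = poissonKernelHP (s.re : ℂ) x := by
      simp [poissonKernelHP]
    have e2 : 2 * Real.pi * inner ℝ x (l / (2 * Real.pi)) = l * x := by
      simp; field_simp
    rw [e1, e2, smul_eq_mul, ← mul_assoc, ← Complex.exp_add]
    congr 2
    push_cast; ring
  simp_rw [this]
  rw [integral_const_mul, hinv, hg]
  simp only [Complex.ofReal_exp, ← Complex.exp_add]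
  congr 1
  rw [abs_of_nonneg (by positivity)]
  conv_rhs => rw [← Complex.re_add_im s]
  push_cast
  have hpi' : (Real.pi : ℂ) ≠ 0 := by exact_mod_cast hpi.ne'
  field_simp
  ring

lemma integral_poissonKernelHP {s : ℂ} (hs : 0 < s.re) : ∫ τ, poissonKernelHP s τ = 1 := by
  have h := integral_exp_mul_poissonKernelHP hs le_rfl
  simp only [Complex.ofReal_zero, zero_mul, neg_zero, Complex.exp_zero, one_mul] at h
  exact Complex.ofReal_injective (integral_ofReal.symm.trans h)

lemma lintegral_poissonKernelHP {s : ℂ} (hs : 0 < s.re) :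
    ∫⁻ τ, ENNReal.ofReal (poissonKernelHP s τ) = 1 := by
  rw [← ofReal_integral_eq_lintegral_ofReal (integrable_poissonKernelHP hs)
    (.of_forall (poissonKernelHP_nonneg hs)), integral_poissonKernelHP hs, ENNReal.ofReal_one]

/-- Jensen's inequality for the Poisson integral. The right-hand side may be infinite, and the left-hand
side is then a junk value if the integral diverges. -/
lemma enorm_poisson_rpow_le {p : ℝ} (hp : 1 ≤ p) {s : ℂ} (hs : 0 < s.re) {g : ℝ → ℂ}
    (hg : AEStronglyMeasurable g) :
    ‖∫ τ, g τ * (poissonKernelHP s τ : ℂ)‖ₑ ^ p ≤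
      ∫⁻ τ, ‖g τ‖ₑ ^ p * ENNReal.ofReal (poissonKernelHP s τ) := by
  have hmeas : Measurable fun τ => ENNReal.ofReal (poissonKernelHP s τ) :=
    (continuous_poissonKernelHP hs).measurable.ennreal_ofReal
  set μ : Measure ℝ := volume.withDensity fun τ => ENNReal.ofReal (poissonKernelHP s τ) with hμ
  have : IsProbabilityMeasure μ := ⟨by simp [hμ, lintegral_poissonKernelHP hs]⟩
  have hgμ : AEStronglyMeasurable g μ := hg.mono_ac (withDensity_absolutelyContinuous _ _)
  have hp0 : 0 < p := by linarith
  have conv : ∀ u : ℝ → ENNReal, AEMeasurable u →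
      ∫⁻ τ, u τ ∂μ = ∫⁻ τ, u τ * ENNReal.ofReal (poissonKernelHP s τ) := fun u hu => by
    rw [hμ, lintegral_withDensity_eq_lintegral_mul₀ hmeas.aemeasurable hu]
    simp only [Pi.mul_apply, mul_comm]
  have h1 : ‖∫ τ, g τ * (poissonKernelHP s τ : ℂ)‖ₑ ≤ eLpNorm g 1 μ := by
    refine (enorm_integral_le_lintegral_enorm _).trans ?_
    rw [eLpNorm_one_eq_lintegral_enorm, conv _ hg.enorm]
    refine lintegral_mono fun τ => ?_
    rw [enorm_mul, ← ofReal_norm (poissonKernelHP s τ : ℂ), Complex.norm_real,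
      Real.norm_of_nonneg (poissonKernelHP_nonneg hs τ)]
  have h2 : eLpNorm g 1 μ ≤ eLpNorm g (ENNReal.ofReal p) μ :=
    eLpNorm_le_eLpNorm_of_exponent_le (by simpa using ENNReal.ofReal_le_ofReal hp) hgμ
  rw [eLpNorm_eq_lintegral_rpow_enorm_toReal (by simpa using hp0) ENNReal.ofReal_ne_top,
    ENNReal.toReal_ofReal hp0.le] at h2
  calc _ ≤ ((∫⁻ τ, ‖g τ‖ₑ ^ p ∂μ) ^ (1 / p)) ^ p := by
        gcongr; exact h1.trans h2
    _ = ∫⁻ τ, ‖g τ‖ₑ ^ p ∂μ := by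
        rw [← ENNReal.rpow_mul, one_div, inv_mul_cancel₀ hp0.ne', ENNReal.rpow_one]
    _ = _ := conv _ (hg.enorm.pow_const p)

/-! ### Functions of linear growth on the line -/

/-- The level sets of a weight `w` that decreases on `(0, ∞)` are intervals, on which the growth
condition bounds the integral of `h`. -/
lemma lintegral_Ioi_mul_antitone_le {h : ℝ → ENNReal} (hm : AEMeasurable h) {C : ENNReal}
    (hC : ∀ T > 0, ∫⁻ τ in Ioc 0 T, h τ ≤ C * ENNReal.ofReal (1 + T)) {w : ℝ → ℝ}
    (hw0 : ∀ τ, 0 ≤ w τ) (hwm : Measurable w) (hanti : AntitoneOn w (Ici 0))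
    (hwi : Integrable w) :
    ∫⁻ τ in Ioi 0, h τ * ENNReal.ofReal (w τ) ≤
      C * (ENNReal.ofReal (w 0) + ∫⁻ τ in Ioi 0, ENNReal.ofReal (w τ)) := by
  set μ : Measure ℝ := (volume.restrict (Ioi 0)).withDensity h with hμ
  have hm' : AEMeasurable h (volume.restrict (Ioi 0)) := hm.restrict
  have e1 : ∫⁻ τ in Ioi 0, h τ * ENNReal.ofReal (w τ) = ∫⁻ τ, ENNReal.ofReal (w τ) ∂μ := by
    rw [hμ, lintegral_withDensity_eq_lintegral_mul₀ hm' hwm.ennreal_ofReal.aemeasurable]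
    rfl
  have key : ∀ t ∈ Ioi (0 : ℝ), μ {τ | t < w τ} ≤
      C * ((Ioo 0 (w 0)).indicator 1 t + volume.restrict (Ioi 0) {τ | t < w τ}) := by
    intro t ht
    have hms : MeasurableSet {τ | t < w τ} := measurableSet_lt measurable_const hwm
    -- The level set is, up to its right end point, the interval `(0, L]`.
    set L := volume.restrict (Ioi 0) {τ | t < w τ} with hL
    have hLfin : L ≠ ⊤ := (hwi.integrableOn.measure_gt_lt_top (μ := volume.restrict (Ioi 0)) ht).ne
    have hsub : {τ | t < w τ} ∩ Ioi 0 ⊆ Ioc 0 L.toReal := by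
      rintro x ⟨hx, hx0⟩
      refine ⟨hx0, ?_⟩
      have : ENNReal.ofReal x ≤ L := by
        rw [hL, Measure.restrict_apply hms]
        calc ENNReal.ofReal x = volume (Ioc 0 x) := by simp
          _ ≤ volume ({τ | t < w τ} ∩ Ioi 0) := measure_mono fun y hy =>
            ⟨lt_of_lt_of_le hx (hanti (mem_Ici.2 hy.1.le) (mem_Ici.2 (le_of_lt hx0)) hy.2), hy.1⟩
      exact (ENNReal.ofReal_le_iff_le_toReal hLfin).1 this
    have hμeq : μ {τ | t < w τ} = ∫⁻ τ in {τ | t < w τ} ∩ Ioi 0, h τ := by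
      rw [hμ, withDensity_apply _ hms, Measure.restrict_restrict hms]
    rcases le_or_gt L.toReal 0 with h0 | h0
    · rw [hμeq, Ioc_eq_empty (not_lt.2 h0)] at *
      rw [subset_empty_iff.1 hsub]
      simp
    · have htw : t ∈ Ioo 0 (w 0) := by
        refine ⟨ht, ?_⟩
        by_contra hcon
        have : {τ | t < w τ} ∩ Ioi 0 = ∅ := by
          refine eq_empty_of_forall_notMem fun x ⟨hx, hx0⟩ => hcon ?_
          exact lt_of_lt_of_le hx (hanti (mem_Ici.2 le_rfl) (mem_Ici.2 (le_of_lt hx0))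
            (le_of_lt hx0))
        rw [hL, Measure.restrict_apply hms, this] at h0
        simp at h0
      rw [indicator_of_mem htw, hμeq]
      refine (lintegral_mono_set hsub).trans ((hC _ h0).trans ?_)
      rw [ENNReal.ofReal_add zero_le_one h0.le, ENNReal.ofReal_one, ENNReal.ofReal_toReal hLfin]
      rfl
  rw [e1, lintegral_eq_lintegral_meas_lt _ (.of_forall hw0) hwm.aemeasurable,
    lintegral_eq_lintegral_meas_lt (volume.restrict (Ioi 0)) (.of_forall hw0) hwm.aemeasurable]
  refine (setLIntegral_mono' measurableSet_Ioi key).trans ?_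
  have hmi : Measurable ((Ioo 0 (w 0)).indicator (1 : ℝ → ENNReal)) :=
    measurable_one.indicator measurableSet_Ioo
  have hmw : Measurable fun t : ℝ => volume.restrict (Ioi 0) {τ | t < w τ} :=
    Antitone.measurable fun a b hab => measure_mono fun τ hτ => lt_of_le_of_lt hab hτ
  rw [lintegral_const_mul _ (by exact hmi.add hmw), lintegral_add_left hmi]
  gcongr
  rw [lintegral_indicator measurableSet_Ioo]
  simp only [Pi.one_apply, lintegral_const, MeasurableSet.univ, Measure.restrict_apply, univ_inter,
    one_mul, Measure.restrict_restrict measurableSet_Ioo]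
  exact (measure_mono inter_subset_left).trans (by simp)

lemma setLIntegral_comp_neg (u : ℝ → ENNReal) (s : Set ℝ) :
    ∫⁻ τ in s, u (-τ) = ∫⁻ τ in -s, u τ := by
  have h := (Measure.measurePreserving_neg (volume : Measure ℝ)).setLIntegral_comp_preimage_emb
    (MeasurableEquiv.neg ℝ).measurableEmbedding u (-s)
  rwa [neg_preimage, neg_neg] at h

/-- A function with two-sided linear growth in the mean can be integrated against an even weight
that decreases away from the origin. This is integration by parts, carried out on the level sets
of the weight. -/
lemma lintegral_mul_even_antitone_le {h : ℝ → ENNReal} (hm : AEMeasurable h) {C : ENNReal}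
    (hC : ∀ T > 0, ∫⁻ τ in Ioc 0 T, h τ ≤ C * ENNReal.ofReal (1 + T))
    (hC' : ∀ T > 0, ∫⁻ τ in Ioc (-T) 0, h τ ≤ C * ENNReal.ofReal (1 + T)) {w : ℝ → ℝ}
    (hw0 : ∀ τ, 0 ≤ w τ) (hwm : Measurable w) (heven : ∀ τ, w (-τ) = w τ)
    (hanti : AntitoneOn w (Ici 0)) (hwi : Integrable w) :
    ∫⁻ τ, h τ * ENNReal.ofReal (w τ) ≤
      C * (2 * ENNReal.ofReal (w 0) + ∫⁻ τ, ENNReal.ofReal (w τ)) := by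
  have split : ∀ u : ℝ → ENNReal,
      ∫⁻ τ, u τ = (∫⁻ τ in Ioi 0, u τ) + ∫⁻ τ in Ioi 0, u (-τ) := by
    intro u
    rw [← lintegral_add_compl u measurableSet_Ioi (A := Ioi 0), compl_Ioi]
    congr 1
    rw [setLIntegral_comp_neg, neg_Ioi, neg_zero, setLIntegral_congr Iio_ae_eq_Iic]
  have hneg : Measure.QuasiMeasurePreserving (fun x : ℝ => -x) :=
    (Measure.measurePreserving_neg (volume : Measure ℝ)).quasiMeasurePreserving
  have h1 := lintegral_Ioi_mul_antitone_le hm hC hw0 hwm hanti hwi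
  have h2 := lintegral_Ioi_mul_antitone_le (h := fun τ => h (-τ))
    (hm.comp_quasiMeasurePreserving hneg) (C := C) (fun T hT => by
      rw [setLIntegral_comp_neg, neg_Ioc, neg_zero, setLIntegral_congr Ico_ae_eq_Ioc]
      exact hC' T hT) hw0 hwm hanti hwi
  rw [split, split (fun τ => ENNReal.ofReal (w τ))]
  simp only [heven]
  refine (add_le_add h1 h2).trans (le_of_eq ?_)
  ring

/-- The mean over `t ∈ [-T, T]` of the Poisson kernels `P_{σ+it}(τ)`, in closed form. -/
def poissonAverage (σ T τ : ℝ) : ℝ :=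
  (Real.arctan ((T - τ) / σ) + Real.arctan ((T + τ) / σ)) / Real.pi / (2 * T)

lemma lintegral_poissonKernelHP_Icc {σ T : ℝ} (hσ : 0 < σ) (hT : 0 < T) (τ : ℝ) :
    ENNReal.ofReal (1 / (2 * T)) *
      ∫⁻ t in Icc (-T) T, ENNReal.ofReal (poissonKernelHP (σ + t * Complex.I) τ) =
      ENNReal.ofReal (poissonAverage σ T τ) := by
  have hP : ∀ t : ℝ, poissonKernelHP (σ + t * Complex.I) τ =
      σ / (σ ^ 2 + (t - τ) ^ 2) / Real.pi := fun t => by simp [poissonKernelHP]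
  simp only [hP]
  have hcont : Continuous fun t : ℝ => σ / (σ ^ 2 + (t - τ) ^ 2) / Real.pi :=
    (Continuous.div (by fun_prop) (by fun_prop) fun t => by positivity).div_const _
  have hderiv : ∀ t ∈ uIcc (-T) T, HasDerivAt (fun t : ℝ => Real.arctan ((t - τ) / σ) / Real.pi)
      (σ / (σ ^ 2 + (t - τ) ^ 2) / Real.pi) t := fun t _ => by
    have h := ((((hasDerivAt_id t).sub_const τ).div_const σ).arctan).div_const Real.pi
    refine h.congr_deriv ?_
    simp only [id]
    field_simp
  have hint := intervalIntegral.integral_eq_sub_of_hasDerivAt hderiv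
    (hcont.intervalIntegrable _ _)
  rw [← ofReal_integral_eq_lintegral_ofReal
    (hcont.integrableOn_Icc) (.of_forall fun t => by positivity), integral_Icc_eq_integral_Ioc,
    ← intervalIntegral.integral_of_le (by linarith), hint,
    ← ENNReal.ofReal_mul (by positivity), poissonAverage]
  congr 1
  rw [show (-T - τ) / σ = -((T + τ) / σ) by ring, Real.arctan_neg]
  ring

lemma poissonAverage_nonneg {σ T : ℝ} (hσ : 0 < σ) (hT : 0 < T) (τ : ℝ) :
    0 ≤ poissonAverage σ T τ := by
  have h : -Real.arctan ((T + τ) / σ) ≤ Real.arctan ((T - τ) / σ) := by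
    rw [← Real.arctan_neg]
    refine Real.arctan_mono ?_
    rw [← neg_div]
    gcongr
    linarith
  unfold poissonAverage
  have := Real.pi_pos
  have : 0 ≤ Real.arctan ((T - τ) / σ) + Real.arctan ((T + τ) / σ) := by linarith
  positivity

lemma poissonAverage_neg (σ T τ : ℝ) : poissonAverage σ T (-τ) = poissonAverage σ T τ := by
  unfold poissonAverage
  rw [sub_neg_eq_add, ← sub_eq_add_neg, add_comm]

lemma continuous_poissonAverage (σ T : ℝ) : Continuous (poissonAverage σ T) := by
  unfold poissonAverage
  exact (((Real.continuous_arctan.comp (by fun_prop)).add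
    (Real.continuous_arctan.comp (by fun_prop))).div_const _).div_const _

lemma antitoneOn_poissonAverage {σ T : ℝ} (hσ : 0 < σ) (hT : 0 < T) :
    AntitoneOn (poissonAverage σ T) (Ici 0) := by
  have hd : ∀ τ : ℝ, HasDerivAt (poissonAverage σ T)
      ((1 / (1 + ((T - τ) / σ) ^ 2) * (-1 / σ) + 1 / (1 + ((T + τ) / σ) ^ 2) * (1 / σ)) /
        Real.pi / (2 * T)) τ := fun τ =>
    ((((((hasDerivAt_id τ).const_sub T).div_const σ).arctan).add
      ((((hasDerivAt_id τ).const_add T).div_const σ).arctan)).div_const _).div_const _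
  refine antitoneOn_of_deriv_nonpos (convex_Ici 0) (continuous_poissonAverage σ T).continuousOn
    (fun τ _ => (hd τ).differentiableAt.differentiableWithinAt) fun τ hτ => ?_
  rw [interior_Ici] at hτ
  rw [(hd τ).deriv]
  have hτ' : 0 < τ := hτ
  have : 1 / (1 + ((T + τ) / σ) ^ 2) ≤ 1 / (1 + ((T - τ) / σ) ^ 2) := by
    refine one_div_le_one_div_of_le (by positivity) ?_
    rw [div_pow, div_pow]
    gcongr 1 + ?_ / _
    nlinarith [mul_pos hT hτ']
  have h2 : 1 / (1 + ((T - τ) / σ) ^ 2) * (-1 / σ) + 1 / (1 + ((T + τ) / σ) ^ 2) * (1 / σ) ≤ 0 := by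
    have := mul_le_mul_of_nonneg_right this (by positivity : 0 ≤ 1 / σ)
    have e : -1 / σ = -(1 / σ) := by ring
    rw [e]; linarith
  have := Real.pi_pos
  exact div_nonpos_of_nonpos_of_nonneg (div_nonpos_of_nonpos_of_nonneg h2 (by positivity))
    (by positivity)

lemma poissonAverage_zero_le {σ T : ℝ} (hT : 1 ≤ T) : poissonAverage σ T 0 ≤ 1 / 2 := by
  unfold poissonAverage
  have h1 := (Real.arctan_lt_pi_div_two ((T - 0) / σ)).le
  have h2 := (Real.arctan_lt_pi_div_two ((T + 0) / σ)).le
  have hpi := Real.pi_pos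
  rw [div_div, div_le_div_iff₀ (by positivity) (by positivity)]
  nlinarith

lemma continuous_uncurry_poissonKernelHP {σ : ℝ} (hσ : 0 < σ) :
    Continuous fun z : ℝ × ℝ => poissonKernelHP (σ + z.1 * Complex.I) z.2 := by
  have hP : ∀ t τ : ℝ, poissonKernelHP (σ + t * Complex.I) τ =
      σ / (σ ^ 2 + (t - τ) ^ 2) / Real.pi := fun t τ => by simp [poissonKernelHP]
  simp only [hP]
  exact (Continuous.div (by fun_prop) (by fun_prop) fun t => by positivity).div_const _

lemma lintegral_mean_poissonKernelHP_mul {σ T : ℝ} (hσ : 0 < σ) (hT : 0 < T) {h : ℝ → ENNReal}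
    (hm : AEMeasurable h) :
    ENNReal.ofReal (1 / (2 * T)) * ∫⁻ t in Icc (-T) T, ∫⁻ τ,
      h τ * ENNReal.ofReal (poissonKernelHP (σ + t * Complex.I) τ) =
    ∫⁻ τ, h τ * ENNReal.ofReal (poissonAverage σ T τ) := by
  have hcont := continuous_uncurry_poissonKernelHP hσ
  rw [lintegral_lintegral_swap]
  · rw [← lintegral_const_mul'' _ ]
    · refine lintegral_congr fun τ => ?_
      rw [← lintegral_poissonKernelHP_Icc hσ hT τ, lintegral_const_mul _ (by
        have : Continuous fun t : ℝ => poissonKernelHP (σ + t * Complex.I) τ :=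
          hcont.comp (by fun_prop : Continuous fun t : ℝ => (t, τ))
        exact this.measurable.ennreal_ofReal)]
      ring
    · refine AEMeasurable.lintegral_prod_left ?_
      exact (hm.comp_snd).mul hcont.measurable.ennreal_ofReal.aemeasurable
  · exact (hm.comp_snd).mul hcont.measurable.ennreal_ofReal.aemeasurable

lemma lintegral_poissonAverage {σ T : ℝ} (hσ : 0 < σ) (hT : 0 < T) :
    ∫⁻ τ, ENNReal.ofReal (poissonAverage σ T τ) = 1 := by
  have h := lintegral_mean_poissonKernelHP_mul hσ hT (h := fun _ => 1) aemeasurable_const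
  simp only [one_mul] at h
  rw [← h]
  have : ∀ t : ℝ, ∫⁻ τ, ENNReal.ofReal (poissonKernelHP (σ + t * Complex.I) τ) = 1 := fun t =>
    lintegral_poissonKernelHP (by simpa using hσ)
  simp only [this, lintegral_const, Measure.restrict_apply_univ, Real.volume_Icc, one_mul]
  rw [← ENNReal.ofReal_mul (by positivity), ← ENNReal.ofReal_one]
  congr 1
  field_simp
  ring

/-- The `p`-th power means of the Poisson integral of a function of linear growth `C` are at most
`2 C`. -/
lemma mean_poisson_rpow_le {p : ℝ} (hp : 1 ≤ p) {g : ℝ → ℂ} (hg : AEStronglyMeasurable g)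
    {C : ENNReal} (hC : ∀ T > 0, ∫⁻ τ in Ioc 0 T, ‖g τ‖ₑ ^ p ≤ C * ENNReal.ofReal (1 + T))
    (hC' : ∀ T > 0, ∫⁻ τ in Ioc (-T) 0, ‖g τ‖ₑ ^ p ≤ C * ENNReal.ofReal (1 + T))
    {σ T : ℝ} (hσ : 0 < σ) (hT : 1 ≤ T) :
    ENNReal.ofReal (1 / (2 * T)) * ∫⁻ t in Icc (-T) T,
      ‖∫ τ, g τ * (poissonKernelHP (σ + t * Complex.I) τ : ℂ)‖ₑ ^ p ≤ 2 * C := by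
  have hT0 : 0 < T := by linarith
  have hm : AEMeasurable fun τ => ‖g τ‖ₑ ^ p := hg.enorm.pow_const p
  have hwm := (continuous_poissonAverage σ T)
  have hw1 := lintegral_poissonAverage hσ hT0
  have hwi : Integrable (poissonAverage σ T) := by
    refine ⟨hwm.aestronglyMeasurable, ?_⟩
    rw [hasFiniteIntegral_iff_ofReal (.of_forall (poissonAverage_nonneg hσ hT0)), hw1]
    exact ENNReal.one_lt_top
  calc _ ≤ ENNReal.ofReal (1 / (2 * T)) * ∫⁻ t in Icc (-T) T, ∫⁻ τ,
      ‖g τ‖ₑ ^ p * ENNReal.ofReal (poissonKernelHP (σ + t * Complex.I) τ) := by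
        gcongr with t
        exact enorm_poisson_rpow_le hp (by simpa using hσ) hg
    _ = ∫⁻ τ, ‖g τ‖ₑ ^ p * ENNReal.ofReal (poissonAverage σ T τ) :=
        lintegral_mean_poissonKernelHP_mul hσ hT0 hm
    _ ≤ C * (2 * ENNReal.ofReal (poissonAverage σ T 0) +
          ∫⁻ τ, ENNReal.ofReal (poissonAverage σ T τ)) :=
        lintegral_mul_even_antitone_le hm hC hC' (poissonAverage_nonneg hσ hT0) hwm.measurable
          (poissonAverage_neg σ T) (antitoneOn_poissonAverage hσ hT0) hwi
    _ ≤ C * (2 * ENNReal.ofReal (1 / 2) + 1) := by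
        rw [hw1]; gcongr; exact poissonAverage_zero_le hT
    _ = 2 * C := by
        rw [show (2 : ENNReal) = ENNReal.ofReal 2 by simp, ← ENNReal.ofReal_mul (by norm_num)]
        norm_num
        rw [mul_comm]

/-- Functions of linear growth in the mean are integrable against the Poisson kernels. -/
lemma integrable_mul_poissonKernelHP_of_growth {p : ℝ} (hp : 1 ≤ p) {g : ℝ → ℂ}
    (hg : AEStronglyMeasurable g) {C : ENNReal} (hCfin : C ≠ ⊤)
    (hC : ∀ T > 0, ∫⁻ τ in Ioc 0 T, ‖g τ‖ₑ ^ p ≤ C * ENNReal.ofReal (1 + T))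
    (hC' : ∀ T > 0, ∫⁻ τ in Ioc (-T) 0, ‖g τ‖ₑ ^ p ≤ C * ENNReal.ofReal (1 + T))
    {s : ℂ} (hs : 0 < s.re) :
    Integrable fun τ => g τ * (poissonKernelHP s τ : ℂ) := by
  have hw : Continuous fun τ : ℝ => (1 + τ ^ 2)⁻¹ :=
    Continuous.inv₀ (by fun_prop) fun τ => by positivity
  have hm : AEMeasurable fun τ => ‖g τ‖ₑ ^ p := hg.enorm.pow_const p
  have h1 := lintegral_mul_even_antitone_le hm hC hC' (w := fun τ : ℝ => (1 + τ ^ 2)⁻¹)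
    (fun τ => by positivity) hw.measurable (fun τ => by simp)
    (fun x hx y hy hxy => by
      have hx' : 0 ≤ x := hx
      beta_reduce; gcongr) integrable_inv_one_add_sq
  have hwfin : ∫⁻ τ : ℝ, ENNReal.ofReal (1 + τ ^ 2)⁻¹ < ⊤ := by
    have := integrable_inv_one_add_sq.2
    rwa [hasFiniteIntegral_iff_ofReal (.of_forall fun τ => by positivity)] at this
  have h2 : ∫⁻ τ, ‖g τ‖ₑ ^ p * ENNReal.ofReal (1 + τ ^ 2)⁻¹ < ⊤ := by
    refine h1.trans_lt (ENNReal.mul_lt_top hCfin.lt_top (ENNReal.add_lt_top.2 ⟨?_, hwfin⟩))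
    exact ENNReal.mul_lt_top (by simp) ENNReal.ofReal_lt_top
  refine ⟨hg.mul (Complex.continuous_ofReal.comp (continuous_poissonKernelHP hs)).aestronglyMeasurable, ?_⟩
  -- Since `|g| ≤ 1 + |g|^p`, the weight `(1 + τ²)⁻¹` only has to be tested against `1` and `|g|^p`.
  have hle : ∀ τ, ‖g τ * (poissonKernelHP s τ : ℂ)‖ₑ ≤ ENNReal.ofReal (poissonBound s) *
      (ENNReal.ofReal (1 + τ ^ 2)⁻¹ + ‖g τ‖ₑ ^ p * ENNReal.ofReal (1 + τ ^ 2)⁻¹) := by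
    intro τ
    have hg1 : ‖g τ‖ₑ ≤ 1 + ‖g τ‖ₑ ^ p := by
      rcases le_total ‖g τ‖ₑ 1 with h | h
      · exact h.trans le_self_add
      · exact (ENNReal.le_rpow_self_of_one_le h hp).trans le_add_self
    rw [enorm_mul, ← ofReal_norm (poissonKernelHP s τ : ℂ), Complex.norm_real,
      Real.norm_of_nonneg (poissonKernelHP_nonneg hs τ)]
    calc _ ≤ (1 + ‖g τ‖ₑ ^ p) * ENNReal.ofReal (poissonBound s * (1 + τ ^ 2)⁻¹) := by
          gcongr; exact poissonKernelHP_le hs τ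
      _ = _ := by rw [ENNReal.ofReal_mul (poissonBound_nonneg hs)]; ring
  refine (lintegral_mono hle).trans_lt ?_
  rw [lintegral_const_mul' _ _ ENNReal.ofReal_ne_top,
    lintegral_add_left hw.measurable.ennreal_ofReal]
  exact ENNReal.mul_lt_top ENNReal.ofReal_lt_top (ENNReal.add_lt_top.2 ⟨hwfin, h2⟩)

/-! ### The points of the set `E_f` -/

lemma aestronglyMeasurable_of_forall_Icc {g : ℝ → ℂ}
    (hg : ∀ T > 0, AEStronglyMeasurable g (volume.restrict (Icc (-T) T))) :
    AEStronglyMeasurable g := by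
  have h : (⋃ n : ℕ, Icc (-((n : ℝ) + 1)) (n + 1)) = univ := by
    refine eq_univ_of_forall fun x => mem_iUnion.2 ?_
    obtain ⟨n, hn⟩ := exists_nat_ge |x|
    exact ⟨n, by constructor <;> [linarith [neg_abs_le x]; linarith [le_abs_self x]]⟩
  rw [← Measure.restrict_univ (μ := (volume : Measure ℝ)), ← h, aestronglyMeasurable_iUnion_iff]
  exact fun n => hg _ (by positivity)

lemma intervalIntegrable_norm_rpow {p : ℝ} (hp : 1 ≤ p) {g : ℝ → ℂ}
    (hg : ∀ T > 0, MemLp g (ENNReal.ofReal p) (volume.restrict (Icc (-T) T))) (a b : ℝ) :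
    IntervalIntegrable (fun τ => ‖g τ‖ ^ p) volume a b := by
  have hp0 : 0 < p := by linarith
  have hT : 0 < |a| + |b| + 1 := by positivity
  have h := (hg _ hT).integrable_norm_rpow (by simpa using hp0) ENNReal.ofReal_ne_top
  rw [ENNReal.toReal_ofReal hp0.le] at h
  have h' : IntegrableOn (fun τ => ‖g τ‖ ^ p) (Icc (-(|a| + |b| + 1)) (|a| + |b| + 1)) := h
  refine ⟨h'.mono_set fun x hx => ?_, h'.mono_set fun x hx => ?_⟩ <;>
  · have := neg_abs_le a; have := le_abs_self a; have := neg_abs_le b; have := le_abs_self b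
    have := abs_nonneg a; have := abs_nonneg b
    exact ⟨by linarith [hx.1], by linarith [hx.2]⟩

lemma lintegral_enorm_rpow_eq {p : ℝ} (hp : 1 ≤ p) {g : ℝ → ℂ}
    (hg : ∀ T > 0, MemLp g (ENNReal.ofReal p) (volume.restrict (Icc (-T) T))) {a b : ℝ}
    (hab : a ≤ b) :
    ∫⁻ τ in Ioc a b, ‖g τ‖ₑ ^ p = ENNReal.ofReal (∫ τ in a..b, ‖g τ‖ ^ p) := by
  have hp0 : 0 < p := by linarith
  rw [intervalIntegral.integral_of_le hab, ofReal_integral_eq_lintegral_ofReal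
    (intervalIntegrable_norm_rpow hp hg a b).1 (.of_forall fun τ => by positivity)]
  refine lintegral_congr fun τ => ?_
  rw [← ofReal_norm, ENNReal.ofReal_rpow_of_nonneg (norm_nonneg _) hp0.le]

/-- A locally integrable nonnegative function whose means over `[-T, T]` converge has linear
growth. -/
lemma exists_growth_of_tendsto {h : ℝ → ℝ} (h0 : ∀ τ, 0 ≤ h τ)
    (hi : ∀ a b, IntervalIntegrable h volume a b) {l : ℝ}
    (hl : Tendsto (fun T : ℝ => 1 / (2 * T) * ∫ τ in (-T)..T, h τ) atTop (𝓝 l)) :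
    ∃ C, 0 ≤ C ∧ ∀ T > 0, ∫ τ in (-T)..T, h τ ≤ C * (1 + T) := by
  have hev : ∀ᶠ T : ℝ in atTop, 1 / (2 * T) * ∫ τ in (-T)..T, h τ < |l| + 1 :=
    hl.eventually_lt_const (by linarith [le_abs_self l])
  obtain ⟨T₀, hT₀⟩ := eventually_atTop.1 (hev.and (eventually_gt_atTop 0))
  have hT₀0 : 0 < T₀ := (hT₀ T₀ le_rfl).2
  set A := ∫ τ in (-T₀)..T₀, h τ with hA
  have hA0 : 0 ≤ A := intervalIntegral.integral_nonneg (by linarith) fun τ _ => h0 τ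
  refine ⟨2 * (|l| + 1) + A, by positivity, fun T hT => ?_⟩
  rcases le_total T₀ T with hle | hle
  · have := (hT₀ T hle).1.le
    rw [one_div_mul_eq_div, div_le_iff₀ (by positivity)] at this
    nlinarith [abs_nonneg l, mul_nonneg hA0 hT.le]
  · have : ∫ τ in (-T)..T, h τ ≤ A :=
      intervalIntegral.integral_mono_interval (by linarith) (by linarith) hle
        (.of_forall h0) (hi _ _)
    nlinarith [abs_nonneg l, mul_nonneg hA0 hT.le, mul_nonneg (abs_nonneg l) hT.le]

lemma isLeast_growthConst {p : ℝ} {a : ℕ+ → ℂ} {F : Torus → ℂ} (hp : 1 ≤ p) {χ : Torus}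
    (hχ : χ ∈ ergodicSet p a F) : IsLeast (growthBounds p F χ) (growthConst p F χ) := by
  obtain ⟨hloc, hlim⟩ := hχ
  have h0 : ∀ τ, 0 ≤ ‖orbit F χ τ‖ ^ p := fun τ => by positivity
  have hi := intervalIntegrable_norm_rpow hp hloc
  obtain ⟨C, hC0, hC⟩ := exists_growth_of_tendsto h0 hi hlim
  have hne : (growthBounds p F χ).Nonempty := by
    refine ⟨C, hC0, fun T hT => ⟨(le_trans ?_ (hC T hT)), (le_trans ?_ (hC T hT))⟩⟩ <;>
    exact intervalIntegral.integral_mono_interval (by linarith) (by linarith) (by linarith)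
        (.of_forall h0) (hi _ _)
  have hbdd : BddBelow (growthBounds p F χ) := ⟨0, fun C hC => hC.1⟩
  refine IsClosed.isLeast_csInf ?_ hne hbdd
  have : growthBounds p F χ = {C | 0 ≤ C} ∩ ⋂ T : ℝ, ⋂ _ : T > 0,
      {C | (∫ τ in (-T)..0, ‖orbit F χ τ‖ ^ p) ≤ C * (1 + T)} ∩
      {C | (∫ τ in (0 : ℝ)..T, ‖orbit F χ τ‖ ^ p) ≤ C * (1 + T)} := by
    ext C; simp [growthBounds]
  rw [this]
  refine isClosed_Ici.inter (isClosed_iInter fun T => isClosed_iInter fun _ => ?_)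
  exact (isClosed_le continuous_const (by fun_prop)).inter
    (isClosed_le continuous_const (by fun_prop))

lemma lintegral_orbit_le_of_mem_growthBounds {p : ℝ} {a : ℕ+ → ℂ} {F : Torus → ℂ} (hp : 1 ≤ p)
    {χ : Torus} (hχ : χ ∈ ergodicSet p a F) {C : ℝ} (hC : C ∈ growthBounds p F χ) :
    (∀ T > 0, ∫⁻ τ in Ioc 0 T, ‖orbit F χ τ‖ₑ ^ p ≤ ENNReal.ofReal C * ENNReal.ofReal (1 + T)) ∧
    ∀ T > 0, ∫⁻ τ in Ioc (-T) 0, ‖orbit F χ τ‖ₑ ^ p ≤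
      ENNReal.ofReal C * ENNReal.ofReal (1 + T) := by
  constructor <;> intro T hT <;>
  rw [lintegral_enorm_rpow_eq hp hχ.1 (by linarith), ← ENNReal.ofReal_mul hC.1]
  · exact ENNReal.ofReal_le_ofReal (hC.2 T hT).2
  · exact ENNReal.ofReal_le_ofReal (hC.2 T hT).1

lemma aestronglyMeasurable_orbit_of_mem_ergodicSet {p : ℝ} {a : ℕ+ → ℂ} {F : Torus → ℂ}
    {χ : Torus} (hχ : χ ∈ ergodicSet p a F) : AEStronglyMeasurable (orbit F χ) :=
  aestronglyMeasurable_of_forall_Icc fun T hT => (hχ.1 T hT).1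

lemma integrable_orbit_of_mem_ergodicSet {p : ℝ} {a : ℕ+ → ℂ} {F : Torus → ℂ} (hp : 1 ≤ p)
    {χ : Torus} (hχ : χ ∈ ergodicSet p a F) {s : ℂ} (hs : s ∈ halfPlane 0) :
    Integrable (fun τ : ℝ => orbit F χ τ * (poissonKernelHP s τ : ℂ)) := by
  obtain ⟨h1, h2⟩ := lintegral_orbit_le_of_mem_growthBounds hp hχ (isLeast_growthConst hp hχ).1
  exact integrable_mul_poissonKernelHP_of_growth hp
    (aestronglyMeasurable_orbit_of_mem_ergodicSet hχ) ENNReal.ofReal_ne_top h1 h2 hs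

lemma iSup_mean_poissonIntegral_le {p : ℝ} {a : ℕ+ → ℂ} {F : Torus → ℂ} (hp : 1 ≤ p)
    {χ : Torus} (hχ : χ ∈ ergodicSet p a F) :
    (⨆ (σ : ℝ) (_ : 0 < σ) (T : ℝ) (_ : 1 ≤ T),
        ENNReal.ofReal (1 / (2 * T)) *
          ∫⁻ t in Icc (-T) T, ‖poissonIntegral F χ (σ + t * Complex.I)‖ₑ ^ p)
        ≤ ENNReal.ofReal (6 * growthConst p F χ) := by
  have hmem := (isLeast_growthConst hp hχ).1
  obtain ⟨h1, h2⟩ := lintegral_orbit_le_of_mem_growthBounds hp hχ hmem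
  refine iSup₂_le fun σ hσ => iSup₂_le fun T hT => ?_
  refine (mean_poisson_rpow_le hp (aestronglyMeasurable_orbit_of_mem_ergodicSet hχ) h1 h2 hσ
    hT).trans ?_
  rw [show (2 : ENNReal) = ENNReal.ofReal 2 by simp, ← ENNReal.ofReal_mul (by norm_num)]
  exact ENNReal.ofReal_le_ofReal (by linarith [hmem.1])

/-! ### Density of characters, equidistribution, uniqueness of Fourier coefficients -/

/-- The character `χ ↦ χ(q)` as a continuous function on the torus. -/
def charMap (q : ℚ) : C(Torus, ℂ) :=
  ⟨fun χ => (charValue χ q : ℂ), continuous_subtype_val.comp (continuous_charValue q)⟩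

@[simp] lemma charMap_apply (q : ℚ) (χ : Torus) : charMap q χ = (charValue χ q : ℂ) := rfl

/-- The characters `χ ↦ χ(q)`, `q > 0`, generate a star subalgebra of the continuous functions. -/
def charSubalgebra : StarSubalgebra ℂ C(Torus, ℂ) where
  toSubalgebra := Algebra.adjoin ℂ (charMap '' Ioi 0)
  star_mem' := by
    change Algebra.adjoin ℂ (charMap '' Ioi 0) ≤ star (Algebra.adjoin ℂ (charMap '' Ioi 0))
    refine Algebra.adjoin_le ?_
    rintro - ⟨q, hq, rfl⟩
    refine Algebra.subset_adjoin ⟨q⁻¹, mem_Ioi.2 (inv_pos.2 hq), ContinuousMap.ext fun χ => ?_⟩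
    simp only [charMap_apply, charValue_inv_rat χ (ne_of_gt (mem_Ioi.1 hq)), Circle.coe_inv_eq_conj,
      ContinuousMap.star_apply, starRingEnd_apply]

lemma charSubalgebra_coe :
    Subalgebra.toSubmodule charSubalgebra.toSubalgebra = Submodule.span ℂ (charMap '' Ioi 0) := by
  apply Algebra.adjoin_eq_span_of_subset
  refine Subset.trans ?_ Submodule.subset_span
  intro x hx
  refine Submonoid.closure_induction (fun _ => id) ⟨1, mem_Ioi.2 one_pos, ?_⟩ ?_ hx
  · ext1 χ; simp
  · rintro - - - - ⟨q, hq, rfl⟩ ⟨r, hr, rfl⟩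
    refine ⟨q * r, mem_Ioi.2 (mul_pos hq hr), ?_⟩
    ext1 χ
    simp [charValue_mul_rat χ (ne_of_gt (mem_Ioi.1 hq)) (ne_of_gt (mem_Ioi.1 hr))]

lemma charSubalgebra_separatesPoints : charSubalgebra.SeparatesPoints := by
  intro χ ψ hne
  obtain ⟨p, hp⟩ := Function.ne_iff.1 hne
  have hmem : charMap ((p : ℕ) : ℚ) ∈ Algebra.adjoin ℂ (charMap '' Ioi 0) :=
    Algebra.subset_adjoin ⟨_, by simpa using p.2.pos, rfl⟩
  refine ⟨_, ⟨charMap ((p : ℕ) : ℚ), hmem, rfl⟩, ?_⟩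
  simpa [charValue_prime, Circle.ext_iff] using hp

/-- Linear combinations of characters are dense in the continuous functions, by the
Stone–Weierstrass theorem. -/
lemma exists_span_charMap_dist_lt (g : C(Torus, ℂ)) {ε : ℝ} (hε : 0 < ε) :
    ∃ g' ∈ Submodule.span ℂ (charMap '' Ioi 0), dist g g' < ε := by
  have h1 := ContinuousMap.starSubalgebra_topologicalClosure_eq_top_of_separatesPoints
    charSubalgebra charSubalgebra_separatesPoints
  have h2 : (Submodule.span ℂ (charMap '' Ioi 0)).topologicalClosure = ⊤ := by
    rw [← charSubalgebra_coe]
    exact congr_arg (Subalgebra.toSubmodule <| StarSubalgebra.toSubalgebra ·) h1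
  have h3 : g ∈ closure ((Submodule.span ℂ (charMap '' Ioi 0) : Submodule ℂ C(Torus, ℂ)) :
      Set C(Torus, ℂ)) := by
    rw [← Submodule.topologicalClosure_coe, h2]; trivial
  exact Metric.mem_closure_iff.1 h3 ε hε

lemma continuous_comp_kronecker (g : C(Torus, ℂ)) (χ : Torus) (c : ℝ) :
    Continuous fun τ : ℝ => g (χ * kronecker (c * τ)) :=
  g.continuous.comp (continuous_const.mul (continuous_kronecker.comp (by fun_prop)))

/-- The means of a non-trivial character along the flow tend to zero, since its restriction to an orbit
is a multiple of `e^{bτ}` with `b ≠ 0` imaginary. -/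
lemma tendsto_mean_charMap {q : ℚ} (hq : 0 < q) (χ : Torus) {c : ℝ} (hc : c ≠ 0) :
    Tendsto (fun T : ℝ => (T : ℂ)⁻¹ * ∫ τ in (0 : ℝ)..T, charMap q (χ * kronecker (c * τ))) atTop
      (𝓝 (∫ χ, charMap q χ ∂haarTorus)) := by
  rcases eq_or_ne q 1 with rfl | hq1
  · simp only [charMap_apply, charValue_one, Circle.coe_one, intervalIntegral.integral_const,
      sub_zero, integral_const, probReal_univ, one_smul, Complex.real_smul, mul_one]
    refine tendsto_const_nhds.congr' ?_
    filter_upwards [eventually_gt_atTop 0] with T hT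
    rw [inv_mul_cancel₀ (by exact_mod_cast hT.ne')]
  · simp only [charMap_apply]
    rw [integral_charValue_eq_zero hq hq1]
    have hlog : Real.log q ≠ 0 :=
      Real.log_ne_zero_of_pos_of_ne_one (by exact_mod_cast hq) (by exact_mod_cast hq1)
    set b : ℂ := -(c * Real.log q) * Complex.I with hb
    have hb0 : b ≠ 0 := by
      rw [hb]
      refine mul_ne_zero (neg_ne_zero.2 (mul_ne_zero ?_ ?_)) Complex.I_ne_zero <;>
      exact_mod_cast (by assumption)
    have e : ∀ τ : ℝ, (charValue (χ * kronecker (c * τ)) q : ℂ) =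
        charValue χ q * Complex.exp (b * τ) := fun τ => by
      rw [charValue_mul_torus, charValue_kronecker _ hq, Circle.coe_mul, Circle.coe_exp]
      congr 2; rw [hb]; push_cast; ring
    have hexp : ∀ T : ℝ, ‖Complex.exp (b * T)‖ = 1 := fun T => by
      rw [hb, Complex.norm_exp]; simp
    simp only [e, intervalIntegral.integral_const_mul, integral_exp_mul_complex hb0]
    refine squeeze_zero_norm' (a := fun T : ℝ => T⁻¹ * (2 / ‖b‖)) ?_ ?_
    · filter_upwards [eventually_gt_atTop 0] with T hT
      rw [norm_mul, norm_mul, norm_inv, norm_div, Complex.norm_real, Real.norm_of_nonneg hT.le,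
        norm_charValue, one_mul]
      gcongr
      refine (norm_sub_le _ _).trans ?_
      rw [hexp, hexp]; norm_num
    · simpa using tendsto_inv_atTop_zero.mul_const (2 / ‖b‖)

lemma norm_mean_sub_le (g g' : C(Torus, ℂ)) (χ : Torus) (c : ℝ) {T : ℝ} (hT : 0 < T) :
    ‖(T : ℂ)⁻¹ * (∫ τ in (0 : ℝ)..T, g (χ * kronecker (c * τ))) -
      (T : ℂ)⁻¹ * ∫ τ in (0 : ℝ)..T, g' (χ * kronecker (c * τ))‖ ≤ dist g g' := by
  rw [← mul_sub, ← intervalIntegral.integral_sub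
    ((continuous_comp_kronecker g χ c).intervalIntegrable _ _)
    ((continuous_comp_kronecker g' χ c).intervalIntegrable _ _), norm_mul, norm_inv,
    Complex.norm_real, Real.norm_of_nonneg hT.le]
  have := intervalIntegral.norm_integral_le_of_norm_le_const (a := 0) (b := T) (C := dist g g')
    (f := fun τ => g (χ * kronecker (c * τ)) - g' (χ * kronecker (c * τ)))
    fun τ _ => by rw [← dist_eq_norm]; exact ContinuousMap.dist_apply_le_dist _
  rw [sub_zero, abs_of_pos hT] at this
  calc _ ≤ T⁻¹ * (dist g g' * T) := by gcongr
    _ = dist g g' := by field_simp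

lemma norm_integral_sub_le (g g' : C(Torus, ℂ)) :
    ‖∫ χ, g χ ∂haarTorus - ∫ χ, g' χ ∂haarTorus‖ ≤ dist g g' := by
  have hi : ∀ g : C(Torus, ℂ), Integrable g haarTorus := fun g =>
    g.continuous.integrable_of_hasCompactSupport (HasCompactSupport.of_compactSpace g)
  rw [← integral_sub (hi g) (hi g')]
  have := norm_integral_le_of_norm_le_const (μ := haarTorus) (f := fun χ => g χ - g' χ)
    (C := dist g g') (.of_forall fun χ => by
      rw [← dist_eq_norm]; exact ContinuousMap.dist_apply_le_dist _)
  simpa using this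

/-- Equidistribution of the Kronecker flow: the means of a continuous function along every orbit
converge to its integral. -/
theorem tendsto_mean_continuousMap (g : C(Torus, ℂ)) (χ : Torus) {c : ℝ} (hc : c ≠ 0) :
    Tendsto (fun T : ℝ => (T : ℂ)⁻¹ * ∫ τ in (0 : ℝ)..T, g (χ * kronecker (c * τ))) atTop
      (𝓝 (∫ χ, g χ ∂haarTorus)) := by
  have hi : ∀ g : C(Torus, ℂ), Integrable g haarTorus := fun g =>
    g.continuous.integrable_of_hasCompactSupport (HasCompactSupport.of_compactSpace g)
  have hspan : ∀ g ∈ Submodule.span ℂ (charMap '' Ioi 0),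
      Tendsto (fun T : ℝ => (T : ℂ)⁻¹ * ∫ τ in (0 : ℝ)..T, g (χ * kronecker (c * τ))) atTop
      (𝓝 (∫ χ, g χ ∂haarTorus)) := by
    intro g hg
    induction hg using Submodule.span_induction with
    | mem g hg => obtain ⟨q, hq, rfl⟩ := hg; exact tendsto_mean_charMap hq χ hc
    | zero => simp
    | add g g' _ _ h h' =>
      have := h.add h'
      rw [← integral_add (hi g) (hi g')] at this
      refine this.congr fun T => ?_
      rw [← mul_add, ← intervalIntegral.integral_add
        ((continuous_comp_kronecker g χ c).intervalIntegrable _ _)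
        ((continuous_comp_kronecker g' χ c).intervalIntegrable _ _)]
      rfl
    | smul z g _ h =>
      have := h.const_mul z
      rw [← integral_const_mul] at this
      refine this.congr fun T => ?_
      rw [mul_left_comm, ← intervalIntegral.integral_const_mul]
      rfl
  rw [Metric.tendsto_atTop']
  intro ε hε
  obtain ⟨g', hg', hd⟩ := exists_span_charMap_dist_lt g (show 0 < ε / 3 by positivity)
  obtain ⟨N, hN⟩ := Metric.tendsto_atTop'.1 (hspan g' hg') (ε / 3) (by positivity)
  refine ⟨max N 0, fun T hT => ?_⟩
  have h1 := norm_mean_sub_le g g' χ c ((le_max_right _ _).trans_lt hT)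
  have h2 := norm_integral_sub_le g g'
  have h3 := hN T ((le_max_left _ _).trans_lt hT)
  rw [← dist_eq_norm] at h1 h2
  rw [dist_comm] at h2
  have := dist_triangle4 ((T : ℂ)⁻¹ * ∫ τ in (0 : ℝ)..T, g (χ * kronecker (c * τ)))
    ((T : ℂ)⁻¹ * ∫ τ in (0 : ℝ)..T, g' (χ * kronecker (c * τ))) (∫ χ, g' χ ∂haarTorus)
    (∫ χ, g χ ∂haarTorus)
  linarith

lemma tendsto_mean_of_continuous {g : Torus → ℝ} (hg : Continuous g) (χ : Torus) {c : ℝ}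
    (hc : c ≠ 0) :
    Tendsto (fun T : ℝ => T⁻¹ * ∫ τ in (0 : ℝ)..T, g (χ * kronecker (c * τ))) atTop
      (𝓝 (∫ χ, g χ ∂haarTorus)) := by
  have h := tendsto_mean_continuousMap ⟨fun χ => (g χ : ℂ), by fun_prop⟩ χ hc
  simp only [ContinuousMap.coe_mk, integral_complex_ofReal, intervalIntegral.integral_ofReal] at h
  have h' := (Complex.continuous_re.tendsto _).comp h
  refine h'.congr fun T => ?_
  simp only [Function.comp, ← Complex.ofReal_inv, ← Complex.ofReal_mul, Complex.ofReal_re]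

lemma tendsto_symmetric_mean {f : ℝ → ℝ} (hf : ∀ a b, IntervalIntegrable f volume a b) {l : ℝ}
    (h1 : Tendsto (fun T : ℝ => T⁻¹ * ∫ τ in (0 : ℝ)..T, f τ) atTop (𝓝 l))
    (h2 : Tendsto (fun T : ℝ => T⁻¹ * ∫ τ in (0 : ℝ)..T, f (-τ)) atTop (𝓝 l)) :
    Tendsto (fun T : ℝ => 1 / (2 * T) * ∫ τ in (-T)..T, f τ) atTop (𝓝 l) := by
  have h := (h1.add h2).const_mul (1 / 2)
  rw [show (1 / 2) * (l + l) = l by ring] at h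
  refine h.congr fun T => ?_
  rw [intervalIntegral.integral_comp_neg, neg_zero,
    ← intervalIntegral.integral_add_adjacent_intervals (hf (-T) 0) (hf 0 T), one_div, one_div,
    mul_inv]
  ring

lemma tendsto_symmetric_mean_of_continuous {g : Torus → ℝ} (hg : Continuous g) (χ : Torus) :
    Tendsto (fun T : ℝ => 1 / (2 * T) * ∫ τ in (-T)..T, g (χ * kronecker τ)) atTop
      (𝓝 (∫ χ, g χ ∂haarTorus)) := by
  refine tendsto_symmetric_mean (fun a b => ?_) ?_ ?_
  · exact (hg.comp (continuous_const.mul continuous_kronecker)).intervalIntegrable _ _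
  · simpa using tendsto_mean_of_continuous hg χ one_ne_zero
  · simpa using tendsto_mean_of_continuous hg χ (neg_ne_zero.2 one_ne_zero)

/-- An integrable function on the torus is determined by its Fourier coefficients. -/
theorem ae_eq_zero_of_fourierCoeffTorus_eq_zero {F : Torus → ℂ} (hF : Integrable F haarTorus)
    (h : ∀ q : ℚ, 0 < q → fourierCoeffTorus F q = 0) : F =ᵐ[haarTorus] 0 := by
  have hgi : ∀ g : C(Torus, ℂ), Integrable (fun χ => F χ * g χ) haarTorus := fun g =>
    hF.mul_bdd (c := ‖g‖) g.continuous.aestronglyMeasurable 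
      (.of_forall fun χ => g.norm_coe_le_norm χ)
  have hspan : ∀ g ∈ Submodule.span ℂ (charMap '' Ioi 0), ∫ χ, F χ * g χ ∂haarTorus = 0 := by
    intro g hg
    induction hg using Submodule.span_induction with
    | mem g hg =>
      obtain ⟨q, hq, rfl⟩ := hg
      rw [← h q⁻¹ (inv_pos.2 hq)]
      refine integral_congr_ae (.of_forall fun χ => ?_)
      simp only [charMap_apply, charValue_inv_rat χ (ne_of_gt (mem_Ioi.1 hq)),
        Circle.coe_inv_eq_conj, Complex.conj_conj]
    | zero => simp
    | add g g' _ _ h h' =>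
      simp only [ContinuousMap.add_apply, mul_add]
      rw [integral_add (hgi g) (hgi g'), h, h', add_zero]
    | smul z g _ h =>
      simp only [ContinuousMap.smul_apply, smul_eq_mul, mul_left_comm _ z]
      rw [integral_const_mul, h, mul_zero]
  have hall : ∀ g : C(Torus, ℂ), ∫ χ, F χ * g χ ∂haarTorus = 0 := by
    intro g
    rw [← norm_eq_zero]
    refine le_antisymm (le_of_forall_pos_lt_add fun ε hε => ?_) (norm_nonneg _)
    set A := ∫ χ, ‖F χ‖ ∂haarTorus with hA
    have hA0 : 0 ≤ A := integral_nonneg fun χ => norm_nonneg _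
    obtain ⟨g', hg', hd⟩ := exists_span_charMap_dist_lt g (show 0 < ε / (A + 1) by positivity)
    have e : ∫ χ, F χ * g χ ∂haarTorus = ∫ χ, F χ * (g χ - g' χ) ∂haarTorus := by
      simp only [mul_sub]
      rw [integral_sub (hgi g) (hgi g'), hspan g' hg', sub_zero]
    rw [e, zero_add]
    calc _ ≤ ∫ χ, ‖F χ‖ * (ε / (A + 1)) ∂haarTorus := by
          refine norm_integral_le_of_norm_le (hF.norm.mul_const _) (.of_forall fun χ => ?_)
          rw [norm_mul, ← dist_eq_norm]
          gcongr
          exact (ContinuousMap.dist_apply_le_dist _).trans hd.le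
      _ = ε * (A / (A + 1)) := by rw [integral_mul_const]; ring
      _ < ε := mul_lt_of_lt_one_right hε ((div_lt_one (by positivity)).2 (by linarith))
  -- The indicator function of a closed set is a bounded pointwise limit of continuous functions.
  refine ae_eq_zero_of_forall_setIntegral_isClosed_eq_zero hF fun s hs => ?_
  have hlim : Tendsto (fun n => ∫ χ, F χ * ((hs.apprSeq n χ : NNReal) : ℂ) ∂haarTorus) atTop
      (𝓝 (∫ χ, F χ * ((s.indicator (fun _ => (1 : NNReal)) χ : NNReal) : ℂ) ∂haarTorus)) := by
    refine tendsto_integral_of_dominated_convergence (fun χ => ‖F χ‖) (fun n => ?_) hF.norm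
      (fun n => .of_forall fun χ => ?_) (.of_forall fun χ => ?_)
    · refine hF.1.mul (Continuous.aestronglyMeasurable ?_)
      have := (hs.apprSeq n).continuous
      fun_prop
    · rw [norm_mul]
      refine mul_le_of_le_one_right (norm_nonneg _) ?_
      have := HasOuterApproxClosed.apprSeq_apply_le_one hs n χ
      simpa using this
    · refine Tendsto.const_mul _ ?_
      have h1 := (tendsto_pi_nhds.1 (HasOuterApproxClosed.tendsto_apprSeq hs)) χ
      exact ((Complex.continuous_ofReal.comp NNReal.continuous_coe).tendsto _).comp h1
  have hzero : ∀ n, ∫ χ, F χ * ((hs.apprSeq n χ : NNReal) : ℂ) ∂haarTorus = 0 := fun n =>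
    hall ⟨fun χ => ((hs.apprSeq n χ : NNReal) : ℂ), by
      have := (hs.apprSeq n).continuous
      fun_prop⟩
  simp only [hzero] at hlim
  rw [← integral_indicator hs.measurableSet, ← tendsto_nhds_unique hlim tendsto_const_nhds]
  refine integral_congr_ae (.of_forall fun χ => ?_)
  by_cases hχ : χ ∈ s <;> simp [hχ]

/-! ### Dirichlet polynomials on the torus -/

/-- The trigonometric polynomial `χ ↦ ∑ aₙ χ(n)` on the torus that corresponds to the Dirichlet
polynomial `∑ aₙ n⁻ˢ`. -/
def torusPoly : (ℕ+ →₀ ℂ) →ₗ[ℂ] C(Torus, ℂ) :=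
  Finsupp.linearCombination ℂ fun n : ℕ+ => charMap ((n : ℕ) : ℚ)

lemma torusPoly_apply (P : ℕ+ →₀ ℂ) (χ : Torus) :
    torusPoly P χ = ∑ n ∈ P.support, P n * (charValue χ ((n : ℕ) : ℚ) : ℂ) := by
  simp [torusPoly, Finsupp.linearCombination_apply, Finsupp.sum]

/-- The Dirichlet polynomial `∑ aₙ χ(n) n⁻ˢ`, twisted by the character `χ`. -/
def twistedPoly (P : ℕ+ →₀ ℂ) (χ : Torus) (s : ℂ) : ℂ := ∑ n ∈ P.support, verticalTerm P χ s n

lemma twistedPoly_zero (P : ℕ+ →₀ ℂ) (χ : Torus) : twistedPoly P χ 0 = torusPoly P χ := by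
  simp [twistedPoly, verticalTerm, torusPoly_apply]

lemma charValue_pnat_kronecker (n : ℕ+) (t : ℝ) :
    (charValue (kronecker t) ((n : ℕ) : ℚ) : ℂ) = ((n : ℕ) : ℂ) ^ (-(t * Complex.I)) := by
  have hn : ((n : ℕ) : ℂ) ≠ 0 := by exact_mod_cast n.ne_zero
  rw [charValue_kronecker_nat t n n.ne_zero, Circle.coe_exp, Complex.cpow_def_of_ne_zero hn,
    ← Complex.natCast_log]
  congr 1; push_cast; ring

lemma verticalTerm_mul_kronecker (a : ℕ+ → ℂ) (χ : Torus) (s : ℂ) (t : ℝ) (n : ℕ+) :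
    verticalTerm a (χ * kronecker t) s n = verticalTerm a χ (s + t * Complex.I) n := by
  have hn : ((n : ℕ) : ℂ) ≠ 0 := by exact_mod_cast n.ne_zero
  unfold verticalTerm
  rw [charValue_mul_torus, Circle.coe_mul, charValue_pnat_kronecker, neg_add, Complex.cpow_add _ _ hn]
  ring

lemma norm_verticalTerm (a : ℕ+ → ℂ) (χ : Torus) (s : ℂ) (n : ℕ+) :
    ‖verticalTerm a χ s n‖ = ‖a n‖ * ((n : ℕ) : ℝ) ^ (-s.re) := by
  unfold verticalTerm
  rw [norm_mul, norm_mul, norm_charValue, mul_one, Complex.norm_natCast_cpow_of_pos n.pos,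
    Complex.neg_re]

lemma twistedPoly_mul_kronecker (P : ℕ+ →₀ ℂ) (χ : Torus) (s : ℂ) (t : ℝ) :
    twistedPoly P (χ * kronecker t) s = twistedPoly P χ (s + t * Complex.I) := by
  simp only [twistedPoly, verticalTerm_mul_kronecker]

lemma polyEval_eq_twistedPoly (P : ℕ+ →₀ ℂ) (σ t : ℝ) :
    polyEval P (σ + t * Complex.I) = twistedPoly P (1 * kronecker t) σ := by
  rw [twistedPoly_mul_kronecker]
  unfold polyEval twistedPoly verticalTerm Finsupp.sum
  have : ∀ q, charValue 1 q = 1 := fun q => by simp [charValue]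
  simp [this]

lemma continuous_twistedPoly (P : ℕ+ →₀ ℂ) (s : ℂ) : Continuous fun χ => twistedPoly P χ s :=
  continuous_finsetSum _ fun n _ =>
    ((charMap ((n : ℕ) : ℚ)).continuous.const_mul (P n)).mul_const _

/-- The Poisson integral of the orbit of a trigonometric polynomial is the twisted Dirichlet
polynomial. -/
lemma poissonIntegral_torusPoly (P : ℕ+ →₀ ℂ) (χ : Torus) {s : ℂ} (hs : 0 < s.re) :
    poissonIntegral (torusPoly P) χ s = twistedPoly P χ s := by
  have e : ∀ τ : ℝ, ∀ n : ℕ+, (charValue (kronecker τ) ((n : ℕ) : ℚ) : ℂ) =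
      Complex.exp (-((Real.log (n : ℕ) : ℝ) * τ) * Complex.I) := fun τ n => by
    rw [charValue_kronecker_nat τ n n.ne_zero, Circle.coe_exp]
    congr 1; push_cast; ring
  unfold poissonIntegral orbit twistedPoly
  simp only [torusPoly_apply, Finset.sum_mul, charValue_mul_torus, Circle.coe_mul, e]
  have hint : ∀ n : ℕ+, Integrable fun τ : ℝ => Complex.exp (-((Real.log (n : ℕ) : ℝ) * τ) *
      Complex.I) * (poissonKernelHP s τ : ℂ) := fun n => by
    refine (integrable_poissonKernelHP hs).ofReal.bdd_mul (c := 1)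
      (Continuous.aestronglyMeasurable (by fun_prop)) (.of_forall fun τ => ?_)
    have := Complex.norm_exp_ofReal_mul_I (-(Real.log (n : ℕ) * τ))
    push_cast at this ⊢
    exact this.le
  rw [integral_finsetSum]
  · refine Finset.sum_congr rfl fun n _ => ?_
    have : ∀ τ : ℝ, P n * ((charValue χ ((n : ℕ) : ℚ) : ℂ) *
        Complex.exp (-((Real.log (n : ℕ) : ℝ) * τ) * Complex.I)) * (poissonKernelHP s τ : ℂ) =
        P n * (charValue χ ((n : ℕ) : ℚ) : ℂ) *
        (Complex.exp (-((Real.log (n : ℕ) : ℝ) * τ) * Complex.I) * (poissonKernelHP s τ : ℂ)) :=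
      fun τ => by ring
    simp only [this]
    rw [integral_const_mul, integral_exp_mul_poissonKernelHP hs
      (Real.log_nonneg (by exact_mod_cast n.pos)), verticalTerm,
      Complex.cpow_def_of_ne_zero (by exact_mod_cast n.ne_zero), ← Complex.natCast_log, mul_neg]
  · intro n _
    refine ((hint n).const_mul (P n * (charValue χ ((n : ℕ) : ℚ) : ℂ))).congr
      (.of_forall fun τ => ?_)
    beta_reduce
    ring

/-! ### Averages along the flow -/

lemma continuous_flow : Continuous fun z : Torus × ℝ => z.1 * kronecker z.2 :=
  continuous_fst.mul (continuous_kronecker.comp continuous_snd)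

lemma lintegral_lintegral_flow {u : Torus → ENNReal} (hu : Measurable u) {k : ℝ → ENNReal}
    (hk : Measurable k) :
    ∫⁻ χ, (∫⁻ τ, u (χ * kronecker τ) * k τ) ∂haarTorus =
      (∫⁻ χ, u χ ∂haarTorus) * ∫⁻ τ, k τ := by
  rw [lintegral_lintegral_swap (((hu.comp continuous_flow.measurable).mul
    (hk.comp measurable_snd)).aemeasurable), ← lintegral_const_mul _ hk]
  refine lintegral_congr fun τ => ?_
  rw [lintegral_mul_const _ (f := fun χ => u (χ * kronecker τ)) (hu.comp (by fun_prop)),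
    lintegral_mul_right_eq_self (μ := haarTorus) u (kronecker τ)]

/-- A null set meets almost every orbit of the flow in a null set of times. -/
lemma quasiMeasurePreserving_flow :
    Measure.QuasiMeasurePreserving (fun z : Torus × ℝ => z.1 * kronecker z.2)
      (haarTorus.prod volume) haarTorus := by
  refine ⟨continuous_flow.measurable, Measure.AbsolutelyContinuous.mk fun s hs h0 => ?_⟩
  rw [Measure.map_apply continuous_flow.measurable hs,
    Measure.prod_apply_symm (continuous_flow.measurable hs), lintegral_eq_zero_iff'
      (measurable_measure_prodMk_right (continuous_flow.measurable hs)).aemeasurable]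
  refine .of_forall fun τ => ?_
  exact (measure_preimage_mul_right haarTorus (kronecker τ) s).trans h0

lemma ae_orbit_ae_eq {F G : Torus → ℂ} (h : F =ᵐ[haarTorus] G) :
    ∀ᵐ χ ∂haarTorus, orbit F χ =ᵐ[volume] orbit G χ :=
  Measure.ae_ae_of_ae_prod (quasiMeasurePreserving_flow.ae_eq_comp h)

/-! ### The norm of a Dirichlet polynomial -/

lemma integrable_of_continuous {E : Type*} [NormedAddCommGroup E] {g : Torus → E}
    (hg : Continuous g) : Integrable g haarTorus :=
  hg.integrable_of_hasCompactSupport (HasCompactSupport.of_compactSpace g)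

lemma continuous_norm_rpow {p : ℝ} (hp : 1 ≤ p) {g : Torus → ℂ} (hg : Continuous g) :
    Continuous fun χ => ‖g χ‖ ^ p :=
  hg.norm.rpow_const fun _ => Or.inr (by linarith)

/-- The mean of a Dirichlet polynomial on a vertical line is an integral over the torus, by
equidistribution of the flow. -/
lemma polyMean_eq {p : ℝ} (hp : 1 ≤ p) (σ : ℝ) (P : ℕ+ →₀ ℂ) :
    polyMean p σ P = (∫ χ, ‖twistedPoly P χ σ‖ ^ p ∂haarTorus) ^ (1 / p) := by
  unfold polyMean
  simp only [polyEval_eq_twistedPoly]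
  rw [(tendsto_symmetric_mean_of_continuous
    (continuous_norm_rpow hp (continuous_twistedPoly P σ)) 1).limUnder_eq]

/-- The Poisson integral contracts the `L^p` norm, because Haar measure is invariant along the
flow. -/
lemma integral_twistedPoly_rpow_le {p : ℝ} (hp : 1 ≤ p) {σ : ℝ} (hσ : 0 < σ) (P : ℕ+ →₀ ℂ) :
    ∫ χ, ‖twistedPoly P χ σ‖ ^ p ∂haarTorus ≤ ∫ χ, ‖torusPoly P χ‖ ^ p ∂haarTorus := by
  have hs : 0 < (σ : ℂ).re := by simpa using hσ
  have hp0 : 0 < p := by linarith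
  have conv : ∀ {g : Torus → ℂ}, Continuous g → ENNReal.ofReal (∫ χ, ‖g χ‖ ^ p ∂haarTorus) =
      ∫⁻ χ, ‖g χ‖ₑ ^ p ∂haarTorus := fun {g} hg => by
    rw [ofReal_integral_eq_lintegral_ofReal
      (integrable_of_continuous (continuous_norm_rpow hp hg))
      (.of_forall fun χ => by positivity)]
    refine lintegral_congr fun χ => ?_
    rw [← ofReal_norm, ENNReal.ofReal_rpow_of_nonneg (norm_nonneg _) hp0.le]
  rw [← ENNReal.ofReal_le_ofReal_iff (integral_nonneg fun χ => by positivity),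
    conv (continuous_twistedPoly P σ), conv (torusPoly P).continuous]
  calc ∫⁻ χ, ‖twistedPoly P χ σ‖ₑ ^ p ∂haarTorus
      ≤ ∫⁻ χ, (∫⁻ τ, ‖torusPoly P (χ * kronecker τ)‖ₑ ^ p *
          ENNReal.ofReal (poissonKernelHP σ τ)) ∂haarTorus := by
        refine lintegral_mono fun χ => ?_
        rw [← poissonIntegral_torusPoly P χ hs]
        refine enorm_poisson_rpow_le hp hs (Continuous.aestronglyMeasurable ?_)
        exact (torusPoly P).continuous.comp (continuous_const.mul continuous_kronecker)
    _ = ∫⁻ χ, ‖torusPoly P χ‖ₑ ^ p ∂haarTorus := by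
        rw [lintegral_lintegral_flow (u := fun χ => ‖torusPoly P χ‖ₑ ^ p)
          ((torusPoly P).continuous.measurable.enorm.pow_const p)
          (continuous_poissonKernelHP hs).measurable.ennreal_ofReal,
          lintegral_poissonKernelHP hs, mul_one]

lemma tendsto_integral_twistedPoly_rpow {p : ℝ} (hp : 1 ≤ p) (P : ℕ+ →₀ ℂ) :
    Tendsto (fun σ : ℝ => ∫ χ, ‖twistedPoly P χ σ‖ ^ p ∂haarTorus) (𝓝[>] 0)
      (𝓝 (∫ χ, ‖torusPoly P χ‖ ^ p ∂haarTorus)) := by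
  have hp0 : 0 < p := by linarith
  refine tendsto_integral_filter_of_dominated_convergence (fun _ => (∑ n ∈ P.support, ‖P n‖) ^ p)
    (.of_forall fun σ => (continuous_norm_rpow hp
      (continuous_twistedPoly P σ)).aestronglyMeasurable) ?_ (integrable_const _)
    (.of_forall fun χ => ?_)
  · filter_upwards [self_mem_nhdsWithin] with σ hσ
    refine .of_forall fun χ => ?_
    rw [Real.norm_of_nonneg (by positivity)]
    refine Real.rpow_le_rpow (norm_nonneg _) ?_ hp0.le
    refine (norm_sum_le _ _).trans (Finset.sum_le_sum fun n _ => ?_)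
    rw [norm_verticalTerm]
    refine mul_le_of_le_one_right (norm_nonneg _) ?_
    exact Real.rpow_le_one_of_one_le_of_nonpos (by exact_mod_cast n.pos)
      (by simpa using (mem_Ioi.1 hσ).le)
  · have hc : Continuous fun σ : ℝ => ‖twistedPoly P χ σ‖ ^ p := by
      refine Continuous.rpow_const (Continuous.norm ?_) fun _ => Or.inr hp0.le
      refine continuous_finsetSum _ fun n _ => ?_
      unfold verticalTerm
      refine continuous_const.mul (Continuous.const_cpow (by fun_prop) (Or.inl ?_))
      exact_mod_cast n.ne_zero
    have := hc.tendsto 0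
    rw [Complex.ofReal_zero, twistedPoly_zero] at this
    exact this.mono_left nhdsWithin_le_nhds

/-- The norm of a Dirichlet polynomial in `𝓗^p` is the norm of the corresponding polynomial in
`L^p` of the torus. -/
theorem polyNorm_eq {p : ℝ} (hp : 1 ≤ p) (P : ℕ+ →₀ ℂ) :
    polyNorm p P = (∫ χ, ‖torusPoly P χ‖ ^ p ∂haarTorus) ^ (1 / p) := by
  have hp0 : 0 < p := by linarith
  have hle : ∀ σ : Ioi (0 : ℝ), polyMean p σ P ≤
      (∫ χ, ‖torusPoly P χ‖ ^ p ∂haarTorus) ^ (1 / p) := fun σ => by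
    rw [polyMean_eq hp]
    exact Real.rpow_le_rpow (integral_nonneg fun χ => by positivity)
      (integral_twistedPoly_rpow_le hp σ.2 P) (by positivity)
  refine le_antisymm (ciSup_le hle) ?_
  have hlim := (tendsto_integral_twistedPoly_rpow hp P).rpow_const
    (p := 1 / p) (Or.inr (by positivity))
  refine le_of_tendsto hlim ?_
  filter_upwards [self_mem_nhdsWithin] with σ hσ
  rw [← polyMean_eq hp]
  exact le_ciSup (f := fun σ : Ioi (0 : ℝ) => polyMean p σ P)
    ⟨_, by rintro _ ⟨σ, rfl⟩; exact hle σ⟩ ⟨σ, hσ⟩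

lemma memLp_of_continuous {g : Torus → ℂ} (hg : Continuous g) (p : ENNReal) :
    MemLp g p haarTorus :=
  hg.memLp_of_hasCompactSupport (HasCompactSupport.of_compactSpace g)

lemma eLpNorm_torusPoly {p : ℝ} (hp : 1 ≤ p) (P : ℕ+ →₀ ℂ) :
    eLpNorm (torusPoly P) (ENNReal.ofReal p) haarTorus = ENNReal.ofReal (polyNorm p P) := by
  have hp0 : 0 < p := by linarith
  rw [(memLp_of_continuous (torusPoly P).continuous _).eLpNorm_eq_integral_rpow_norm
    (by simpa using hp0) ENNReal.ofReal_ne_top, ENNReal.toReal_ofReal hp0.le, polyNorm_eq hp,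
    one_div]

/-! ### The Bohr lift as a limit of polynomials -/

lemma integrable_mul_conj_charValue {F : Torus → ℂ} (hF : Integrable F haarTorus) (q : ℚ) :
    Integrable (fun χ => F χ * (starRingEnd ℂ) (charValue χ q : ℂ)) haarTorus :=
  hF.mul_bdd (c := 1) (Continuous.aestronglyMeasurable
    (Complex.continuous_conj.comp (charMap q).continuous))
    (.of_forall fun χ => by rw [RCLike.norm_conj, norm_charValue])

lemma enorm_fourierCoeffTorus_sub_le {F G : Torus → ℂ} (hF : Integrable F haarTorus)
    (hG : Integrable G haarTorus) (q : ℚ) :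
    ‖fourierCoeffTorus F q - fourierCoeffTorus G q‖ₑ ≤ eLpNorm (F - G) 1 haarTorus := by
  unfold fourierCoeffTorus
  rw [← integral_sub (integrable_mul_conj_charValue hF q) (integrable_mul_conj_charValue hG q),
    eLpNorm_one_eq_lintegral_enorm]
  refine (enorm_integral_le_lintegral_enorm _).trans (lintegral_mono fun χ => ?_)
  rw [← sub_mul, enorm_mul, ← ofReal_norm ((starRingEnd ℂ) _), RCLike.norm_conj, norm_charValue]
  simp

lemma integral_charValue_mul_conj {q r : ℚ} (hq : 0 < q) (hr : 0 < r) :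
    ∫ χ, (charValue χ q : ℂ) * (starRingEnd ℂ) (charValue χ r : ℂ) ∂haarTorus =
      if q = r then 1 else 0 := by
  have e : ∀ χ, (charValue χ q : ℂ) * (starRingEnd ℂ) (charValue χ r : ℂ) =
      charValue χ (q * r⁻¹) := fun χ => by
    rw [charValue_mul_rat χ hq.ne' (inv_ne_zero hr.ne'), charValue_inv_rat χ hr.ne',
      Circle.coe_mul, Circle.coe_inv_eq_conj]
  simp only [e]
  split_ifs with h
  · simp [h, mul_inv_cancel₀ hr.ne']
  · refine integral_charValue_eq_zero (by positivity) fun h1 => h ?_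
    rwa [← div_eq_mul_inv, div_eq_one_iff_eq hr.ne'] at h1

lemma fourierCoeffTorus_torusPoly (P : ℕ+ →₀ ℂ) {q : ℚ} (hq : 0 < q) :
    fourierCoeffTorus (torusPoly P) q =
      ∑ n ∈ P.support, P n * if ((n : ℕ) : ℚ) = q then 1 else 0 := by
  unfold fourierCoeffTorus
  simp only [torusPoly_apply, Finset.sum_mul, mul_assoc]
  rw [integral_finsetSum]
  · refine Finset.sum_congr rfl fun n _ => ?_
    rw [integral_const_mul, integral_charValue_mul_conj (by exact_mod_cast n.pos) hq]
  · intro n _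
    exact integrable_of_continuous (continuous_const.mul ((charMap _).continuous.mul
      (Complex.continuous_conj.comp (charMap q).continuous)))

lemma fourierCoeffTorus_torusPoly_natCast (P : ℕ+ →₀ ℂ) (n : ℕ+) :
    fourierCoeffTorus (torusPoly P) ((n : ℕ) : ℚ) = P n := by
  rw [fourierCoeffTorus_torusPoly P (by exact_mod_cast n.pos)]
  simp only [Nat.cast_inj, PNat.coe_inj, mul_ite, mul_one, mul_zero, Finset.sum_ite_eq',
    Finsupp.mem_support_iff, ne_eq, ite_not]
  split_ifs with h
  · exact h.symm
  · rfl

lemma fourierCoeffTorus_torusPoly_of_notMem (P : ℕ+ →₀ ℂ) {q : ℚ} (hq : 0 < q)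
    (hq' : q ∉ range (Nat.cast : ℕ → ℚ)) : fourierCoeffTorus (torusPoly P) q = 0 := by
  rw [fourierCoeffTorus_torusPoly P hq]
  refine Finset.sum_eq_zero fun n _ => ?_
  rw [if_neg fun h => hq' ⟨n, h⟩, mul_zero]

/-- If the Dirichlet polynomials `P k` approximate the Dirichlet series with Bohr lift `F`, then
the corresponding polynomials on the torus converge to `F` in `L^p`. -/
theorem tendsto_eLpNorm_torusPoly_sub {p : ℝ} (hp : 1 ≤ p) {P : ℕ → ℕ+ →₀ ℂ} {a : ℕ+ → ℂ}
    (hP : Approximates p P a) {F : Torus → ℂ} (hF : IsBohrLift p a F) :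
    Tendsto (fun k => eLpNorm (⇑(torusPoly (P k)) - F) (ENNReal.ofReal p) haarTorus) atTop (𝓝 0) := by
  have hp1 : 1 ≤ ENNReal.ofReal p := by simpa using ENNReal.ofReal_le_ofReal hp
  have : Fact (1 ≤ ENNReal.ofReal p) := ⟨hp1⟩
  have hmem : ∀ k, MemLp (torusPoly (P k)) (ENNReal.ofReal p) haarTorus := fun k =>
    memLp_of_continuous (torusPoly (P k)).continuous _
  set f : ℕ → Lp ℂ (ENNReal.ofReal p) haarTorus := fun k => (hmem k).toLp _ with hf
  have hcau : CauchySeq f := by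
    rw [Metric.cauchySeq_iff]
    intro ε hε
    obtain ⟨N, hN⟩ := hP.1 ε hε
    refine ⟨N, fun m hm n hn => ?_⟩
    rw [dist_eq_norm, hf, ← MemLp.toLp_sub, Lp.norm_toLp]
    have := eLpNorm_torusPoly hp (P m - P n)
    rw [map_sub, ContinuousMap.coe_sub] at this
    rw [this]
    rw [ENNReal.toReal_ofReal']
    exact max_lt (hN m hm n hn) hε
  obtain ⟨G, hG⟩ := cauchySeq_tendsto_of_complete hcau
  have hlim : Tendsto (fun k => eLpNorm (⇑(torusPoly (P k)) - ⇑G) (ENNReal.ofReal p) haarTorus) atTop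
      (𝓝 0) := by
    rw [Lp.tendsto_Lp_iff_tendsto_eLpNorm'] at hG
    refine hG.congr fun k => eLpNorm_congr_ae ?_
    exact (hmem k).coeFn_toLp.sub (ae_eq_refl _)
  have hGi : Integrable G haarTorus := (Lp.memLp G).integrable hp1
  have hFi : Integrable F haarTorus := hF.1.1.integrable hp1
  have hcoeff : ∀ q, Tendsto (fun k => fourierCoeffTorus (torusPoly (P k)) q) atTop
      (𝓝 (fourierCoeffTorus G q)) := fun q => by
    rw [tendsto_iff_edist_tendsto_0]
    refine tendsto_of_tendsto_of_tendsto_of_le_of_le tendsto_const_nhds hlim (fun _ => zero_le)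
      fun k => ?_
    rw [edist_eq_enorm_sub]
    exact (enorm_fourierCoeffTorus_sub_le
      (integrable_of_continuous (torusPoly (P k)).continuous) hGi q).trans
      (eLpNorm_le_eLpNorm_of_exponent_le hp1 ((hmem k).1.sub (Lp.memLp G).1))
  have heq : ∀ q : ℚ, 0 < q → fourierCoeffTorus F q = fourierCoeffTorus G q := by
    intro q hq
    by_cases hq' : q ∈ range (Nat.cast : ℕ → ℚ)
    · obtain ⟨n, rfl⟩ := hq'
      have hn : 0 < n := by exact_mod_cast hq
      have h1 := hF.2 ⟨n, hn⟩
      have h2 := hcoeff ((n : ℕ) : ℚ)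
      have h3 := (hP.2 ⟨n, hn⟩).congr fun k =>
        (fourierCoeffTorus_torusPoly_natCast (P k) ⟨n, hn⟩).symm
      exact h1.trans (tendsto_nhds_unique h3 h2)
    · rw [hF.1.2 q hq hq']
      refine tendsto_nhds_unique ?_ (hcoeff q)
      exact tendsto_const_nhds.congr fun k =>
        (fourierCoeffTorus_torusPoly_of_notMem (P k) hq hq').symm
  have hFG : F =ᵐ[haarTorus] G := by
    have := ae_eq_zero_of_fourierCoeffTorus_eq_zero (hFi.sub hGi) fun q hq => by
      have h := sub_eq_zero.2 (heq q hq)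
      unfold fourierCoeffTorus at h ⊢
      rw [← integral_sub (integrable_mul_conj_charValue hFi q)
        (integrable_mul_conj_charValue hGi q)] at h
      simpa [sub_mul] using h
    filter_upwards [this] with χ hχ
    simpa [sub_eq_zero] using hχ
  refine hlim.congr fun k => eLpNorm_congr_ae ?_
  exact (ae_eq_refl _).sub hFG.symm

/-- The norm in `𝓗^p` of a Dirichlet series is the `L^p` norm of its Bohr lift. -/
theorem hpNorm_eq {p : ℝ} (hp : 1 ≤ p) {a : ℕ+ → ℂ} (ha : MemHp p a) {F : Torus → ℂ}
    (hF : IsBohrLift p a F) : hpNorm p a = (eLpNorm F (ENNReal.ofReal p) haarTorus).toReal := by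
  have hp1 : 1 ≤ ENNReal.ofReal p := by simpa using ENNReal.ofReal_le_ofReal hp
  have key : ∀ P, Approximates p P a → Tendsto (fun k => polyNorm p (P k)) atTop
      (𝓝 (eLpNorm F (ENNReal.ofReal p) haarTorus).toReal) := by
    intro P hP
    have hmem : ∀ k, MemLp (torusPoly (P k)) (ENNReal.ofReal p) haarTorus := fun k =>
      memLp_of_continuous (torusPoly (P k)).continuous _
    have hpn : ∀ k, polyNorm p (P k) =
        (eLpNorm (torusPoly (P k)) (ENNReal.ofReal p) haarTorus).toReal := fun k => by
      rw [eLpNorm_torusPoly hp, ENNReal.toReal_ofReal]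
      rw [polyNorm_eq hp]; positivity
    have h := tendsto_eLpNorm_torusPoly_sub hp hP hF
    have h' := (ENNReal.tendsto_toReal ENNReal.zero_ne_top).comp h
    rw [tendsto_iff_dist_tendsto_zero]
    refine squeeze_zero (fun _ => dist_nonneg) (fun k => ?_) h'
    have : Fact (1 ≤ ENNReal.ofReal p) := ⟨hp1⟩
    rw [hpn, Real.dist_eq, ← Lp.norm_toLp _ (hmem k), ← Lp.norm_toLp _ hF.1.1]
    refine (abs_norm_sub_norm_le _ _).trans ?_
    rw [← MemLp.toLp_sub, Lp.norm_toLp]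
    rfl
  obtain ⟨P, hP⟩ := ha
  have : {r | ∃ P, Approximates p P a ∧ Tendsto (fun k => polyNorm p (P k)) atTop (𝓝 r)} =
      {(eLpNorm F (ENNReal.ofReal p) haarTorus).toReal} := by
    ext r
    constructor
    · rintro ⟨Q, hQ, hr⟩
      exact tendsto_nhds_unique hr (key Q hQ)
    · rintro rfl
      exact ⟨P, hP, key P hP⟩
  rw [hpNorm, this, csInf_singleton]

lemma hpNorm_rpow_eq {p : ℝ} (hp : 1 ≤ p) {a : ℕ+ → ℂ} (ha : MemHp p a) {F : Torus → ℂ}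
    (hF : IsBohrLift p a F) : hpNorm p a ^ p = ∫ χ, ‖F χ‖ ^ p ∂haarTorus := by
  have hp0 : 0 < p := by linarith
  have h0 : 0 ≤ ∫ χ, ‖F χ‖ ^ p ∂haarTorus := integral_nonneg fun χ => by positivity
  rw [hpNorm_eq hp ha hF, hF.1.1.eLpNorm_eq_integral_rpow_norm (by simpa using hp0)
    ENNReal.ofReal_ne_top, ENNReal.toReal_ofReal hp0.le, ENNReal.toReal_ofReal (by positivity),
    ← Real.rpow_mul h0, inv_mul_cancel₀ hp0.ne', Real.rpow_one]

/-! ### The maximal ergodic inequality -/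

section Maximal

variable {α : Type*}

/-- The largest of the Birkhoff sums `S₀ f, …, Sₙ f`, in the recursive form on which Garsia's proof of
the maximal ergodic theorem relies. -/
def maxBirkhoffSum (T : α → α) (f : α → ℝ) : ℕ → α → ℝ
  | 0 => 0
  | n + 1 => fun x => max 0 (f x + maxBirkhoffSum T f n (T x))

lemma maxBirkhoffSum_nonneg (T : α → α) (f : α → ℝ) (n : ℕ) (x : α) :
    0 ≤ maxBirkhoffSum T f n x := by
  cases n with
  | zero => exact le_rfl
  | succ n => exact le_max_left _ _

lemma maxBirkhoffSum_le_succ (T : α → α) (f : α → ℝ) (n : ℕ) (x : α) :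
    maxBirkhoffSum T f n x ≤ maxBirkhoffSum T f (n + 1) x := by
  induction n generalizing x with
  | zero => exact maxBirkhoffSum_nonneg T f 1 x
  | succ n ih => exact max_le_max le_rfl (add_le_add le_rfl (ih _))

lemma birkhoffSum_le_maxBirkhoffSum (T : α → α) (f : α → ℝ) (n : ℕ) (x : α) :
    birkhoffSum T f n x ≤ maxBirkhoffSum T f n x := by
  induction n generalizing x with
  | zero => simp [maxBirkhoffSum]
  | succ n ih =>
    rw [birkhoffSum_succ']
    exact (add_le_add le_rfl (ih _)).trans (le_max_right _ _)

variable [MeasurableSpace α] {μ : Measure α} {T : α → α} {f : α → ℝ}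

lemma measurable_maxBirkhoffSum (hT : Measurable T) (hf : Measurable f) (n : ℕ) :
    Measurable (maxBirkhoffSum T f n) := by
  induction n with
  | zero => exact measurable_zero
  | succ n ih => exact measurable_const.max (hf.add (ih.comp hT))

lemma integrable_maxBirkhoffSum (hT : MeasurePreserving T μ μ) (hf : Integrable f μ) (n : ℕ) :
    Integrable (maxBirkhoffSum T f n) μ := by
  induction n with
  | zero => exact integrable_zero _ _ _
  | succ n ih => exact (integrable_zero _ _ _).sup (hf.add (hT.integrable_comp_of_integrable ih))

/-- The maximal ergodic theorem, by Garsia's argument. -/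
theorem setIntegral_nonneg_of_maxBirkhoffSum_pos (hT : MeasurePreserving T μ μ)
    (hfm : Measurable f) (hf : Integrable f μ) (n : ℕ) :
    0 ≤ ∫ x in {x | 0 < maxBirkhoffSum T f n x}, f x ∂μ := by
  cases n with
  | zero => simp [maxBirkhoffSum]
  | succ n =>
    set M := maxBirkhoffSum T f (n + 1) with hM
    have hMi : Integrable M μ := integrable_maxBirkhoffSum hT hf _
    have hMT : Integrable (fun x => M (T x)) μ := hT.integrable_comp_of_integrable hMi
    have hMm : Measurable M := measurable_maxBirkhoffSum hT.measurable hfm _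
    have hs : MeasurableSet {x | 0 < M x} := measurableSet_lt measurable_const hMm
    have h1 : ∫ x in {x | 0 < M x}, (M x - M (T x)) ∂μ ≤ ∫ x in {x | 0 < M x}, f x ∂μ := by
      refine setIntegral_mono_on (hMi.sub hMT).integrableOn hf.integrableOn hs fun x hx => ?_
      have hx' : M x = f x + maxBirkhoffSum T f n (T x) := by
        rcases max_choice 0 (f x + maxBirkhoffSum T f n (T x)) with h | h
        · exact absurd (h.symm.trans_gt hx) (lt_irrefl _)
        · exact h
      have := maxBirkhoffSum_le_succ T f n (T x)
      rw [hx']; linarith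
    have h2 : ∫ x in {x | 0 < M x}, M x ∂μ = ∫ x, M x ∂μ := by
      refine setIntegral_eq_integral_of_forall_compl_eq_zero fun x hx => ?_
      exact le_antisymm (not_lt.1 hx) (maxBirkhoffSum_nonneg T f _ x)
    have h3 : ∫ x in {x | 0 < M x}, M (T x) ∂μ ≤ ∫ x, M (T x) ∂μ :=
      setIntegral_le_integral hMT (.of_forall fun x => maxBirkhoffSum_nonneg T f _ _)
    have h4 : ∫ x, M (T x) ∂μ = ∫ x, M x ∂μ := by
      rw [← integral_map hT.aemeasurable (by rw [hT.map_eq]; exact hMi.1), hT.map_eq]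
    rw [integral_sub hMi.integrableOn hMT.integrableOn] at h1
    linarith

/-- The weak type inequality for the maximal function of the Birkhoff averages. -/
theorem measure_exists_lt_birkhoffSum_le [IsProbabilityMeasure μ] (hT : MeasurePreserving T μ μ)
    (hfm : Measurable f) (hf : Integrable f μ) (h0 : ∀ x, 0 ≤ f x) {c : ℝ} (hc : 0 < c) :
    μ {x | ∃ n : ℕ, n * c < birkhoffSum T f n x} ≤ ENNReal.ofReal ((∫ x, f x ∂μ) / c) := by
  -- The averages of `f` exceed `c` where the Birkhoff sums of `f - c` are positive.
  set g : α → ℝ := fun x => f x - c with hg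
  have hgm : Measurable g := hfm.sub_const c
  have hgi : Integrable g μ := hf.sub (integrable_const c)
  have hsum : ∀ n x, birkhoffSum T g n x = birkhoffSum T f n x - n * c := fun n x => by
    simp [birkhoffSum, hg, Finset.sum_sub_distrib]
  have hsub : {x | ∃ n : ℕ, n * c < birkhoffSum T f n x} ⊆
      ⋃ n, {x | 0 < maxBirkhoffSum T g n x} := by
    rintro x ⟨n, hn⟩
    refine mem_iUnion.2 ⟨n, ?_⟩
    have := birkhoffSum_le_maxBirkhoffSum T g n x
    rw [hsum] at this
    exact lt_of_lt_of_le (sub_pos.2 hn) this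
  have hmono : Monotone fun n => {x | 0 < maxBirkhoffSum T g n x} :=
    monotone_nat_of_le_succ fun n x hx => lt_of_lt_of_le hx (maxBirkhoffSum_le_succ T g n x)
  refine (measure_mono hsub).trans ?_
  rw [hmono.measure_iUnion]
  refine iSup_le fun n => ?_
  have h := setIntegral_nonneg_of_maxBirkhoffSum_pos hT hgm hgi n
  rw [integral_sub hf.integrableOn (integrable_const c).integrableOn, setIntegral_const,
    smul_eq_mul] at h
  have h2 := setIntegral_le_integral (s := {x | 0 < maxBirkhoffSum T g n x}) hf (.of_forall h0)
  rw [← ofReal_measureReal]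
  refine ENNReal.ofReal_le_ofReal ?_
  rw [le_div_iff₀ hc]
  linarith

end Maximal

/-! ### The ergodic theorem for the Kronecker flow -/

lemma measurePreserving_mul_kronecker (t : ℝ) :
    MeasurePreserving (fun χ : Torus => χ * kronecker t) haarTorus haarTorus :=
  measurePreserving_mul_right haarTorus (kronecker t)

lemma ae_intervalIntegrable_flow {h : Torus → ℝ} (hm : Measurable h)
    (hi : Integrable h haarTorus) :
    ∀ᵐ χ ∂haarTorus, ∀ a b, IntervalIntegrable (fun τ => h (χ * kronecker τ)) volume a b := by
  have key : ∀ n : ℕ, ∀ᵐ χ ∂haarTorus,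
      IntegrableOn (fun τ => h (χ * kronecker τ)) (Icc (-n) n) := by
    intro n
    have hk : Measurable ((Icc (-n : ℝ) n).indicator (1 : ℝ → ENNReal)) :=
      measurable_one.indicator measurableSet_Icc
    have h1 := lintegral_lintegral_flow hm.enorm hk
    have hfin : ∫⁻ χ, ∫⁻ τ in Icc (-n : ℝ) n, ‖h (χ * kronecker τ)‖ₑ ∂volume ∂haarTorus ≠ ⊤ := by
      have e : ∀ χ, ∫⁻ τ, ‖h (χ * kronecker τ)‖ₑ * (Icc (-n : ℝ) n).indicator 1 τ =
          ∫⁻ τ in Icc (-n : ℝ) n, ‖h (χ * kronecker τ)‖ₑ := fun χ => by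
        rw [← lintegral_indicator measurableSet_Icc]
        refine lintegral_congr fun τ => ?_
        by_cases hτ : τ ∈ Icc (-n : ℝ) n <;> simp [hτ]
      simp only [e] at h1
      rw [h1, lintegral_indicator measurableSet_Icc]
      refine ENNReal.mul_ne_top hi.2.ne ?_
      simp
    have hmeas : Measurable fun χ => ∫⁻ τ in Icc (-n : ℝ) n, ‖h (χ * kronecker τ)‖ₑ :=
      Measurable.lintegral_prod_right (hm.comp continuous_flow.measurable).enorm
    filter_upwards [ae_lt_top hmeas hfin] with χ hχ
    exact ⟨(hm.comp (continuous_const.mul continuous_kronecker).measurable).aestronglyMeasurable,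
      hχ⟩
  filter_upwards [ae_all_iff.2 key] with χ hχ a b
  obtain ⟨n, hn⟩ := exists_nat_ge (max |a| |b|)
  have ha := (le_max_left _ _).trans hn
  have hb := (le_max_right _ _).trans hn
  rw [abs_le] at ha hb
  exact ⟨(hχ n).mono_set fun x hx => ⟨ha.1.trans hx.1.le, hx.2.trans hb.2⟩,
    (hχ n).mono_set fun x hx => ⟨hb.1.trans hx.1.le, hx.2.trans ha.2⟩⟩

lemma ae_intervalIntegrable_flow_mul {h : Torus → ℝ} (hm : Measurable h)
    (hi : Integrable h haarTorus) {c : ℝ} (hc : c ≠ 0) :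
    ∀ᵐ χ ∂haarTorus, ∀ a b, IntervalIntegrable (fun τ => h (χ * kronecker (c * τ))) volume a b := by
  filter_upwards [ae_intervalIntegrable_flow hm hi] with χ hχ a b
  have := (hχ (c * a) (c * b)).comp_mul_left (c := c)
  rwa [mul_div_cancel_left₀ _ hc, mul_div_cancel_left₀ _ hc] at this

/-- The weak type inequality for the maximal function of the averages along the flow. -/
lemma measure_exists_lt_integral_flow_le {u : Torus → ℝ} (hm : Measurable u)
    (hi : Integrable u haarTorus) (h0 : ∀ χ, 0 ≤ u χ) {c : ℝ} (hc : c ≠ 0) {l : ℝ} (hl : 0 < l) :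
    haarTorus {χ | ∃ T ≥ 1, 2 * l * T < ∫ τ in (0 : ℝ)..T, u (χ * kronecker (c * τ))} ≤
      ENNReal.ofReal ((∫ χ, u χ ∂haarTorus) / l) := by
  -- The integrals over `[0, n]` are the Birkhoff sums of `U` under the time-one map of the flow.
  set U : Torus → ℝ := fun χ => ∫ τ in (0 : ℝ)..1, u (χ * kronecker (c * τ)) with hU
  have hflow : Continuous fun z : Torus × ℝ => z.1 * kronecker (c * z.2) :=
    continuous_fst.mul (continuous_kronecker.comp (by fun_prop))
  have hum : Measurable fun z : Torus × ℝ => u (z.1 * kronecker (c * z.2)) :=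
    hm.comp hflow.measurable
  have hUm : Measurable U := by
    simp only [hU, intervalIntegral.integral_of_le zero_le_one]
    exact (StronglyMeasurable.integral_prod_right' hum.stronglyMeasurable).measurable
  have hprod : Integrable (fun z : Torus × ℝ => u (z.1 * kronecker (c * z.2)))
      (haarTorus.prod (volume.restrict (Ioc 0 1))) := by
    rw [integrable_prod_iff' hum.aestronglyMeasurable]
    have e : ∀ τ : ℝ, ∫ χ, ‖u (χ * kronecker (c * τ))‖ ∂haarTorus = ∫ χ, ‖u χ‖ ∂haarTorus :=
      fun τ => integral_mul_right_eq_self (μ := haarTorus) (fun χ => ‖u χ‖) _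
    refine ⟨.of_forall fun τ => hi.comp_mul_right (kronecker (c * τ)), ?_⟩
    simp only [e]
    exact integrable_const _
  have hUi : Integrable U haarTorus := by
    simp only [hU, intervalIntegral.integral_of_le zero_le_one]
    exact hprod.integral_prod_left
  have hUint : ∫ χ, U χ ∂haarTorus = ∫ χ, u χ ∂haarTorus := by
    simp only [hU, intervalIntegral.integral_of_le zero_le_one]
    rw [integral_integral_swap hprod]
    have e : ∀ τ : ℝ, ∫ χ, u (χ * kronecker (c * τ)) ∂haarTorus = ∫ χ, u χ ∂haarTorus :=
      fun τ => integral_mul_right_eq_self (μ := haarTorus) u _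
    simp [e]
  have hU0 : ∀ χ, 0 ≤ U χ := fun χ =>
    intervalIntegral.integral_nonneg zero_le_one fun τ _ => h0 _
  rw [← hUint]
  refine le_trans (measure_mono_ae ?_) (measure_exists_lt_birkhoffSum_le
    (measurePreserving_mul_kronecker c) hUm hUi hU0 hl)
  filter_upwards [ae_intervalIntegrable_flow_mul hm hi hc] with χ hχ
  rintro ⟨T, hT, hlt⟩
  have hsum : ∀ n : ℕ, birkhoffSum (fun χ => χ * kronecker c) U n χ =
      ∫ τ in (0 : ℝ)..n, u (χ * kronecker (c * τ)) := by
    have hit : ∀ k : ℕ, (fun χ : Torus => χ * kronecker c)^[k] χ = χ * kronecker (c * k) := by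
      intro k
      induction k with
      | zero => simp
      | succ k ih =>
        rw [Function.iterate_succ_apply', ih, mul_assoc, ← kronecker_add]
        congr 2; push_cast; ring
    intro n
    have := intervalIntegral.sum_integral_adjacent_intervals (n := n) (a := fun k : ℕ => (k : ℝ))
      (μ := volume) (f := fun τ => u (χ * kronecker (c * τ))) fun k _ => hχ _ _
    rw [Nat.cast_zero] at this
    rw [← this, birkhoffSum]
    refine Finset.sum_congr rfl fun k _ => ?_
    rw [hit, hU]
    have e : ∀ τ : ℝ, χ * kronecker (c * k) * kronecker (c * τ) =
        χ * kronecker (c * (τ + k)) := fun τ => by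
      rw [mul_assoc, ← kronecker_add]; congr 2; ring
    simp only [e]
    rw [intervalIntegral.integral_comp_add_right (fun τ => u (χ * kronecker (c * τ)))]
    simp [add_comm]
  refine ⟨⌈T⌉₊, ?_⟩
  rw [hsum]
  have h1 : (⌈T⌉₊ : ℝ) < T + 1 := Nat.ceil_lt_add_one (by linarith)
  have h2 : ∫ τ in (0 : ℝ)..T, u (χ * kronecker (c * τ)) ≤
      ∫ τ in (0 : ℝ)..⌈T⌉₊, u (χ * kronecker (c * τ)) :=
    intervalIntegral.integral_mono_interval le_rfl (by linarith) (Nat.le_ceil T)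
      (.of_forall fun τ => h0 _) (hχ _ _)
  nlinarith

/-- The one-sided pointwise ergodic theorem. The function is approximated by continuous functions so
fast that, by the weak type inequality and the Borel–Cantelli lemma, for almost every `χ` the error
terms eventually have small means over all intervals `[0, T]`, `T ≥ 1`. -/
lemma ae_tendsto_mean_flow {h : Torus → ℝ} (hm : Measurable h) (hi : Integrable h haarTorus)
    {c : ℝ} (hc : c ≠ 0) :
    ∀ᵐ χ ∂haarTorus, Tendsto (fun T : ℝ => T⁻¹ * ∫ τ in (0 : ℝ)..T, h (χ * kronecker (c * τ)))
      atTop (𝓝 (∫ χ, h χ ∂haarTorus)) := by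
  have hex : ∀ j : ℕ, ∃ g : BoundedContinuousFunction Torus ℝ,
      ∫ χ, ‖h χ - g χ‖ ∂haarTorus ≤ (1 / 4) ^ j ∧ Integrable g haarTorus := fun j =>
    hi.exists_boundedContinuous_integral_sub_le (by positivity)
  choose g hg hgi using hex
  set u : ℕ → Torus → ℝ := fun j χ => ‖h χ - g j χ‖ with hu
  have hum : ∀ j, Measurable (u j) := fun j => (hm.sub (g j).continuous.measurable).norm
  have hui : ∀ j, Integrable (u j) haarTorus := fun j => (hi.sub (hgi j)).norm
  have hle : ∀ j, haarTorus {χ | ∃ T ≥ 1, 2 * (1 / 2) ^ j * T <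
      ∫ τ in (0 : ℝ)..T, u j (χ * kronecker (c * τ))} ≤ ENNReal.ofReal ((1 / 2) ^ j) := fun j => by
    refine (measure_exists_lt_integral_flow_le (hum j) (hui j) (fun χ => norm_nonneg _) hc
      (by positivity)).trans (ENNReal.ofReal_le_ofReal ?_)
    rw [div_le_iff₀ (by positivity), ← mul_pow]
    refine (hg j).trans (le_of_eq ?_)
    norm_num
  have hsum : ∑' j, haarTorus {χ | ∃ T ≥ 1, 2 * (1 / 2) ^ j * T <
      ∫ τ in (0 : ℝ)..T, u j (χ * kronecker (c * τ))} ≠ ⊤ := by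
    refine ((ENNReal.tsum_le_tsum hle).trans_lt ?_).ne
    rw [← ENNReal.ofReal_tsum_of_nonneg (fun j => by positivity)
      (summable_geometric_of_lt_one (by norm_num) (by norm_num))]
    exact ENNReal.ofReal_lt_top
  filter_upwards [ae_eventually_notMem hsum, ae_intervalIntegrable_flow_mul hm hi hc] with χ hχ hint
  rw [Metric.tendsto_atTop']
  intro ε hε
  have hsmall : ∀ᶠ j : ℕ in atTop, (1 / 2 : ℝ) ^ j < ε / 4 :=
    (tendsto_pow_atTop_nhds_zero_of_lt_one (by norm_num) (by norm_num)).eventually_lt_const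
      (by positivity)
  obtain ⟨j, hj, hj2⟩ := (hχ.and hsmall).exists
  obtain ⟨N, hN⟩ := Metric.tendsto_atTop'.1 (tendsto_mean_of_continuous (g j).continuous χ hc)
    (ε / 4) (by positivity)
  refine ⟨max N 1, fun T hT => ?_⟩
  have hT1 : 1 < T := (le_max_right _ _).trans_lt hT
  have hT0 : 0 < T := by linarith
  have hgint : ∀ a b, IntervalIntegrable (fun τ => g j (χ * kronecker (c * τ))) volume a b :=
    fun a b => ((g j).continuous.comp (continuous_const.mul
      (continuous_kronecker.comp (by fun_prop)))).intervalIntegrable _ _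
  have h1 : |T⁻¹ * (∫ τ in (0 : ℝ)..T, h (χ * kronecker (c * τ))) -
      T⁻¹ * ∫ τ in (0 : ℝ)..T, g j (χ * kronecker (c * τ))| ≤ 2 * (1 / 2) ^ j := by
    have hub : ∫ τ in (0 : ℝ)..T, u j (χ * kronecker (c * τ)) ≤ 2 * (1 / 2) ^ j * T := by
      by_contra hcon
      exact hj ⟨T, hT1.le, not_le.1 hcon⟩
    rw [← mul_sub, ← intervalIntegral.integral_sub (hint _ _) (hgint _ _), abs_mul,
      abs_of_pos (inv_pos.2 hT0), inv_mul_le_iff₀ hT0, mul_comm T]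
    exact (intervalIntegral.abs_integral_le_integral_abs hT0.le).trans hub
  have h2 : |∫ χ, g j χ ∂haarTorus - ∫ χ, h χ ∂haarTorus| ≤ (1 / 2) ^ j := by
    rw [abs_sub_comm, ← integral_sub hi (hgi j)]
    refine (abs_integral_le_integral_abs).trans ((hg j).trans ?_)
    exact pow_le_pow_left₀ (by norm_num) (by norm_num) j
  have h3 := hN T ((le_max_left _ _).trans_lt hT)
  have := dist_triangle4 (T⁻¹ * ∫ τ in (0 : ℝ)..T, h (χ * kronecker (c * τ)))
    (T⁻¹ * ∫ τ in (0 : ℝ)..T, g j (χ * kronecker (c * τ))) (∫ χ, g j χ ∂haarTorus)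
    (∫ χ, h χ ∂haarTorus)
  rw [← Real.dist_eq] at h1 h2
  linarith

/-- The pointwise ergodic theorem for the Kronecker flow. -/
theorem ae_tendsto_symmetric_mean_flow {h : Torus → ℝ} (hm : Measurable h)
    (hi : Integrable h haarTorus) :
    ∀ᵐ χ ∂haarTorus, Tendsto (fun T : ℝ => 1 / (2 * T) * ∫ τ in (-T)..T, h (χ * kronecker τ))
      atTop (𝓝 (∫ χ, h χ ∂haarTorus)) := by
  filter_upwards [ae_tendsto_mean_flow hm hi one_ne_zero,
    ae_tendsto_mean_flow hm hi (neg_ne_zero.2 one_ne_zero),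
    ae_intervalIntegrable_flow hm hi] with χ h1 h2 h3
  refine tendsto_symmetric_mean h3 ?_ ?_
  · simpa using h1
  · simpa using h2

/-- The set `E_f` has full measure. -/
theorem ae_mem_ergodicSet {p : ℝ} (hp : 1 ≤ p) {a : ℕ+ → ℂ} (ha : MemHp p a) {F : Torus → ℂ}
    (hF : IsBohrLift p a F) : ∀ᵐ χ ∂haarTorus, χ ∈ ergodicSet p a F := by
  have hp0 : 0 < p := by linarith
  set G : Torus → ℂ := hF.1.1.1.mk F with hG
  have hFG : F =ᵐ[haarTorus] G := hF.1.1.1.ae_eq_mk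
  have hGm : Measurable G := hF.1.1.1.stronglyMeasurable_mk.measurable
  have hGL : MemLp G (ENNReal.ofReal p) haarTorus := hF.1.1.ae_eq hFG
  have hm : Measurable fun χ => ‖G χ‖ ^ p := hGm.norm.pow_const p
  have hi : Integrable (fun χ => ‖G χ‖ ^ p) haarTorus := by
    have := hGL.integrable_norm_rpow (by simpa using hp0) ENNReal.ofReal_ne_top
    rwa [ENNReal.toReal_ofReal hp0.le] at this
  have hnorm : hpNorm p a ^ p = ∫ χ, ‖G χ‖ ^ p ∂haarTorus := by
    rw [hpNorm_rpow_eq hp ha hF]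
    refine integral_congr_ae ?_
    filter_upwards [hFG] with χ hχ
    rw [hχ]
  filter_upwards [ae_tendsto_symmetric_mean_flow hm hi, ae_intervalIntegrable_flow hm hi,
    ae_orbit_ae_eq hFG] with χ h1 h2 h3
  have hom : Measurable (orbit G χ) :=
    hGm.comp (continuous_const.mul continuous_kronecker).measurable
  refine ⟨fun T hT => ?_, ?_⟩
  · have hGT : MemLp (orbit G χ) (ENNReal.ofReal p) (volume.restrict (Icc (-T) T)) := by
      rw [← integrable_norm_rpow_iff hom.aestronglyMeasurable (by simpa using hp0)
        ENNReal.ofReal_ne_top, ENNReal.toReal_ofReal hp0.le]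
      exact (integrableOn_Icc_iff_integrableOn_Ioc (by simp)).2 (h2 (-T) T).1
    exact hGT.ae_eq (ae_restrict_of_ae h3.symm)
  · rw [hnorm]
    refine h1.congr fun T => ?_
    congr 1
    refine intervalIntegral.integral_congr_ae ?_
    filter_upwards [h3] with τ hτ _
    rw [hτ]; rfl

/-! ### Homogeneous functions of one coordinate -/

/-- The function `H` on the torus is homogeneous of degree `m` in the coordinate `q`. -/
def HasWeight (q : Nat.Primes) (m : ℤ) (H : Torus → ℂ) : Prop :=
  ∀ (χ : Torus) (z : Circle), H (χ * Pi.mulSingle q z) = (z : ℂ) ^ m * H χ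

section Weight

variable {q : Nat.Primes} {m m' : ℤ} {H H' : Torus → ℂ}

lemma HasWeight.mul (h : HasWeight q m H) (h' : HasWeight q m' H') :
    HasWeight q (m + m') fun χ => H χ * H' χ := fun χ z => by
  beta_reduce
  rw [h, h', zpow_add₀ z.coe_ne_zero]; ring

lemma HasWeight.conj (h : HasWeight q m H) :
    HasWeight q (-m) fun χ => (starRingEnd ℂ) (H χ) := fun χ z => by
  beta_reduce
  rw [h, map_mul, map_zpow₀, zpow_neg, ← inv_zpow, ← Circle.coe_inv_eq_conj, Circle.coe_inv]

lemma HasWeight.norm (h : HasWeight q m H) (χ : Torus) (z : Circle) :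
    ‖H (χ * Pi.mulSingle q z)‖ = ‖H χ‖ := by
  rw [h, norm_mul, norm_zpow, Circle.norm_coe, one_zpow, one_mul]

lemma HasWeight.integral_eq_zero (h : HasWeight q m H) (hm : m ≠ 0) :
    ∫ χ, H χ ∂haarTorus = 0 := by
  have hm' : (m : ℂ) ≠ 0 := by exact_mod_cast hm
  have h1 := integral_mul_right_eq_self (μ := haarTorus) H
    (Pi.mulSingle q (Circle.exp (Real.pi / m)))
  have hz : ((Circle.exp (Real.pi / m) : Circle) : ℂ) ^ m = -1 := by
    rw [Circle.coe_exp, ← Complex.exp_int_mul, ← Complex.exp_pi_mul_I]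
    congr 1; push_cast; field_simp
  simp only [h _ _, hz] at h1
  rw [integral_const_mul] at h1
  linear_combination (-1 / 2 : ℂ) * h1

/-- The phase of `H`, with the value `1` at the zeros of `H`, so that its modulus is `1` everywhere.
At these zeros the homogeneity of `H` is lost. -/
def unitPhase (H : Torus → ℂ) (χ : Torus) : ℂ := if H χ = 0 then 1 else H χ / ‖H χ‖

lemma norm_unitPhase (H : Torus → ℂ) (χ : Torus) : ‖unitPhase H χ‖ = 1 := by
  unfold unitPhase
  split_ifs with h
  · simp
  · simp [h]

lemma HasWeight.unitPhase (h : HasWeight q 0 H) : HasWeight q 0 (unitPhase H) := fun χ z => by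
  have := h χ z
  rw [zpow_zero, one_mul] at this
  simp [DirichletHardy.unitPhase, this]

lemma measurable_unitPhase (hH : Measurable H) : Measurable (unitPhase H) :=
  Measurable.ite (hH (measurableSet_singleton 0)) measurable_const
    (hH.div (Complex.measurable_ofReal.comp hH.norm))

lemma mul_conj_unitPhase (H : Torus → ℂ) (χ : Torus) :
    H χ * (starRingEnd ℂ) (unitPhase H χ) = (‖H χ‖ : ℂ) := by
  unfold unitPhase
  split_ifs with h
  · simp [h]
  · have h' : (‖H χ‖ : ℂ) ≠ 0 := by simpa using h
    rw [map_div₀, Complex.conj_ofReal, mul_div_assoc', Complex.mul_conj, Complex.normSq_eq_norm_sq]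
    push_cast
    field_simp

/-- The phase of `H`, with the value `0` at the zeros of `H`; it is homogeneous of the same degree as
`H`. -/
def phase (H : Torus → ℂ) (χ : Torus) : ℂ := H χ / ‖H χ‖

lemma norm_phase_le (H : Torus → ℂ) (χ : Torus) : ‖phase H χ‖ ≤ 1 := by
  unfold phase
  rw [norm_div, Complex.norm_real, norm_norm]
  exact div_self_le_one _

lemma HasWeight.phase (h : HasWeight q m H) : HasWeight q m (phase H) := fun χ z => by
  unfold DirichletHardy.phase
  rw [h.norm, h, mul_div_assoc]

lemma measurable_phase (hH : Measurable H) : Measurable (phase H) :=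
  hH.div (Complex.measurable_ofReal.comp hH.norm)

lemma mul_conj_phase (H : Torus → ℂ) (χ : Torus) :
    H χ * (starRingEnd ℂ) (phase H χ) = (‖H χ‖ : ℂ) := by
  unfold phase
  rw [map_div₀, Complex.conj_ofReal, mul_div_assoc', Complex.mul_conj, Complex.normSq_eq_norm_sq]
  by_cases h : H χ = 0
  · simp [h]
  have h' : (‖H χ‖ : ℂ) ≠ 0 := by simpa using h
  push_cast
  field_simp

/-! ### Coefficient estimates in one coordinate -/

section Coordinate

variable {K : ℕ} {g : ℕ → C(Torus, ℂ)}

lemma integrable_mul_of_norm_le (f : C(Torus, ℂ)) {h : Torus → ℂ} (hh : Measurable h) {b : ℝ}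
    (hb : ∀ χ, ‖h χ‖ ≤ b) : Integrable (fun χ => f χ * h χ) haarTorus :=
  (integrable_of_continuous f.continuous).mul_bdd hh.aestronglyMeasurable (.of_forall hb)

/-- A test function of degree `m` only sees the component of degree `-m`. -/
lemma integral_sum_mul_of_hasWeight (hg : ∀ k : ℕ, HasWeight q k (g k)) {h : Torus → ℂ}
    (hh : Measurable h) {b : ℝ} (hb : ∀ χ, ‖h χ‖ ≤ b) (hw : HasWeight q m h) :
    ∫ χ, (∑ k ∈ Finset.range K, g k) χ * h χ ∂haarTorus =
      ∑ k ∈ Finset.range K, if (k : ℤ) = -m then ∫ χ, g k χ * h χ ∂haarTorus else 0 := by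
  simp only [ContinuousMap.coe_sum, Finset.sum_apply, Finset.sum_mul]
  rw [integral_finsetSum _ fun k _ => integrable_mul_of_norm_le (g k) hh hb]
  refine Finset.sum_congr rfl fun k _ => ?_
  split_ifs with hk
  · rfl
  · exact ((hg k).mul hw).integral_eq_zero fun h0 => hk (by linarith)

lemma integral_norm_component_le (hg : ∀ k : ℕ, HasWeight q k (g k)) {k : ℕ} (hk : k < K) :
    ∫ χ, ‖g k χ‖ ∂haarTorus ≤ ∫ χ, ‖(∑ j ∈ Finset.range K, g j) χ‖ ∂haarTorus := by
  set G := ∑ j ∈ Finset.range K, g j with hG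
  have hm : Measurable fun χ => (starRingEnd ℂ) (phase (g k) χ) :=
    Complex.continuous_conj.measurable.comp (measurable_phase (g k).continuous.measurable)
  have hb : ∀ χ, ‖(starRingEnd ℂ) (phase (g k) χ)‖ ≤ 1 := fun χ => by
    rw [RCLike.norm_conj]; exact norm_phase_le _ _
  have h1 := integral_sum_mul_of_hasWeight (K := K) hg hm hb (hg k).phase.conj
  simp only [neg_neg, Nat.cast_inj, Finset.sum_ite_eq', Finset.mem_range, hk, if_true,
    mul_conj_phase] at h1
  rw [integral_complex_ofReal] at h1
  have h2 : ‖∫ χ, G χ * (starRingEnd ℂ) (phase (g k) χ) ∂haarTorus‖ ≤ ∫ χ, ‖G χ‖ ∂haarTorus :=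
    norm_integral_le_of_norm_le (integrable_of_continuous G.continuous).norm
      (.of_forall fun χ => by
        rw [norm_mul]; exact mul_le_of_le_one_right (norm_nonneg _) (hb χ))
  rw [h1, Complex.norm_real] at h2
  exact (le_abs_self _).trans h2

/-- The bound is quadratic in `ε`, as `c̄ - c` is imaginary. -/
lemma norm_one_add_mul_conj_sub_le {c : ℂ} (hc : ‖c‖ ≤ 1) (ε : ℝ) :
    ‖1 + ε * ((starRingEnd ℂ) c - c)‖ ≤ 1 + 2 * ε ^ 2 := by
  have him : |c.im| ≤ 1 := (Complex.abs_im_le_norm c).trans hc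
  have e : (1 + ε * ((starRingEnd ℂ) c - c) : ℂ) = ⟨1, -2 * ε * c.im⟩ := by
    apply Complex.ext <;> simp; ring
  rw [e, ← Real.sqrt_sq (norm_nonneg _), ← Complex.normSq_eq_norm_sq, Complex.normSq_mk]
  refine Real.sqrt_le_iff.2 ⟨by positivity, ?_⟩
  have : c.im ^ 2 ≤ 1 := by rwa [sq_le_one_iff_abs_le_one]
  nlinarith [sq_nonneg ε, sq_nonneg (ε ^ 2), mul_le_mul_of_nonneg_left this (sq_nonneg ε)]

/-- Testing against `φ̄ (1 + ε (c̄ - c))`, where `φ` is the phase of the component of degree `0` and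
`φ c` that of the component of degree `k > 0`. The term with `c` picks up nothing, as there are no
components of negative degree, and without it the test function would only be bounded by
`1 + O(ε)`. -/
lemma integral_norm_zero_add_le (hg : ∀ k : ℕ, HasWeight q k (g k)) {k : ℕ} (hk0 : k ≠ 0) (hk : k < K)
    (ε : ℝ) :
    ∫ χ, ‖g 0 χ‖ ∂haarTorus + ε * ∫ χ, ‖g k χ‖ ∂haarTorus ≤
      (1 + 2 * ε ^ 2) * ∫ χ, ‖(∑ j ∈ Finset.range K, g j) χ‖ ∂haarTorus := by
  set G := ∑ j ∈ Finset.range K, g j with hG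
  set φ := unitPhase (g 0) with hφ
  set ψ := phase (g k) with hψ
  have hφm : Measurable φ := measurable_unitPhase (g 0).continuous.measurable
  have hψm : Measurable ψ := measurable_phase (g k).continuous.measurable
  have hcm : Measurable (starRingEnd ℂ) := Complex.continuous_conj.measurable
  have hφw : HasWeight q 0 φ := HasWeight.unitPhase (by simpa using hg 0)
  have hψw : HasWeight q k ψ := (hg k).phase
  have hφ1 : ∀ χ, ‖φ χ‖ = 1 := norm_unitPhase _
  have hψ1 : ∀ χ, ‖ψ χ‖ ≤ 1 := norm_phase_le _
  have hφ2 : ∀ χ, φ χ * (starRingEnd ℂ) (φ χ) = 1 := fun χ => by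
    rw [Complex.mul_conj, Complex.normSq_eq_norm_sq, hφ1]; simp
  set h₁ : Torus → ℂ := fun χ => (starRingEnd ℂ) (φ χ) with hh₁
  set h₂ : Torus → ℂ := fun χ => (starRingEnd ℂ) (ψ χ) with hh₂
  set h₃ : Torus → ℂ := fun χ => (starRingEnd ℂ) (φ χ) * (starRingEnd ℂ) (φ χ) * ψ χ with hh₃
  have b₁ : ∀ χ, ‖h₁ χ‖ ≤ 1 := fun χ => by rw [hh₁, RCLike.norm_conj, hφ1]
  have b₂ : ∀ χ, ‖h₂ χ‖ ≤ 1 := fun χ => by rw [hh₂, RCLike.norm_conj]; exact hψ1 χ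
  have b₃ : ∀ χ, ‖h₃ χ‖ ≤ 1 := fun χ => by
    rw [hh₃, norm_mul, norm_mul, RCLike.norm_conj, hφ1]; simpa using hψ1 χ
  have m₁ : Measurable h₁ := hcm.comp hφm
  have m₂ : Measurable h₂ := hcm.comp hψm
  have m₃ : Measurable h₃ := (m₁.mul m₁).mul hψm
  have I₁ : ∫ χ, G χ * h₁ χ ∂haarTorus = ((∫ χ, ‖g 0 χ‖ ∂haarTorus : ℝ) : ℂ) := by
    rw [hG, integral_sum_mul_of_hasWeight hg m₁ b₁ hφw.conj]
    simp only [neg_zero, Nat.cast_eq_zero, Finset.sum_ite_eq', Finset.mem_range,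
      (Nat.zero_le k).trans_lt hk, if_true]
    rw [← integral_complex_ofReal]
    exact integral_congr_ae (.of_forall fun χ => mul_conj_unitPhase _ _)
  have I₂ : ∫ χ, G χ * h₂ χ ∂haarTorus = ((∫ χ, ‖g k χ‖ ∂haarTorus : ℝ) : ℂ) := by
    rw [hG, integral_sum_mul_of_hasWeight hg m₂ b₂ hψw.conj]
    simp only [neg_neg, Nat.cast_inj, Finset.sum_ite_eq', Finset.mem_range, hk, if_true]
    rw [← integral_complex_ofReal]
    exact integral_congr_ae (.of_forall fun χ => mul_conj_phase _ _)
  have I₃ : ∫ χ, G χ * h₃ χ ∂haarTorus = 0 := by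
    rw [hG, integral_sum_mul_of_hasWeight hg m₃ b₃ ((hφw.conj.mul hφw.conj).mul hψw)]
    refine Finset.sum_eq_zero fun j _ => if_neg ?_
    omega
  have i₁ := integrable_mul_of_norm_le G m₁ b₁
  have i₂ := integrable_mul_of_norm_le G m₂ b₂
  have i₃ := integrable_mul_of_norm_le G m₃ b₃
  have i₂₃ : Integrable (fun χ => G χ * h₂ χ - G χ * h₃ χ) haarTorus := i₂.sub i₃
  have i₄ : Integrable (fun χ => (ε : ℂ) * (G χ * h₂ χ - G χ * h₃ χ)) haarTorus :=
    i₂₃.const_mul _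
  have htot : ∫ χ, (G χ * h₁ χ + ε * (G χ * h₂ χ - G χ * h₃ χ)) ∂haarTorus =
      ((∫ χ, ‖g 0 χ‖ ∂haarTorus + ε * ∫ χ, ‖g k χ‖ ∂haarTorus : ℝ) : ℂ) := by
    rw [integral_add i₁ i₄, integral_const_mul, integral_sub i₂ i₃, I₁, I₂,
      I₃]
    push_cast; ring
  have hbound : ‖∫ χ, (G χ * h₁ χ + ε * (G χ * h₂ χ - G χ * h₃ χ)) ∂haarTorus‖ ≤
      ∫ χ, (1 + 2 * ε ^ 2) * ‖G χ‖ ∂haarTorus := by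
    refine norm_integral_le_of_norm_le
      ((integrable_of_continuous G.continuous).norm.const_mul _) (.of_forall fun χ => ?_)
    set c := (starRingEnd ℂ) (φ χ) * ψ χ with hc
    have hc1 : ‖c‖ ≤ 1 := by
      rw [hc, norm_mul, RCLike.norm_conj, hφ1, one_mul]; exact hψ1 χ
    have e : G χ * h₁ χ + ε * (G χ * h₂ χ - G χ * h₃ χ) =
        G χ * (starRingEnd ℂ) (φ χ) * (1 + ε * ((starRingEnd ℂ) c - c)) := by
      simp only [hh₁, hh₂, hh₃, hc, map_mul, Complex.conj_conj]
      linear_combination (-ε * G χ * (starRingEnd ℂ) (ψ χ)) * hφ2 χ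
    rw [e, norm_mul, norm_mul, RCLike.norm_conj, hφ1, mul_one, mul_comm]
    gcongr
    exact norm_one_add_mul_conj_sub_le hc1 ε
  rw [htot, Complex.norm_real, integral_const_mul] at hbound
  exact (le_abs_self _).trans hbound

/-- The optimal choice of `ε` in `integral_norm_zero_add_le`. -/
lemma integral_norm_component_sq_le (hg : ∀ k : ℕ, HasWeight q k (g k)) {k : ℕ} (hk0 : k ≠ 0)
    (hk : k < K) :
    (∫ χ, ‖g k χ‖ ∂haarTorus) ^ 2 ≤ 8 * (∫ χ, ‖(∑ j ∈ Finset.range K, g j) χ‖ ∂haarTorus) *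
      (∫ χ, ‖(∑ j ∈ Finset.range K, g j) χ‖ ∂haarTorus - ∫ χ, ‖g 0 χ‖ ∂haarTorus) := by
  set N := ∫ χ, ‖(∑ j ∈ Finset.range K, g j) χ‖ ∂haarTorus
  set A := ∫ χ, ‖g 0 χ‖ ∂haarTorus
  set B := ∫ χ, ‖g k χ‖ ∂haarTorus
  have h := discrim_le_zero (a := 2 * N) (b := -B) (c := N - A) fun ε => by
    have := integral_norm_zero_add_le hg hk0 hk ε
    linarith
  unfold discrim at h
  linarith

/-- The components of `G = ∑ gₖ` satisfy a weighted square sum estimate with constant `1`. With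
`N = ‖G‖₁` and `A = ‖g₀‖₁`, the components of positive degree contribute at most
`(∑_{k > 0} 9⁻ᵏ) 8 N (N - A) = N (N - A)`, and `A² + N (N - A) ≤ N²`. -/
lemma sum_pow_inv_nine_mul_sq_le (hg : ∀ k : ℕ, HasWeight q k (g k)) :
    ∑ k ∈ Finset.range K, (1 / 9 : ℝ) ^ k * (∫ χ, ‖g k χ‖ ∂haarTorus) ^ 2 ≤
      (∫ χ, ‖(∑ j ∈ Finset.range K, g j) χ‖ ∂haarTorus) ^ 2 := by
  cases K with
  | zero => simp
  | succ K =>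
    set N := ∫ χ, ‖(∑ j ∈ Finset.range (K + 1), g j) χ‖ ∂haarTorus with hN
    set A := ∫ χ, ‖g 0 χ‖ ∂haarTorus with hA
    have hA0 : 0 ≤ A := integral_nonneg fun χ => norm_nonneg _
    have hAN : A ≤ N := integral_norm_component_le hg (Nat.succ_pos K)
    have hgeom : ∑ k ∈ Finset.range K, (1 / 9 : ℝ) ^ (k + 1) ≤ 1 / 8 := by
      have h1 : ∑ k ∈ Finset.range K, (1 / 9 : ℝ) ^ k ≤ (1 - 1 / 9)⁻¹ := by
        rw [← tsum_geometric_of_lt_one (by norm_num) (by norm_num)]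
        exact (summable_geometric_of_lt_one (by norm_num) (by norm_num)).sum_le_tsum _
          fun k _ => by positivity
      simp only [pow_succ, ← Finset.sum_mul]
      linarith
    have hle : ∑ k ∈ Finset.range K, (1 / 9 : ℝ) ^ (k + 1) * (∫ χ, ‖g (k + 1) χ‖ ∂haarTorus) ^ 2 ≤
        ∑ k ∈ Finset.range K, (1 / 9 : ℝ) ^ (k + 1) * (8 * N * (N - A)) :=
      Finset.sum_le_sum fun k hk => mul_le_mul_of_nonneg_left
        (integral_norm_component_sq_le hg k.succ_ne_zero (by simpa using hk)) (by positivity)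
    rw [← Finset.sum_mul] at hle
    have hNA : 0 ≤ 8 * N * (N - A) := mul_nonneg (by linarith) (by linarith)
    rw [Finset.sum_range_succ', pow_zero, one_mul]
    have := mul_le_mul_of_nonneg_right hgeom hNA
    nlinarith

/-- The square sum estimate that follows from the trivial bound for the components. The ratio `x` may be
close to `1`, at the cost of the factor `1 - x`. -/
lemma sum_pow_mul_sq_le (hg : ∀ k : ℕ, HasWeight q k (g k)) {x : ℝ} (hx0 : 0 ≤ x) (hx1 : x < 1) :
    ∑ k ∈ Finset.range K, (1 - x) * x ^ k * (∫ χ, ‖g k χ‖ ∂haarTorus) ^ 2 ≤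
      (∫ χ, ‖(∑ j ∈ Finset.range K, g j) χ‖ ∂haarTorus) ^ 2 := by
  set N := ∫ χ, ‖(∑ j ∈ Finset.range K, g j) χ‖ ∂haarTorus with hN
  have h1 : ∑ k ∈ Finset.range K, x ^ k ≤ (1 - x)⁻¹ := by
    rw [← tsum_geometric_of_lt_one hx0 hx1]
    exact (summable_geometric_of_lt_one hx0 hx1).sum_le_tsum _ fun k _ => by positivity
  have hx : 0 < 1 - x := by linarith
  calc _ ≤ ∑ k ∈ Finset.range K, (1 - x) * x ^ k * N ^ 2 := by
        refine Finset.sum_le_sum fun k hk => mul_le_mul_of_nonneg_left ?_ (by positivity)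
        exact pow_le_pow_left₀ (integral_nonneg fun χ => norm_nonneg _)
          (integral_norm_component_le hg (Finset.mem_range.1 hk)) 2
    _ = (1 - x) * (∑ k ∈ Finset.range K, x ^ k) * N ^ 2 := by
        rw [Finset.mul_sum, Finset.sum_mul]
    _ ≤ (1 - x) * (1 - x)⁻¹ * N ^ 2 := by gcongr
    _ = N ^ 2 := by rw [mul_inv_cancel₀ hx.ne', one_mul]

end Coordinate

end Weight

/-! ### Weighted square sums of the coefficients of a polynomial -/

lemma charValue_mulSingle (q : Nat.Primes) (z : Circle) (n : ℕ) :
    charValue (Pi.mulSingle q z) (n : ℚ) = z ^ padicValNat q n := by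
  unfold charValue
  rw [finprod_eq_single _ q fun p hp => by rw [Pi.mulSingle_eq_of_ne hp, one_zpow],
    Pi.mulSingle_eq_same, padicValRat.of_nat, zpow_natCast]

/-- The part of the Dirichlet polynomial `P` with frequencies `n` divisible by `q` exactly `k`
times. -/
def primePart (P : ℕ+ →₀ ℂ) (q k : ℕ) : ℕ+ →₀ ℂ := P.filter fun n => padicValNat q n = k

lemma hasWeight_primePart (P : ℕ+ →₀ ℂ) (q : Nat.Primes) (k : ℕ) :
    HasWeight q k (torusPoly (primePart P q k)) := fun χ z => by
  rw [torusPoly_apply, torusPoly_apply, Finset.mul_sum]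
  refine Finset.sum_congr rfl fun n hn => ?_
  have hk : padicValNat q n = k := by
    simp only [primePart, Finsupp.support_filter, Finset.mem_filter] at hn
    exact hn.2
  rw [charValue_mul_torus, charValue_mulSingle, hk, Circle.coe_mul, Circle.coe_pow, zpow_natCast]
  ring

lemma sum_torusPoly_primePart {P : ℕ+ →₀ ℂ} {q K : ℕ}
    (hK : ∀ n ∈ P.support, padicValNat q n < K) :
    ∑ k ∈ Finset.range K, torusPoly (primePart P q k) = torusPoly P := by
  rw [← map_sum]
  congr 1
  ext n
  rw [Finsupp.finsetSum_apply]
  simp only [primePart, Finsupp.filter_apply]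
  by_cases hn : n ∈ P.support
  · simp [hK n hn]
  · simp [Finsupp.notMem_support_iff.1 hn]

/-- The ratio of the geometric weights attached to the powers of `p`. Summability of the dual weights in
`Re s > 1/2` requires a ratio of at least about `1 / p`, so that `1 / 9` is too small for the primes up
to `7`. -/
def weightRatio (x : ℝ) (p : ℕ) : ℝ := if p ≤ 7 then x else 1 / 9

/-- The first of the geometric weights attached to the powers of `p`. It is `1` for all but finitely many
primes, so that the product over all primes does not vanish. -/
def weightConst (x : ℝ) (p : ℕ) : ℝ := if p ≤ 7 then 1 - x else 1

section Weights

variable {x : ℝ}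

lemma weightRatio_pos (hx0 : 0 < x) (p : ℕ) : 0 < weightRatio x p := by
  unfold weightRatio; split_ifs <;> [exact hx0; norm_num]

lemma weightConst_pos (hx1 : x < 1) (p : ℕ) : 0 < weightConst x p := by
  unfold weightConst; split_ifs <;> [linarith; norm_num]

lemma sum_weight_primePart_le (hx0 : 0 < x) (hx1 : x < 1) {P : ℕ+ →₀ ℂ} {q K : ℕ} (hq : q.Prime)
    (hK : ∀ n ∈ P.support, padicValNat q n < K) :
    ∑ k ∈ Finset.range K, weightConst x q * weightRatio x q ^ k *
      (∫ χ, ‖torusPoly (primePart P q k) χ‖ ∂haarTorus) ^ 2 ≤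
      (∫ χ, ‖torusPoly P χ‖ ∂haarTorus) ^ 2 := by
  rw [← sum_torusPoly_primePart hK]
  unfold weightConst weightRatio
  split_ifs
  · exact sum_pow_mul_sq_le (fun k => hasWeight_primePart P ⟨q, hq⟩ k) hx0.le hx1
  · simp only [one_mul]
    exact sum_pow_inv_nine_mul_sq_le (fun k => hasWeight_primePart P ⟨q, hq⟩ k)

lemma norm_fourierCoeffTorus_le (F : Torus → ℂ) (q : ℚ) :
    ‖fourierCoeffTorus F q‖ ≤ ∫ χ, ‖F χ‖ ∂haarTorus := by
  refine (norm_integral_le_integral_norm _).trans (le_of_eq ?_)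
  simp only [norm_mul, RCLike.norm_conj, norm_charValue, mul_one]

/-- The weighted square sum of the coefficients of a polynomial is bounded by its norm in `L^1`. The
induction peels off one prime at a time. -/
lemma sum_prod_weight_mul_sq_le (hx0 : 0 < x) (hx1 : x < 1) (S : Finset ℕ)
    (hS : ∀ p ∈ S, p.Prime) (P : ℕ+ →₀ ℂ)
    (hP : ∀ m ∈ P.support, ∀ n ∈ P.support, ∀ p : ℕ, p.Prime → p ∉ S →
      padicValNat p m = padicValNat p n) :
    ∑ n ∈ P.support, (∏ p ∈ S, weightConst x p * weightRatio x p ^ padicValNat p n) * ‖P n‖ ^ 2 ≤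
      (∫ χ, ‖torusPoly P χ‖ ∂haarTorus) ^ 2 := by
  induction S using Finset.induction_on generalizing P with
  | empty =>
    simp only [Finset.prod_empty, one_mul]
    rcases P.support.eq_empty_or_nonempty with h | ⟨n, hn⟩
    · rw [h, Finset.sum_empty]; positivity
    · have hsupp : P.support = {n} := by
        refine Finset.eq_singleton_iff_unique_mem.2 ⟨hn, fun m hm => PNat.coe_injective ?_⟩
        refine Nat.eq_of_factorization_eq m.ne_zero n.ne_zero fun p => ?_
        by_cases hp : p.Prime
        · rw [Nat.factorization_def _ hp, Nat.factorization_def _ hp]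
          exact hP m hm n hn p hp (Finset.notMem_empty p)
        · rw [Nat.factorization_eq_zero_of_not_prime _ hp,
            Nat.factorization_eq_zero_of_not_prime _ hp]
      rw [hsupp, Finset.sum_singleton, ← fourierCoeffTorus_torusPoly_natCast P n]
      exact pow_le_pow_left₀ (norm_nonneg _) (norm_fourierCoeffTorus_le _ _) 2
  | insert q S hqS ih =>
    have hq : q.Prime := hS q (Finset.mem_insert_self q S)
    obtain ⟨K, hK⟩ : ∃ K, ∀ n ∈ P.support, padicValNat q n < K :=
      ⟨P.support.sup (fun n => padicValNat q n) + 1, fun n hn =>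
        Nat.lt_succ_of_le (Finset.le_sup (f := fun n : ℕ+ => padicValNat q n) hn)⟩
    refine le_trans (b := ∑ k ∈ Finset.range K, weightConst x q * weightRatio x q ^ k *
        ∑ n ∈ (primePart P q k).support,
          (∏ p ∈ S, weightConst x p * weightRatio x p ^ padicValNat p n) * ‖primePart P q k n‖ ^ 2)
      (le_of_eq ?_) ((Finset.sum_le_sum fun k _ => ?_).trans
      (sum_weight_primePart_le hx0 hx1 hq hK))
    · rw [← Finset.sum_fiberwise_of_maps_to (t := Finset.range K)
        (g := fun n : ℕ+ => padicValNat q n) fun n hn => Finset.mem_range.2 (hK n hn)]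
      refine Finset.sum_congr rfl fun k _ => ?_
      rw [Finset.mul_sum, primePart, Finsupp.support_filter]
      refine Finset.sum_congr rfl fun n hn => ?_
      have hk := (Finset.mem_filter.1 hn).2
      rw [Finset.prod_insert hqS, Finsupp.filter_apply, if_pos hk, hk]
      ring
    · have := weightRatio_pos hx0 q
      have := weightConst_pos hx1 q
      refine mul_le_mul_of_nonneg_left (ih (fun p hp => hS p (Finset.mem_insert_of_mem hp)) _ ?_)
        (by positivity)
      intro m hm n hn p hp hpS
      simp only [primePart, Finsupp.support_filter, Finset.mem_filter] at hm hn
      by_cases hpq : p = q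
      · rw [hpq, hm.2, hn.2]
      · exact hP m hm.1 n hn.1 p hp (by simp [hpq, hpS])

lemma pow_le_prod_weightConst (hx0 : 0 < x) (hx1 : x < 1) (S : Finset ℕ) :
    (1 - x) ^ 8 ≤ ∏ p ∈ S, weightConst x p := by
  unfold weightConst
  rw [Finset.prod_ite, Finset.prod_const, Finset.prod_const_one, mul_one]
  refine pow_le_pow_of_le_one (by linarith) (by linarith) ?_
  calc _ ≤ (Finset.range 8).card := Finset.card_le_card fun p hp => by
        have := (Finset.mem_filter.1 hp).2
        exact Finset.mem_range.2 (by omega)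
    _ = 8 := by simp

end Weights

/-! ### Completely multiplicative functions -/

/-- The completely multiplicative function with given values at the primes; its value at `0` is `0`. -/
def multExtension (z : ℕ → ℝ) : ℕ →* ℝ where
  toFun n := if n = 0 then 0 else n.factorization.prod fun p k => z p ^ k
  map_one' := by simp
  map_mul' m n := by
    rcases eq_or_ne m 0 with rfl | hm
    · simp
    rcases eq_or_ne n 0 with rfl | hn
    · simp
    rw [if_neg (mul_ne_zero hm hn), if_neg hm, if_neg hn, Nat.factorization_mul hm hn,
      Finsupp.prod_add_index' (fun _ => pow_zero _) fun _ _ _ => pow_add _ _ _]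

lemma multExtension_prime (z : ℕ → ℝ) {p : ℕ} (hp : p.Prime) : multExtension z p = z p := by
  simp [multExtension, hp.ne_zero, hp.factorization]

lemma multExtension_eq_prod (z : ℕ → ℝ) {n : ℕ} (hn : n ≠ 0) {S : Finset ℕ}
    (hS : ∀ p ∈ S, p.Prime) (hnS : n.primeFactors ⊆ S) :
    multExtension z n = ∏ p ∈ S, z p ^ padicValNat p n := by
  change (if n = 0 then 0 else n.factorization.prod fun p k => z p ^ k) = _
  rw [if_neg hn, Finsupp.prod_of_support_subset (s := S) _ hnS _ fun p _ => pow_zero _]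
  exact Finset.prod_congr rfl fun p hp => by rw [Nat.factorization_def _ (hS p hp)]

lemma multExtension_nonneg {z : ℕ → ℝ} (hz : ∀ p, 0 ≤ z p) (n : ℕ) : 0 ≤ multExtension z n := by
  change 0 ≤ (if n = 0 then 0 else n.factorization.prod fun p k => z p ^ k)
  split_ifs
  · exact le_rfl
  · exact Finset.prod_nonneg fun p _ => pow_nonneg (hz p) _

/-- A completely multiplicative function is summable if it is summable over the primes, with values
bounded away from `1`; this follows from the partial Euler products. -/
lemma summable_multExtension {z : ℕ → ℝ} (hz0 : ∀ p, 0 ≤ z p) {θ : ℝ} (hθ : θ < 1)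
    (hzθ : ∀ p : ℕ, p.Prime → z p ≤ θ) (hz : Summable z) : Summable fun n => multExtension z n := by
  have hlt : ∀ {p : ℕ}, p.Prime → ‖multExtension z p‖ < 1 := fun {p} hp => by
    rw [multExtension_prime z hp, Real.norm_of_nonneg (hz0 p)]
    exact (hzθ p hp).trans_lt hθ
  have hfac : ∀ p : ℕ, p.Prime → (1 - multExtension z p)⁻¹ ≤ Real.exp ((1 - θ)⁻¹ * z p) := by
    intro p hp
    rw [multExtension_prime z hp]
    have h1 : 0 < 1 - z p := by linarith [hzθ p hp]
    have h2 : (1 - z p)⁻¹ ≤ (1 - θ)⁻¹ := inv_anti₀ (by linarith) (by linarith [hzθ p hp])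
    calc (1 - z p)⁻¹ = (1 - z p)⁻¹ * z p + 1 := by field_simp; ring
      _ ≤ (1 - θ)⁻¹ * z p + 1 := by
          have := mul_le_mul_of_nonneg_right h2 (hz0 p); linarith
      _ ≤ _ := Real.add_one_le_exp _
  refine summable_of_sum_range_le (c := Real.exp ((1 - θ)⁻¹ * ∑' p, z p))
    (multExtension_nonneg hz0) fun N => ?_
  obtain ⟨h1, h2⟩ := EulerProduct.summable_and_hasSum_smoothNumbers_prod_primesBelow_geometric hlt N
  have h3 : ∑ n ∈ Finset.range N, multExtension z n ≤ ∏ p ∈ N.primesBelow,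
      (1 - multExtension z p)⁻¹ := by
    have hind := (hasSum_subtype_iff_indicator (f := fun n => multExtension z n)).1 h2
    refine le_trans (Finset.sum_le_sum fun n hn => ?_)
      (sum_le_hasSum (Finset.range N) (fun n _ => ?_) hind)
    · rcases eq_or_ne n 0 with rfl | hn0
      · have h0 : multExtension z 0 = 0 := by simp [multExtension]
        rw [h0]
        exact indicator_nonneg (fun n _ => multExtension_nonneg hz0 n) _
      · rw [indicator_of_mem (Nat.mem_smoothNumbers_of_lt (Nat.pos_of_ne_zero hn0)
          (Finset.mem_range.1 hn))]
    · exact indicator_nonneg (fun n _ => multExtension_nonneg hz0 n) _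
  refine h3.trans ?_
  calc ∏ p ∈ N.primesBelow, (1 - multExtension z p)⁻¹
      ≤ ∏ p ∈ N.primesBelow, Real.exp ((1 - θ)⁻¹ * z p) := by
        refine Finset.prod_le_prod (fun p hp => ?_) fun p hp =>
          hfac p (Nat.prime_of_mem_primesBelow hp)
        have hp' := Nat.prime_of_mem_primesBelow hp
        rw [multExtension_prime z hp']
        exact inv_nonneg.2 (by linarith [hzθ p hp'])
    _ = Real.exp ((1 - θ)⁻¹ * ∑ p ∈ N.primesBelow, z p) := by
        rw [← Real.exp_sum, Finset.mul_sum]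
    _ ≤ _ := by
        have : 0 ≤ (1 - θ)⁻¹ := inv_nonneg.2 (by linarith)
        gcongr
        exact hz.sum_le_tsum _ fun p _ => hz0 p

/-! ### Absolute convergence in `Re s > 1/2` -/

/-- The values at the primes of the multiplicative function `n^{-2σ} / w(n)`, where `w` is the
weight for which the coefficients are square summable. -/
def dualWeight (x σ : ℝ) (p : ℕ) : ℝ := (weightRatio x p)⁻¹ * (p : ℝ) ^ (-(2 * σ))

lemma prod_weightRatio_mul_multExtension {x : ℝ} (hx0 : 0 < x) (σ : ℝ) {n : ℕ} (hn : n ≠ 0)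
    {S : Finset ℕ} (hS : ∀ p ∈ S, p.Prime) (hnS : n.primeFactors ⊆ S) :
    (∏ p ∈ S, weightRatio x p ^ padicValNat p n) * multExtension (dualWeight x σ) n =
      (n : ℝ) ^ (-(2 * σ)) := by
  have hprod : n = ∏ p ∈ S, p ^ padicValNat p n := by
    conv_lhs => rw [← Nat.prod_factorization_pow_eq_self hn]
    rw [Finsupp.prod_of_support_subset (s := S) _ hnS _ fun p _ => pow_zero _]
    exact Finset.prod_congr rfl fun p hp => by rw [Nat.factorization_def _ (hS p hp)]
  rw [multExtension_eq_prod _ hn hS hnS, ← Finset.prod_mul_distrib]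
  conv_rhs => rw [hprod]
  rw [Nat.cast_prod, ← Real.finsetProd_rpow _ _ fun p _ => by positivity]
  refine Finset.prod_congr rfl fun p _ => ?_
  have := weightRatio_pos hx0 p
  rw [dualWeight, ← mul_pow, mul_inv_cancel_left₀ this.ne', Nat.cast_pow, ← Real.rpow_natCast,
    ← Real.rpow_natCast, ← Real.rpow_mul (by positivity), ← Real.rpow_mul (by positivity), mul_comm]

lemma summable_multExtension_dualWeight {σ : ℝ} (hσ : 1 / 2 < σ) :
    Summable fun n => multExtension (dualWeight (2 ^ (1 - 2 * σ)) σ) n := by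
  -- With this ratio the dual weight of the prime `2` is `1 / 2`.
  set x : ℝ := 2 ^ (1 - 2 * σ) with hx
  have hx0 : 0 < x := by positivity
  have hz0 : ∀ p, 0 ≤ dualWeight x σ p := fun p => by
    have := weightRatio_pos hx0 p
    unfold dualWeight; positivity
  refine summable_multExtension hz0 (θ := 9 / 11) (by norm_num) (fun p hp => ?_) ?_
  · unfold dualWeight weightRatio
    split_ifs with h
    · have h1 : (p : ℝ) ^ (-(2 * σ)) ≤ 2 ^ (-(2 * σ)) :=
        Real.rpow_le_rpow_of_nonpos (by norm_num) (by exact_mod_cast hp.two_le) (by linarith)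
      calc x⁻¹ * (p : ℝ) ^ (-(2 * σ)) ≤ x⁻¹ * 2 ^ (-(2 * σ)) := by gcongr
        _ = 2 ^ (-1 : ℝ) := by
            rw [hx, ← Real.rpow_neg (by norm_num), ← Real.rpow_add (by norm_num)]
            congr 1; ring
        _ ≤ 9 / 11 := by rw [Real.rpow_neg_one]; norm_num
    · have hp11 : 11 ≤ p := by
        by_contra hlt
        have h8 : 8 ≤ p := by omega
        have h10 : p ≤ 10 := by omega
        interval_cases p <;> revert hp <;> decide
      have hp1 : (1 : ℝ) ≤ p := by exact_mod_cast hp.one_lt.le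
      have h1 : (p : ℝ) ^ (-(2 * σ)) ≤ (p : ℝ) ^ (-1 : ℝ) :=
        Real.rpow_le_rpow_of_exponent_le hp1 (by linarith)
      have h2 : (p : ℝ) ^ (-1 : ℝ) ≤ 1 / 11 := by
        rw [Real.rpow_neg_one, ← one_div]
        exact one_div_le_one_div_of_le (by norm_num) (by exact_mod_cast hp11)
      norm_num
      linarith
  · have hs : Summable fun p : ℕ => (x⁻¹ + 9) * (p : ℝ) ^ (-(2 * σ)) :=
      (Real.summable_nat_rpow.2 (by linarith)).mul_left _
    refine hs.of_nonneg_of_le hz0 fun p => ?_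
    unfold dualWeight weightRatio
    have : 0 ≤ (p : ℝ) ^ (-(2 * σ)) := by positivity
    have : 0 ≤ x⁻¹ := by positivity
    gcongr
    split_ifs
    · linarith
    · norm_num; linarith

/-- For `σ > 1/2` the sum `∑ |aₙ| n^{-σ}` over the coefficients of a polynomial is bounded by a multiple
of its norm in `L^1`, by the weighted square sum estimate and the Cauchy–Schwarz inequality. -/
theorem exists_sum_norm_mul_rpow_le {σ : ℝ} (hσ : 1 / 2 < σ) :
    ∃ D : ℝ, 0 ≤ D ∧ ∀ P : ℕ+ →₀ ℂ, ∑ n ∈ P.support, ‖P n‖ * ((n : ℕ) : ℝ) ^ (-σ) ≤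
      D * ∫ χ, ‖torusPoly P χ‖ ∂haarTorus := by
  set x : ℝ := 2 ^ (1 - 2 * σ) with hx
  have hx0 : 0 < x := by positivity
  have hx1 : x < 1 := Real.rpow_lt_one_of_one_lt_of_neg (by norm_num) (by linarith)
  have hz0 : ∀ p, 0 ≤ dualWeight x σ p := fun p => by
    have := weightRatio_pos hx0 p
    unfold dualWeight; positivity
  have hsum : Summable fun n => multExtension (dualWeight x σ) n :=
    summable_multExtension_dualWeight hσ
  have hc : 0 < (1 - x) ^ 8 := pow_pos (by linarith) 8
  set B : ℝ := ((1 - x) ^ 8)⁻¹ * ∑' n, multExtension (dualWeight x σ) n with hB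
  have hB0 : 0 ≤ B := mul_nonneg (by positivity) (tsum_nonneg (multExtension_nonneg hz0))
  refine ⟨√B, Real.sqrt_nonneg _, fun P => ?_⟩
  set S : Finset ℕ := P.support.biUnion fun n => (n : ℕ).primeFactors with hS
  have hSp : ∀ p ∈ S, p.Prime := fun p hp => by
    obtain ⟨n, _, hn⟩ := Finset.mem_biUnion.1 hp
    exact Nat.prime_of_mem_primeFactors hn
  have hsub : ∀ n ∈ P.support, (n : ℕ).primeFactors ⊆ S := fun n hn =>
    Finset.subset_biUnion_of_mem (fun n : ℕ+ => (n : ℕ).primeFactors) hn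
  have hval : ∀ n ∈ P.support, ∀ p : ℕ, p.Prime → p ∉ S → padicValNat p n = 0 :=
    fun n hn p hp hpS => padicValNat.eq_zero_of_not_dvd fun hd =>
      hpS (hsub n hn (Nat.mem_primeFactors.2 ⟨hp, hd, n.ne_zero⟩))
  have h1 := sum_prod_weight_mul_sq_le hx0 hx1 S hSp P fun m hm n hn p hp hpS => by
    rw [hval m hm p hp hpS, hval n hn p hp hpS]
  set W : ℕ+ → ℝ := fun n => ∏ p ∈ S, weightConst x p * weightRatio x p ^ padicValNat p n with hW
  have hWpos : ∀ n, 0 < W n := fun n => Finset.prod_pos fun p _ =>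
    mul_pos (weightConst_pos hx1 p) (pow_pos (weightRatio_pos hx0 p) _)
  have hCS := Finset.sum_sq_le_sum_mul_sum_of_sq_le_mul P.support
    (f := fun n => W n * ‖P n‖ ^ 2) (g := fun n => (W n)⁻¹ * ((n : ℕ) : ℝ) ^ (-(2 * σ)))
    (r := fun n => ‖P n‖ * ((n : ℕ) : ℝ) ^ (-σ))
    (fun n _ => mul_nonneg (hWpos n).le (by positivity))
    (fun n _ => mul_nonneg (inv_pos.2 (hWpos n)).le (by positivity)) (fun n _ => le_of_eq <| by
      have h2 : ((n : ℕ) : ℝ) ^ (-(2 * σ)) = (((n : ℕ) : ℝ) ^ (-σ)) ^ 2 := by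
        rw [← Real.rpow_natCast, ← Real.rpow_mul (by positivity)]
        congr 1; push_cast; ring
      have := (hWpos n).ne'
      rw [h2]; field_simp)
  have h2 : ∑ n ∈ P.support, (W n)⁻¹ * ((n : ℕ) : ℝ) ^ (-(2 * σ)) ≤ B := by
    have hle : ∀ n ∈ P.support, (W n)⁻¹ * ((n : ℕ) : ℝ) ^ (-(2 * σ)) ≤
        ((1 - x) ^ 8)⁻¹ * multExtension (dualWeight x σ) n := fun n hn => by
      have hC := pow_le_prod_weightConst hx0 hx1 S
      have hR : 0 < ∏ p ∈ S, weightRatio x p ^ padicValNat p n :=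
        Finset.prod_pos fun p _ => pow_pos (weightRatio_pos hx0 p) _
      rw [← prod_weightRatio_mul_multExtension hx0 σ n.ne_zero hSp (hsub n hn), hW]
      simp only [Finset.prod_mul_distrib]
      rw [mul_inv, mul_assoc, inv_mul_cancel_left₀ hR.ne']
      exact mul_le_mul_of_nonneg_right (inv_anti₀ hc hC) (multExtension_nonneg hz0 _)
    refine (Finset.sum_le_sum hle).trans ?_
    rw [← Finset.mul_sum, hB]
    gcongr
    have := hsum.sum_le_tsum (P.support.map ⟨((↑) : ℕ+ → ℕ), PNat.coe_injective⟩)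
      fun n _ => multExtension_nonneg hz0 n
    rwa [Finset.sum_map] at this
  have hN0 : 0 ≤ ∫ χ, ‖torusPoly P χ‖ ∂haarTorus := integral_nonneg fun χ => norm_nonneg _
  refine le_of_sq_le_sq ?_ (by positivity)
  rw [mul_pow, Real.sq_sqrt hB0, mul_comm]
  refine hCS.trans (mul_le_mul h1 h2 ?_ (by positivity))
  exact Finset.sum_nonneg fun n _ => mul_nonneg (inv_pos.2 (hWpos n)).le (by positivity)

/-! ### Absolute convergence of Dirichlet series in the Hardy space -/

lemma sum_norm_mul_rpow_le_of_tendsto {σ D : ℝ} (hD0 : 0 ≤ D)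
    (hD : ∀ P : ℕ+ →₀ ℂ, ∑ n ∈ P.support, ‖P n‖ * ((n : ℕ) : ℝ) ^ (-σ) ≤
      D * ∫ χ, ‖torusPoly P χ‖ ∂haarTorus) {Q : ℕ → ℕ+ →₀ ℂ} {b : ℕ+ → ℂ} {H : Torus → ℂ}
    (hH : Integrable H haarTorus) (hb : ∀ n, Tendsto (fun k => Q k n) atTop (𝓝 (b n)))
    (hQ : Tendsto (fun k => ∫ χ, ‖torusPoly (Q k) χ - H χ‖ ∂haarTorus) atTop (𝓝 0))
    (s : Finset ℕ+) :
    ∑ n ∈ s, ‖b n‖ * ((n : ℕ) : ℝ) ^ (-σ) ≤ D * ∫ χ, ‖H χ‖ ∂haarTorus := by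
  have h1 : Tendsto (fun k => ∑ n ∈ s, ‖Q k n‖ * ((n : ℕ) : ℝ) ^ (-σ)) atTop
      (𝓝 (∑ n ∈ s, ‖b n‖ * ((n : ℕ) : ℝ) ^ (-σ))) :=
    tendsto_finsetSum _ fun n _ => (hb n).norm.mul_const _
  have h2 : Tendsto (fun k => D * ((∫ χ, ‖torusPoly (Q k) χ - H χ‖ ∂haarTorus) +
      ∫ χ, ‖H χ‖ ∂haarTorus)) atTop (𝓝 (D * ∫ χ, ‖H χ‖ ∂haarTorus)) := by
    simpa using (hQ.add_const (∫ χ, ‖H χ‖ ∂haarTorus)).const_mul D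
  refine le_of_tendsto_of_tendsto' h1 h2 fun k => ?_
  have hQi := integrable_of_continuous (torusPoly (Q k)).continuous
  calc ∑ n ∈ s, ‖Q k n‖ * ((n : ℕ) : ℝ) ^ (-σ)
      ≤ ∑ n ∈ s ∪ (Q k).support, ‖Q k n‖ * ((n : ℕ) : ℝ) ^ (-σ) :=
        Finset.sum_le_sum_of_subset_of_nonneg Finset.subset_union_left fun n _ _ => by positivity
    _ = ∑ n ∈ (Q k).support, ‖Q k n‖ * ((n : ℕ) : ℝ) ^ (-σ) :=
        (Finset.sum_subset Finset.subset_union_right fun n _ hn => by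
          rw [Finsupp.notMem_support_iff.1 hn, norm_zero, zero_mul]).symm
    _ ≤ D * ∫ χ, ‖torusPoly (Q k) χ‖ ∂haarTorus := hD _
    _ ≤ _ := by
        gcongr
        have hi : Integrable (fun χ => ‖torusPoly (Q k) χ - H χ‖) haarTorus := (hQi.sub hH).norm
        rw [← integral_add hi hH.norm]
        refine integral_mono hQi.norm (hi.add hH.norm) fun χ => ?_
        simpa using norm_add_le (torusPoly (Q k) χ - H χ) (H χ)

/-- For a function in `𝓗^1` the series defining the vertical limit functions converge absolutely in
`Re s > 1/2`, and there they are the limits of the approximating twisted Dirichlet polynomials. -/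
lemma summable_and_tendsto_twistedPoly {Q : ℕ → ℕ+ →₀ ℂ} {a : ℕ+ → ℂ} {F : Torus → ℂ}
    (hF : Integrable F haarTorus) (ha : ∀ n, Tendsto (fun k => Q k n) atTop (𝓝 (a n)))
    (hQ : Tendsto (fun k => ∫ χ, ‖torusPoly (Q k) χ - F χ‖ ∂haarTorus) atTop (𝓝 0)) (χ : Torus)
    {s : ℂ} (hs : s ∈ halfPlane (1 / 2)) :
    Summable (fun n => ‖verticalTerm a χ s n‖) ∧
      Tendsto (fun k => twistedPoly (Q k) χ s) atTop (𝓝 (∑' n, verticalTerm a χ s n)) := by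
  obtain ⟨D, hD0, hD⟩ := exists_sum_norm_mul_rpow_le (σ := s.re) hs
  have hsum : Summable fun n => ‖verticalTerm a χ s n‖ := by
    simp only [norm_verticalTerm]
    exact summable_of_sum_le (fun n => by positivity)
      (sum_norm_mul_rpow_le_of_tendsto hD0 hD hF ha hQ)
  refine ⟨hsum, ?_⟩
  rw [tendsto_iff_norm_sub_tendsto_zero]
  refine squeeze_zero (fun _ => norm_nonneg _) (fun k => ?_) (by simpa using hQ.const_mul D)
  have hQi := integrable_of_continuous (torusPoly (Q k)).continuous
  have hle := sum_norm_mul_rpow_le_of_tendsto hD0 hD (Q := fun j => Q k - Q j)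
    (b := fun n => Q k n - a n) (hQi.sub hF) (fun n => by simpa using (ha n).const_sub (Q k n)) (by
      refine hQ.congr fun j => integral_congr_ae (.of_forall fun ψ => ?_)
      simp only [map_sub, ContinuousMap.sub_apply, Pi.sub_apply]
      rw [← norm_neg]
      congr 1; ring)
  have hfin : ∀ n ∉ (Q k).support, verticalTerm (Q k) χ s n = 0 := fun n hn => by
    simp [verticalTerm, Finsupp.notMem_support_iff.1 hn]
  have hQsum : Summable fun n => verticalTerm (Q k) χ s n :=
    summable_of_ne_finset_zero hfin
  have hdiff : ∀ n, verticalTerm (Q k) χ s n - verticalTerm a χ s n =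
      verticalTerm (fun n => Q k n - a n) χ s n := fun n => by
    unfold verticalTerm; ring
  have hsumd : Summable fun n => ‖verticalTerm (fun n => Q k n - a n) χ s n‖ := by
    simp only [norm_verticalTerm]
    exact summable_of_sum_le (fun n => by positivity) hle
  have e : twistedPoly (Q k) χ s = ∑' n, verticalTerm (Q k) χ s n :=
    (tsum_eq_sum hfin).symm
  rw [e, ← hQsum.tsum_sub hsum.of_norm]
  simp only [hdiff]
  refine (norm_tsum_le_tsum_norm hsumd).trans ?_
  simp only [norm_verticalTerm] at hsumd ⊢
  exact hsumd.tsum_le_of_sum_le hle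

/-! ### The Poisson integral as a limit of Dirichlet polynomials -/

/-- A Dirichlet series in `𝓗^p` is approximated by Dirichlet polynomials so fast that, on almost
every orbit of the flow, the boundary values converge in the weighted space with weight
`(1 + τ²)⁻¹`. -/
lemma exists_ae_tendsto_orbit {p : ℝ} (hp : 1 ≤ p) {a : ℕ+ → ℂ} (ha : MemHp p a) {F : Torus → ℂ}
    (hF : IsBohrLift p a F) :
    ∃ Q : ℕ → ℕ+ →₀ ℂ, (∀ n, Tendsto (fun k => Q k n) atTop (𝓝 (a n))) ∧
      Tendsto (fun k => ∫ χ, ‖torusPoly (Q k) χ - F χ‖ ∂haarTorus) atTop (𝓝 0) ∧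
      ∀ᵐ χ ∂haarTorus, AEStronglyMeasurable (orbit F χ) ∧
        Tendsto (fun k => ∫⁻ τ, ‖orbit (torusPoly (Q k)) χ τ - orbit F χ τ‖ₑ *
          ENNReal.ofReal (1 + τ ^ 2)⁻¹) atTop (𝓝 0) := by
  obtain ⟨P, hP⟩ := ha
  have hp1 : 1 ≤ ENNReal.ofReal p := by simpa using ENNReal.ofReal_le_ofReal hp
  have hFi : Integrable F haarTorus := hF.1.1.integrable hp1
  have hlim := tendsto_eLpNorm_torusPoly_sub hp hP hF
  have hlim1 : Tendsto (fun k => eLpNorm (⇑(torusPoly (P k)) - F) 1 haarTorus) atTop (𝓝 0) :=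
    tendsto_of_tendsto_of_tendsto_of_le_of_le tendsto_const_nhds hlim (fun _ => zero_le)
      fun k => eLpNorm_le_eLpNorm_of_exponent_le hp1
        ((torusPoly (P k)).continuous.aestronglyMeasurable.sub hF.1.1.1)
  obtain ⟨φ, hφ, hφle⟩ := extraction_forall_of_eventually'
    (P := fun j k => eLpNorm (⇑(torusPoly (P k)) - F) 1 haarTorus ≤ ENNReal.ofReal ((1 / 2) ^ j))
    fun j => by
      obtain ⟨N, hN⟩ := eventually_atTop.1 ((hlim1.eventually_le_const
        (show 0 < ENNReal.ofReal ((1 / 2) ^ j) by simp)))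
      exact ⟨N, hN⟩
  refine ⟨fun j => P (φ j), fun n => (hP.2 n).comp hφ.tendsto_atTop, ?_, ?_⟩
  · have := (ENNReal.tendsto_toReal ENNReal.zero_ne_top).comp (hlim1.comp hφ.tendsto_atTop)
    refine this.congr fun j => ?_
    have hi : Integrable (⇑(torusPoly (P (φ j))) - F) haarTorus :=
      (integrable_of_continuous (torusPoly (P (φ j))).continuous).sub hFi
    rw [Function.comp_apply, Function.comp_apply, eLpNorm_one_eq_lintegral_enorm,
      ← integral_norm_eq_lintegral_enorm hi.1]
    rfl
  -- A measurable version of `F`; it agrees with `F` at almost every time on almost every orbit.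
  set G : Torus → ℂ := hF.1.1.1.mk F with hG
  have hFG : F =ᵐ[haarTorus] G := hF.1.1.1.ae_eq_mk
  have hGm : Measurable G := hF.1.1.1.stronglyMeasurable_mk.measurable
  have hkm : Measurable fun τ : ℝ => ENNReal.ofReal (1 + τ ^ 2)⁻¹ := by fun_prop
  have hkfin : ∫⁻ τ : ℝ, ENNReal.ofReal (1 + τ ^ 2)⁻¹ ≠ ⊤ := by
    have := integrable_inv_one_add_sq.2
    rw [hasFiniteIntegral_iff_ofReal (.of_forall fun τ => by positivity)] at this
    exact this.ne
  set u : ℕ → Torus → ENNReal := fun j χ => ‖torusPoly (P (φ j)) χ - G χ‖ₑ with hu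
  have hum : ∀ j, Measurable (u j) := fun j =>
    ((torusPoly (P (φ j))).continuous.measurable.sub hGm).enorm
  set V : ℕ → Torus → ENNReal := fun j χ =>
    ∫⁻ τ, u j (χ * kronecker τ) * ENNReal.ofReal (1 + τ ^ 2)⁻¹ with hV
  have hVm : ∀ j, Measurable (V j) := fun j =>
    Measurable.lintegral_prod_right (((hum j).comp continuous_flow.measurable).mul
      (hkm.comp measurable_snd))
  have hVint : ∀ j, ∫⁻ χ, V j χ ∂haarTorus ≤
      ENNReal.ofReal ((1 / 2) ^ j) * ∫⁻ τ : ℝ, ENNReal.ofReal (1 + τ ^ 2)⁻¹ := fun j => by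
    rw [hV, lintegral_lintegral_flow (hum j) hkm]
    gcongr
    refine le_trans (le_of_eq ?_) (hφle j)
    rw [eLpNorm_one_eq_lintegral_enorm]
    refine lintegral_congr_ae ?_
    filter_upwards [hFG] with χ hχ
    rw [hu, Pi.sub_apply, hχ]
  have hfin : ∫⁻ χ, ∑' j, V j χ ∂haarTorus ≠ ⊤ := by
    rw [lintegral_tsum fun j => (hVm j).aemeasurable]
    refine ((ENNReal.tsum_le_tsum hVint).trans_lt ?_).ne
    rw [ENNReal.tsum_mul_right, ← ENNReal.ofReal_tsum_of_nonneg (fun j => by positivity)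
      (summable_geometric_of_lt_one (by norm_num) (by norm_num))]
    exact ENNReal.mul_lt_top ENNReal.ofReal_lt_top hkfin.lt_top
  filter_upwards [ae_lt_top (Measurable.tsum hVm) hfin, ae_orbit_ae_eq hFG] with χ h1 h2
  have hom : Measurable (orbit G χ) :=
    hGm.comp (continuous_const.mul continuous_kronecker).measurable
  refine ⟨hom.aestronglyMeasurable.congr h2.symm, ?_⟩
  refine (ENNReal.tendsto_atTop_zero_of_tsum_ne_top h1.ne).congr fun j => lintegral_congr_ae ?_
  filter_upwards [h2] with τ hτ
  rw [hτ]; rfl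

lemma differentiable_twistedPoly (P : ℕ+ →₀ ℂ) (χ : Torus) :
    Differentiable ℂ (twistedPoly P χ) := by
  unfold twistedPoly verticalTerm
  refine Differentiable.fun_sum fun n _ => Differentiable.const_mul ?_ _
  exact Differentiable.const_cpow (by fun_prop) (Or.inl (by exact_mod_cast n.ne_zero))

lemma isOpen_halfPlane (κ : ℝ) : IsOpen (halfPlane κ) :=
  isOpen_lt continuous_const Complex.continuous_re

lemma enorm_twistedPoly_sub_poissonIntegral_le {F : Torus → ℂ} {χ : Torus}
    (hm : AEStronglyMeasurable (orbit F χ)) (P : ℕ+ →₀ ℂ) {s : ℂ} (hs : 0 < s.re)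
    (hfin : ∫⁻ τ, ‖orbit (torusPoly P) χ τ - orbit F χ τ‖ₑ * ENNReal.ofReal (1 + τ ^ 2)⁻¹ ≠ ⊤) :
    ‖twistedPoly P χ s - poissonIntegral F χ s‖ₑ ≤ ENNReal.ofReal (poissonBound s) *
      ∫⁻ τ, ‖orbit (torusPoly P) χ τ - orbit F χ τ‖ₑ * ENNReal.ofReal (1 + τ ^ 2)⁻¹ := by
  have hoc : Continuous (orbit (torusPoly P) χ) :=
    (torusPoly P).continuous.comp (continuous_const.mul continuous_kronecker)
  have hPi : Integrable fun τ => orbit (torusPoly P) χ τ * (poissonKernelHP s τ : ℂ) :=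
    (integrable_poissonKernelHP hs).ofReal.bdd_mul (c := ‖torusPoly P‖) hoc.aestronglyMeasurable
      (.of_forall fun τ => (torusPoly P).norm_coe_le_norm _)
  have hle : ∫⁻ τ, ‖(orbit (torusPoly P) χ τ - orbit F χ τ) * (poissonKernelHP s τ : ℂ)‖ₑ ≤
      ENNReal.ofReal (poissonBound s) *
      ∫⁻ τ, ‖orbit (torusPoly P) χ τ - orbit F χ τ‖ₑ * ENNReal.ofReal (1 + τ ^ 2)⁻¹ := by
    rw [← lintegral_const_mul' _ _ ENNReal.ofReal_ne_top]
    refine lintegral_mono fun τ => ?_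
    rw [enorm_mul, ← ofReal_norm (poissonKernelHP s τ : ℂ), Complex.norm_real,
      Real.norm_of_nonneg (poissonKernelHP_nonneg hs τ), mul_left_comm,
      ← ENNReal.ofReal_mul (poissonBound_nonneg hs)]
    gcongr
    exact poissonKernelHP_le hs τ
  have hdi : Integrable fun τ =>
      (orbit (torusPoly P) χ τ - orbit F χ τ) * (poissonKernelHP s τ : ℂ) :=
    ⟨(hoc.aestronglyMeasurable.sub hm).mul
      (Complex.continuous_ofReal.comp (continuous_poissonKernelHP hs)).aestronglyMeasurable,
      hle.trans_lt (ENNReal.mul_lt_top ENNReal.ofReal_lt_top hfin.lt_top)⟩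
  have hFi : Integrable fun τ => orbit F χ τ * (poissonKernelHP s τ : ℂ) :=
    (hPi.sub hdi).congr (.of_forall fun τ => by simp [sub_mul])
  rw [← poissonIntegral_torusPoly P χ hs, poissonIntegral, poissonIntegral, ← integral_sub hPi hFi]
  simp only [← sub_mul]
  exact (enorm_integral_le_lintegral_enorm _).trans hle

/-- The twisted Dirichlet polynomials converge locally uniformly in `Re s > 0` to the Poisson integral,
and in `Re s > 1/2` to the vertical limit function. -/
lemma isContinuation_of_tendsto_orbit {Q : ℕ → ℕ+ →₀ ℂ} {a : ℕ+ → ℂ} {F : Torus → ℂ} {χ : Torus}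
    (hF : Integrable F haarTorus) (ha : ∀ n, Tendsto (fun k => Q k n) atTop (𝓝 (a n)))
    (hQ : Tendsto (fun k => ∫ χ, ‖torusPoly (Q k) χ - F χ‖ ∂haarTorus) atTop (𝓝 0))
    (hm : AEStronglyMeasurable (orbit F χ))
    (hχ : Tendsto (fun k => ∫⁻ τ, ‖orbit (torusPoly (Q k)) χ τ - orbit F χ τ‖ₑ *
          ENNReal.ofReal (1 + τ ^ 2)⁻¹) atTop (𝓝 0)) :
    IsContinuationOfVerticalLimit a χ (poissonIntegral F χ) := by
  have hev : ∀ᶠ k in atTop, ∫⁻ τ, ‖orbit (torusPoly (Q k)) χ τ - orbit F χ τ‖ₑ *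
      ENNReal.ofReal (1 + τ ^ 2)⁻¹ ≠ ⊤ :=
    (hχ.eventually_lt_const ENNReal.zero_lt_top).mono fun k hk => hk.ne
  have hloc : TendstoLocallyUniformlyOn (fun k => twistedPoly (Q k) χ) (poissonIntegral F χ) atTop
      (halfPlane 0) := by
    rw [tendstoLocallyUniformlyOn_iff_forall_isCompact (isOpen_halfPlane 0)]
    intro K hK hKc
    have hcont : ContinuousOn poissonBound K := by
      unfold poissonBound
      refine ContinuousOn.div_const (ContinuousOn.add (ContinuousOn.div ?_ ?_ fun s hs => ?_) ?_) _
      · exact Continuous.continuousOn (by fun_prop)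
      · exact Complex.continuous_re.continuousOn
      · exact (ne_of_gt (hK hs : 0 < s.re))
      · exact Continuous.continuousOn (by fun_prop)
    obtain ⟨B, hB⟩ := hKc.bddAbove_image hcont
    have hlim : Tendsto (fun k => ENNReal.ofReal B *
        ∫⁻ τ, ‖orbit (torusPoly (Q k)) χ τ - orbit F χ τ‖ₑ * ENNReal.ofReal (1 + τ ^ 2)⁻¹) atTop
        (𝓝 0) := by
      simpa using ENNReal.Tendsto.const_mul hχ (Or.inr ENNReal.ofReal_ne_top)
    rw [EMetric.tendstoUniformlyOn_iff]
    intro ε hε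
    filter_upwards [hev, hlim.eventually_lt_const hε] with k hk hkε s hs
    rw [edist_comm, edist_eq_enorm_sub]
    refine ((enorm_twistedPoly_sub_poissonIntegral_le hm (Q k) (hK hs) hk).trans ?_).trans_lt hkε
    gcongr
    exact hB (mem_image_of_mem _ hs)
  refine ⟨?_, fun s hs => ?_⟩
  · refine DifferentiableOn.analyticOnNhd ?_ (isOpen_halfPlane 0)
    exact hloc.differentiableOn
      (.of_forall fun k => (differentiable_twistedPoly (Q k) χ).differentiableOn)
      (isOpen_halfPlane 0)
  · obtain ⟨h1, h2⟩ := summable_and_tendsto_twistedPoly hF ha hQ χ hs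
    have hs0 : s ∈ halfPlane 0 := lt_trans (by norm_num) (show (1 / 2 : ℝ) < s.re from hs)
    exact ⟨h1, tendsto_nhds_unique (hloc.tendsto_at hs0) h2⟩

theorem ae_isContinuationOfVerticalLimit {p : ℝ} (hp : 1 ≤ p) {a : ℕ+ → ℂ} (ha : MemHp p a)
    {F : Torus → ℂ} (hF : IsBohrLift p a F) :
    ∀ᵐ χ ∂haarTorus, IsContinuationOfVerticalLimit a χ (poissonIntegral F χ) := by
  obtain ⟨Q, h1, h2, h3⟩ := exists_ae_tendsto_orbit hp ha hF
  have hFi : Integrable F haarTorus :=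
    hF.1.1.integrable (by simpa using ENNReal.ofReal_le_ofReal hp)
  filter_upwards [h3] with χ hχ
  exact isContinuation_of_tendsto_orbit hFi h1 h2 hχ.1 hχ.2

/-! ### Invariance along the flow -/

lemma orbit_mul_kronecker (F : Torus → ℂ) (χ : Torus) (t τ : ℝ) :
    orbit F (χ * kronecker t) τ = orbit F χ (τ + t) := by
  rw [orbit, orbit, mul_assoc, ← kronecker_add, add_comm]

lemma poissonIntegral_mul_kronecker (F : Torus → ℂ) (χ : Torus) (t : ℝ) (s : ℂ) :
    poissonIntegral F (χ * kronecker t) s = poissonIntegral F χ (s + t * Complex.I) := by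
  unfold poissonIntegral
  rw [← integral_add_right_eq_self (fun τ : ℝ => orbit F χ τ *
    (poissonKernelHP (s + t * Complex.I) τ : ℂ)) t]
  refine integral_congr_ae (.of_forall fun τ => ?_)
  beta_reduce
  rw [orbit_mul_kronecker]
  congr 2
  simp [poissonKernelHP]

lemma add_mul_I_mem_halfPlane {κ : ℝ} {s : ℂ} (hs : s ∈ halfPlane κ) (t : ℝ) :
    s + t * Complex.I ∈ halfPlane κ := by
  simpa [halfPlane] using hs

lemma isContinuation_mul_kronecker {a : ℕ+ → ℂ} {F : Torus → ℂ} {χ : Torus}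
    (h : IsContinuationOfVerticalLimit a χ (poissonIntegral F χ)) (t : ℝ) :
    IsContinuationOfVerticalLimit a (χ * kronecker t) (poissonIntegral F (χ * kronecker t)) := by
  have e : poissonIntegral F (χ * kronecker t) =
      fun s => poissonIntegral F χ (s + t * Complex.I) :=
    funext (poissonIntegral_mul_kronecker F χ t)
  refine ⟨?_, fun s hs => ?_⟩
  · rw [e]
    intro s hs
    exact (h.1 _ (add_mul_I_mem_halfPlane hs t)).comp_of_eq (by fun_prop) rfl
  · simp only [verticalTerm_mul_kronecker, poissonIntegral_mul_kronecker]
    exact h.2 _ (add_mul_I_mem_halfPlane hs t)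

lemma isContinuation_mul_kronecker_iff {a : ℕ+ → ℂ} {F : Torus → ℂ} {χ : Torus} (t : ℝ) :
    IsContinuationOfVerticalLimit a (χ * kronecker t) (poissonIntegral F (χ * kronecker t)) ↔
      IsContinuationOfVerticalLimit a χ (poissonIntegral F χ) := by
  refine ⟨fun h => ?_, fun h => isContinuation_mul_kronecker h t⟩
  have := isContinuation_mul_kronecker h (-t)
  rwa [mul_assoc, ← kronecker_add, add_neg_cancel, kronecker_zero, mul_one] at this

lemma notMem_ergodicSet_of_orbit_eq_const {p c : ℝ} (hc : 0 ≤ c) {a : ℕ+ → ℂ}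
    (hne : c ^ p ≠ hpNorm p a ^ p) {G : Torus → ℂ} {χ : Torus} (hG : ∀ τ, orbit G χ τ = c) :
    χ ∉ ergodicSet p a G := by
  rintro ⟨-, h⟩
  refine hne (tendsto_nhds_unique (tendsto_const_nhds.congr' ?_) h)
  filter_upwards [eventually_gt_atTop 0] with T hT
  simp only [hG, Complex.norm_real, Real.norm_of_nonneg hc, intervalIntegral.integral_const,
    smul_eq_mul]
  field_simp
  ring

/-- The representative can be chosen to be constant on the invariant null set where the continuation
fails. The constant is chosen so that this null set avoids `E_f`. -/
theorem exists_representative {p : ℝ} (hp : 1 ≤ p) {a : ℕ+ → ℂ} {F : Torus → ℂ}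
    (hae : ∀ᵐ χ ∂haarTorus, IsContinuationOfVerticalLimit a χ (poissonIntegral F χ)) :
    ∃ G : Torus → ℂ, G =ᵐ[haarTorus] F ∧ ∀ χ ∈ ergodicSet p a G,
      IsContinuationOfVerticalLimit a χ (poissonIntegral G χ) := by
  classical
  have hp0 : p ≠ 0 := by linarith
  obtain ⟨c, hc0, hc⟩ : ∃ c : ℝ, 0 ≤ c ∧ c ^ p ≠ hpNorm p a ^ p := by
    by_cases h : hpNorm p a ^ p = 0
    · exact ⟨1, zero_le_one, by rw [h, Real.one_rpow]; exact one_ne_zero⟩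
    · exact ⟨0, le_rfl, by rw [Real.zero_rpow hp0]; exact Ne.symm h⟩
  set G : Torus → ℂ := fun χ =>
    if IsContinuationOfVerticalLimit a χ (poissonIntegral F χ) then F χ else c with hG
  refine ⟨G, ?_, fun χ hχ => ?_⟩
  · filter_upwards [hae] with χ hχ
    exact if_pos hχ
  by_cases h : IsContinuationOfVerticalLimit a χ (poissonIntegral F χ)
  · have ho : orbit G χ = orbit F χ := funext fun τ =>
      if_pos ((isContinuation_mul_kronecker_iff τ).2 h)
    have e : poissonIntegral G χ = poissonIntegral F χ := by
      unfold poissonIntegral; rw [ho]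
    rwa [e]
  · exact absurd hχ (notMem_ergodicSet_of_orbit_eq_const hc0 hc fun τ =>
      if_neg fun h' => h ((isContinuation_mul_kronecker_iff τ).1 h'))

end DirichletHardy

end

theorem theorem1p2 (p : ℝ) (hp : 1 ≤ p) (a : ℕ+ → ℂ) (ha : MemHp p a)
    (F : Torus → ℂ) (hF : IsBohrLift p a F) :
    -- the set `E_f` has full measure
    (∀ᵐ χ ∂haarTorus, χ ∈ ergodicSet p a F) ∧
    -- for every `χ` in `E_f`, the Poisson integral converges absolutely in `ℂ_0`, the constant
    -- `C_f(χ)` exists, and the Poisson integral satisfies the estimate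
    (∀ χ ∈ ergodicSet p a F,
      (∀ s ∈ halfPlane 0,
        Integrable (fun τ : ℝ => orbit F χ τ * (poissonKernelHP s τ : ℂ)) volume) ∧
      IsLeast (growthBounds p F χ) (growthConst p F χ) ∧
      (⨆ (σ : ℝ) (_ : 0 < σ) (T : ℝ) (_ : 1 ≤ T),
        ENNReal.ofReal (1 / (2 * T)) *
          ∫⁻ t in Icc (-T) T, ‖poissonIntegral F χ (σ + t * Complex.I)‖ₑ ^ p)
        ≤ ENNReal.ofReal (6 * growthConst p F χ)) ∧
    -- for almost every `χ` in `E_f`, the Poisson integral is analytic in `ℂ_0` and coincides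
    -- with `f_χ` in `ℂ_{1/2}`
    (∀ᵐ χ ∂haarTorus, χ ∈ ergodicSet p a F →
      IsContinuationOfVerticalLimit a χ (poissonIntegral F χ)) ∧
    -- for a suitable representative of `f^*`, this holds for every `χ` in `E_f`
    (∃ G : Torus → ℂ, G =ᵐ[haarTorus] F ∧
      ∀ χ ∈ ergodicSet p a G,
        IsContinuationOfVerticalLimit a χ (poissonIntegral G χ)) := by
  have hae := ae_isContinuationOfVerticalLimit hp ha hF
  exact ⟨ae_mem_ergodicSet hp ha hF, fun χ hχ =>
    ⟨fun s hs => integrable_orbit_of_mem_ergodicSet hp hχ hs, isLeast_growthConst hp hχ,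
      iSup_mean_poissonIntegral_le hp hχ⟩,
    hae.mono fun χ h _ => h, exists_representative hp hae⟩
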